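/- Let $\Omega\subset\mathbb{R}^2$ be a bounded polygonal domain (open, connected, with Lipschitz boundary, admitting a conforming triangulation), let $\partial\Omega_D\subset\partial\Omega$ be closed with positive length, and let $\partial\Omega_N=\partial\Omega\setminus\partial\Omega_D$. Let $V=H^1(\Omega;\mathbb{C})$ with its usual norm, and let $V_0$ be the space of functions of $V$ with zero trace on $\partial\Omega_D$. Let $H^{1/2}(\partial\Omega_D;\mathbb{R})$ be the space of traces on $\partial\Omega_D$ of functions of $H^1(\Omega;\mathbb{R})$, with the quotient norm $\|\xi_D\|=\inf\{\|v\|_{H^1(\Omega)} : v=\xi_D \text{ on }\partial\Omega_D\}$. **Coefficients.** Let $\alpha\le 0\le\beta$, $\mu_1(\xi)=\cos\xi-\alpha\sin\xi$, $\mu_2(\xi)=\cos\xi+\beta\sin\xi$, $\Gamma_{12}=-\mu_1'/\mu_2$, $\Gamma_{21}=\mu_2'/\mu_1$. Let $\xi^-\in[-\frac\pi2,0]$, $\xi^+\in[0,\frac\pi2]$; for a function $G$ let $\widehat G(\xi)=G(\xi^+)$ if $\xi\ge\xi^+$, $\widehat G(\xi)=G(\xi^-)$ if $\xi\le\xi^-$,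 and $\widehat G(\xi)=G(\xi)$ otherwise. Let $\hat B(\xi)=\mathrm{diag}\big(-\widehat{\Gamma_{21}}(\xi),\widehat{\Gamma_{12}}(\xi)\big)$, and assume that $\xi^\pm$ are such that all entries of $\hat B(\xi)$, $\xi\in\mathbb{R}$, are bounded in absolute value by a constant $M>0$. For $\varepsilon>0$, real $\xi$ and $g\in L^2(\partial\Omega_N;\mathbb{R})$ put $$a_\varepsilon(\xi;\zeta,\tilde\zeta)=\int_\Omega(\hat B(\xi)+i\varepsilon I)\nabla\zeta\cdot\overline{\nabla\tilde\zeta},\qquad l(\tilde\zeta)=\int_{\partial\Omega_N}g\,\overline{\tilde\zeta}.$$ **Discretization.** Let $(\mathcal{T}_h)_h$ be a shape-regular and quasi-uniform family of conforming triangulations of $\Omega$ and let $V_h$ be the space of complex continuous functions on $\overline\Omega$ that are affine on each triangle of $\mathcal{T}_h$. Let $\mathcal{I}_h$ be a Scott--Zhang interpolation operator: each vertex $a$ is assigned an edge $F_a\ni a$ of $\mathcal{T}_h$, with $F_a\subset\partial\Omega$ if $a\in\partial\Omega$, and $\mathcal{I}_hv$ is the continuous piecewise affine function whose value at $a$ is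 $\int_{F_a}\psi_a v$, where $\psi_a$ is the affine function on $F_a$ with $\int_{F_a}\psi_a p=p(a)$ for all affine $p$. For $\xi_D\in H^{1/2}(\partial\Omega_D;\mathbb{R})$ and $\zeta_D\in H^1(\Omega;\mathbb{R})$ with $\zeta_D=\xi_D$ on $\partial\Omega_D$ let $$V_{hD}=\{\zeta_h\in V_h:\ \Re\zeta_h=\mathcal{I}_h\zeta_D,\ \Im\zeta_h=0\text{ on }\partial\Omega_D\},\qquad V_{h0}=\{\zeta_h\in V_h:\ \zeta_h=0\text{ on }\partial\Omega_D\}.$$ **Claim.** For every $\xi_h\in V_{hD}$ there is a unique $\zeta_h\in V_{hD}$ with $$a_\varepsilon(\Re\xi_h;\zeta_h,\tilde\zeta_h)=l(\tilde\zeta_h)\qquad\text{for all }\tilde\zeta_h\in V_{h0}.$$ Moreover, there are constants $C,C_{tr}>0$, depending only on $\Omega$ and $\partial\Omega_D$, and $C'>0$, depending in addition only on the family of triangulations (in particular, $C,C_{tr},C'$ do not depend on $h$, on the assignments $a\mapsto F_a$, or on $\alpha,\beta,\xi^\pm,M,\varepsilon,\xi_D,\zeta_D,g,\xi_h$), such that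 1. $C$ is a Poincaré constant: $\|v\|_{L^2(\Omega)}^2\le C\|\nabla v\|_{L^2(\Omega)}^2$ for all $v\in V_0$; 2. $C_{tr}$ is a lifting constant: each $\xi_D\in H^{1/2}(\partial\Omega_D;\mathbb{R})$ has a $\zeta_D\in H^1(\Omega;\mathbb{R})$ with $\zeta_D=\xi_D$ on $\partial\Omega_D$ and $\|\zeta_D\|_{H^1}\le C_{tr}\|\xi_D\|_{H^{1/2}(\partial\Omega_D)}$; 3. $C'$ is an interpolation constant: $\|\mathcal{I}_hv\|_{H^1}\le C'\|v\|_{H^1}$ for all $v\in H^1(\Omega;\mathbb{R})$ and all $h$; 4. the solution $\zeta_h$ satisfies $$\|\zeta_h\|_V\le C'C_{tr}\Big(1+\frac{M\sqrt{1+C}}{\varepsilon}\Big)\|\xi_D\|_{H^{1/2}(\partial\Omega_D)}+\frac{\sqrt{1+C}}{\varepsilon}\|g\|_{L^2(\partial\Omega_N)}$$ whenever $\zeta_D$ is a lift as in 2, and also, for an arbitrary lift $\zeta_D$, whenever $\partial\Omega_D$ is a union of edges of $\mathcal{T}_h$ and $F_a\subset\partial\Omega_D$ for every vertex $a\in\partial\Omega_D$.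 -/

import Mathlib

open MeasureTheory Filter Topology
open scoped ContDiff Matrix

noncomputable section

namespace Kirigami

/-- The Euclidean plane. -/
abbrev Plane : Type := EuclideanSpace ℝ (Fin 2)

/-! ### Sobolev functions on an open set of the plane -/

section Sobolev

variable {𝕜 : Type*} [RCLike 𝕜]

/-- `g` is the weak partial derivative of `u` on `Ω` in the `i`-th direction. -/
def HasWeakPartial (Ω : Set Plane) (i : Fin 2) (u g : Plane → 𝕜) : Prop :=
  ∀ φ : Plane → ℝ, ContDiff ℝ ∞ φ → HasCompactSupport φ → tsupport φ ⊆ Ω →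
    ∫ x in Ω, (fderiv ℝ φ x (EuclideanSpace.single i 1)) • u x = -∫ x in Ω, φ x • g x

/-- Membership in `H¹(Ω; 𝕜)`. -/
def MemH1 (Ω : Set Plane) (u : Plane → 𝕜) : Prop :=
  MemLp u 2 (volume.restrict Ω) ∧
    ∀ i, ∃ g : Plane → 𝕜, MemLp g 2 (volume.restrict Ω) ∧ HasWeakPartial Ω i u g

open Classical in
/-- The square integrable weak partial derivative of `u` (unique almost everywhere on `Ω`), with
the value `0` if there is none. -/
def weakPartial (Ω : Set Plane) (i : Fin 2) (u : Plane → 𝕜) : Plane → 𝕜 :=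
  if h : ∃ g : Plane → 𝕜, MemLp g 2 (volume.restrict Ω) ∧ HasWeakPartial Ω i u g
  then h.choose else 0

/-- The weak gradient. -/
def weakGrad (Ω : Set Plane) (u : Plane → 𝕜) (x : Plane) : Fin 2 → 𝕜 :=
  fun i => weakPartial Ω i u x

/-- The `L²` norm with respect to `μ`. -/
def l2Norm (μ : Measure Plane) (u : Plane → 𝕜) : ℝ := (eLpNorm u 2 μ).toReal

/-- The `L²(Ω)` norm of the weak gradient. -/
def gradNorm (Ω : Set Plane) (u : Plane → 𝕜) : ℝ :=
  √(∑ i, l2Norm (volume.restrict Ω) (weakPartial Ω i u) ^ 2)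

/-- The usual norm of `H¹(Ω; 𝕜)`. -/
def h1Norm (Ω : Set Plane) (u : Plane → 𝕜) : ℝ :=
  √(l2Norm (volume.restrict Ω) u ^ 2 + gradNorm Ω u ^ 2)

/-! ### Traces

The trace is the closure of the restriction of smooth functions, with respect to convergence in
`H¹(Ω)` and in `L²(S)`, where curves carry the arc length `μH[1]`. -/

/-- `w` is the trace of `v ∈ H¹(Ω)` on the curve `S`. -/
def HasTraceOn (Ω S : Set Plane) (v w : Plane → 𝕜) : Prop :=
  MemH1 Ω v ∧ MemLp w 2 ((μH[1] : Measure Plane).restrict S) ∧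
    ∃ φ : ℕ → Plane → 𝕜, (∀ n, ContDiff ℝ ∞ (φ n)) ∧
      Tendsto (fun n => eLpNorm (φ n - v) 2 (volume.restrict Ω)) atTop (𝓝 0) ∧
      (∀ i, Tendsto (fun n => eLpNorm
        (fun x => fderiv ℝ (φ n) x (EuclideanSpace.single i 1) - weakPartial Ω i v x) 2
        (volume.restrict Ω)) atTop (𝓝 0)) ∧
      Tendsto (fun n => eLpNorm (φ n - w) 2 ((μH[1] : Measure Plane).restrict S)) atTop (𝓝 0)

open Classical in
/-- The trace of `v` on `S` (unique almost everywhere on edges of a triangulation of `Ω`). -/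
def traceOn (Ω S : Set Plane) (v : Plane → 𝕜) : Plane → 𝕜 :=
  if h : ∃ w, HasTraceOn Ω S v w then h.choose else 0

end Sobolev

/-- The real functions of `H¹(Ω; ℝ)` with trace `ξD` on `ΓD`. -/
def lifts (Ω ΓD : Set Plane) (ξD : Plane → ℝ) : Set (Plane → ℝ) :=
  {v | HasTraceOn Ω ΓD v ξD}

/-- Membership in `H^{1/2}(ΓD; ℝ)`, the space of traces on `ΓD` of functions of `H¹(Ω; ℝ)`. -/
def MemHHalf (Ω ΓD : Set Plane) (ξD : Plane → ℝ) : Prop := (lifts Ω ΓD ξD).Nonempty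

/-- The (quotient) norm of the trace space `H^{1/2}(ΓD; ℝ)`. -/
def hHalfNorm (Ω ΓD : Set Plane) (ξD : Plane → ℝ) : ℝ := sInf (h1Norm Ω '' lifts Ω ΓD ξD)

/-- `V₀`: the functions of `H¹(Ω; ℂ)` that vanish on `ΓD`. -/
def V0 (Ω ΓD : Set Plane) : Set (Plane → ℂ) := {v | HasTraceOn Ω ΓD v 0}

/-! ### Triangulations -/

/-- A conforming triangulation of `Ω` by finitely many nondegenerate closed triangles, each given
by its set of three vertices. -/
structure Triangulation (Ω : Set Plane) where
  /-- the triangles -/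
  cells : Finset (Finset Plane)
  card_eq : ∀ K ∈ cells, K.card = 3
  indep : ∀ K ∈ cells, AffineIndependent ℝ ((↑) : K → Plane)
  cover : ⋃ K ∈ cells, convexHull ℝ (K : Set Plane) = closure Ω
  inter : ∀ K ∈ cells, ∀ L ∈ cells,
    convexHull ℝ (K : Set Plane) ∩ convexHull ℝ (L : Set Plane) ⊆
      convexHull ℝ ((K : Set Plane) ∩ (L : Set Plane))

namespace Triangulation

variable {Ω : Set Plane}

/-- The vertices of the triangulation. -/
def vertices (𝒯 : Triangulation Ω) : Set Plane := {a | ∃ K ∈ 𝒯.cells, a ∈ K}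

/-- The space of `𝕜`-valued continuous functions on the closure of `Ω` that are affine on each
triangle. Outside the closure of `Ω` the functions are given the value `0`. -/
def P1 (𝒯 : Triangulation Ω) (𝕜 : Type*) [RCLike 𝕜] : Set (Plane → 𝕜) :=
  {u | ContinuousOn u (closure Ω) ∧
    (∀ K ∈ 𝒯.cells, ∃ A : Plane →ᵃ[ℝ] 𝕜, Set.EqOn u A (convexHull ℝ (K : Set Plane))) ∧
    ∀ x, x ∉ closure Ω → u x = 0}

theorem exists_affineMap {𝕜 : Type*} [RCLike 𝕜] (𝒯 : Triangulation Ω) {K : Finset Plane}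
    (hK : K ∈ 𝒯.cells) (c : Plane → 𝕜) : ∃ A : Plane →ᵃ[ℝ] 𝕜, ∀ a ∈ K, A a = c a := by
  have htop : affineSpan ℝ (Set.range ((↑) : K → Plane)) = ⊤ := by
    rw [(𝒯.indep K hK).affineSpan_eq_top_iff_card_eq_finrank_add_one]
    simp [𝒯.card_eq K hK]
  let b : AffineBasis K ℝ Plane := ⟨(↑), 𝒯.indep K hK, htop⟩
  refine ⟨∑ i : K, (LinearMap.toSpanSingleton ℝ 𝕜 (c i)).toAffineMap.comp (b.coord i), ?_⟩
  intro a ha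
  have h : ∀ i : K, b.coord i a = if i = ⟨a, ha⟩ then 1 else 0 := fun i =>
    b.coord_apply i ⟨a, ha⟩
  have : (∑ i : K, (LinearMap.toSpanSingleton ℝ 𝕜 (c i)).toAffineMap.comp (b.coord i)) a
      = ∑ i : K, (b.coord i a) • c i := by
    have := map_sum (AddMonoidHom.mk' (fun A : Plane →ᵃ[ℝ] 𝕜 => A a) (by intros; rfl))
      (fun i : K => (LinearMap.toSpanSingleton ℝ 𝕜 (c i)).toAffineMap.comp (b.coord i)) Finset.univ
    exact this
  rw [this]
  simp [h]

theorem convexHull_subset_closure (𝒯 : Triangulation Ω) {K : Finset Plane} (hK : K ∈ 𝒯.cells) :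
    convexHull ℝ (K : Set Plane) ⊆ closure Ω := by
  rw [← 𝒯.cover]
  exact Set.subset_biUnion_of_mem (u := fun K : Finset Plane => convexHull ℝ (K : Set Plane)) hK

/-- Nodal values determine a continuous piecewise affine function. -/
theorem exists_nodal {𝕜 : Type*} [RCLike 𝕜] (𝒯 : Triangulation Ω) (c : Plane → 𝕜) :
    ∃ u ∈ 𝒯.P1 𝕜, ∀ a ∈ 𝒯.vertices, u a = c a := by
  classical
  choose! A hA using fun (K : Finset Plane) (hK : K ∈ 𝒯.cells) => 𝒯.exists_affineMap hK c
  have agree : ∀ K ∈ 𝒯.cells, ∀ L ∈ 𝒯.cells, ∀ x ∈ convexHull ℝ (K : Set Plane),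
      x ∈ convexHull ℝ (L : Set Plane) → A K x = A L x := by
    intro K hK L hL x hxK hxL
    have hconv : Convex ℝ {x | A K x = A L x} := by
      intro x hx y hy s t hs ht hst
      change A K x = A L x at hx
      change A K y = A L y at hy
      change A K (s • x + t • y) = A L (s • x + t • y)
      rw [Convex.combo_affine_apply hst, Convex.combo_affine_apply hst, hx, hy]
    exact convexHull_min (fun a ha => by
      change A K a = A L a
      rw [hA K hK a ha.1, hA L hL a ha.2]) hconv (𝒯.inter K hK L hL ⟨hxK, hxL⟩)
  let u : Plane → 𝕜 := fun x =>
    if h : ∃ K ∈ 𝒯.cells, x ∈ convexHull ℝ (K : Set Plane) then A h.choose x else 0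
  have hu : ∀ K ∈ 𝒯.cells, Set.EqOn u (A K) (convexHull ℝ (K : Set Plane)) := by
    intro K hK x hx
    have h : ∃ K ∈ 𝒯.cells, x ∈ convexHull ℝ (K : Set Plane) := ⟨K, hK, hx⟩
    simp only [u, dif_pos h]
    exact agree _ h.choose_spec.1 K hK x h.choose_spec.2 hx
  refine ⟨u, ⟨?_, fun K hK => ⟨A K, hu K hK⟩, ?_⟩, ?_⟩
  · have hcov : closure Ω = ⋃ K : 𝒯.cells, convexHull ℝ ((K : Finset Plane) : Set Plane) := by
      rw [← 𝒯.cover]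
      ext x
      simp
    rw [hcov]
    refine (locallyFinite_of_finite _).continuousOn_iUnion (fun K => ?_) (fun K => ?_)
    · exact ((K : Finset Plane).finite_toSet.isCompact_convexHull (𝕜 := ℝ)).isClosed
    · exact ((A K).continuous_of_finiteDimensional.continuousOn).congr (hu K K.2)
  · intro x hx
    have h : ¬ ∃ K ∈ 𝒯.cells, x ∈ convexHull ℝ (K : Set Plane) := by
      rintro ⟨K, hK, hxK⟩
      exact hx (𝒯.convexHull_subset_closure hK hxK)
    simp only [u, dif_neg h]
  · rintro a ⟨K, hK, ha⟩
    rw [hu K hK (subset_convexHull ℝ _ ha), hA K hK a ha]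

/-- The continuous piecewise affine function with the nodal values `c`. -/
def nodalInterp {𝕜 : Type*} [RCLike 𝕜] (𝒯 : Triangulation Ω) (c : Plane → 𝕜) : Plane → 𝕜 :=
  (𝒯.exists_nodal c).choose

/-- The choice that enters the definition of the Scott--Zhang operator: each vertex `a` is assigned
an edge `[a, nbr a]` of the triangulation, which lies on the boundary if `a` does. -/
structure EdgeChoice (𝒯 : Triangulation Ω) where
  /-- the other end point of the edge assigned to a vertex -/
  nbr : Plane → Plane
  ne : ∀ a ∈ 𝒯.vertices, nbr a ≠ a
  edge : ∀ a ∈ 𝒯.vertices, ∃ K ∈ 𝒯.cells, a ∈ K ∧ nbr a ∈ K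
  boundary : ∀ a ∈ 𝒯.vertices, a ∈ frontier Ω → segment ℝ a (nbr a) ⊆ frontier Ω

/-- The Scott--Zhang nodal value at `a`: the mean of the trace of `v` on the edge `[a, b]`,
`b = nbr a`, against the affine function that is dual to the barycentric coordinates of the edge
(in the parameter `t ↦ a + t (b - a)` this is `4 - 6 t`: its integral against `1 - t` is `1` and
against `t` is `0`). -/
def scottZhangValue {𝕜 : Type*} [RCLike 𝕜] {𝒯 : Triangulation Ω} (s : 𝒯.EdgeChoice)
    (v : Plane → 𝕜) (a : Plane) : 𝕜 :=
  ∫ t in (0 : ℝ)..1,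
    (4 - 6 * t) • traceOn Ω (segment ℝ a (s.nbr a)) v (AffineMap.lineMap a (s.nbr a) t)

/-- The Scott--Zhang interpolation operator `v ↦ 𝓘ₕ v`. -/
def scottZhang {𝕜 : Type*} [RCLike 𝕜] {𝒯 : Triangulation Ω} (s : 𝒯.EdgeChoice)
    (v : Plane → 𝕜) : Plane → 𝕜 :=
  𝒯.nodalInterp (scottZhangValue s v)

/-- The edge choice is adapted to `ΓD`: `ΓD` is a union of edges, and the edge of a vertex on `ΓD`
is contained in `ΓD`. -/
def EdgeChoice.AdaptedTo {𝒯 : Triangulation Ω} (s : 𝒯.EdgeChoice) (ΓD : Set Plane) : Prop :=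
  (∀ x ∈ ΓD, ∃ K ∈ 𝒯.cells, ∃ a ∈ K, ∃ b ∈ K,
    a ≠ b ∧ x ∈ segment ℝ a b ∧ segment ℝ a b ⊆ ΓD) ∧
  ∀ a ∈ 𝒯.vertices, a ∈ ΓD → segment ℝ a (s.nbr a) ⊆ ΓD

/-- Shape regularity: every triangle contains a disc of radius comparable to its diameter. -/
def ShapeRegular {ι : Type*} (𝒯 : ι → Triangulation Ω) : Prop :=
  ∃ σ : ℝ, 0 < σ ∧ ∀ i, ∀ K ∈ (𝒯 i).cells, ∃ x : Plane,
    Metric.ball x (σ * Metric.diam (K : Set Plane)) ⊆ convexHull ℝ (K : Set Plane)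

/-- Quasi-uniformity: in each triangulation all the diameters are comparable. -/
def QuasiUniform {ι : Type*} (𝒯 : ι → Triangulation Ω) : Prop :=
  ∃ τ : ℝ, 0 < τ ∧ ∀ i, ∀ K ∈ (𝒯 i).cells, ∀ L ∈ (𝒯 i).cells,
    τ * Metric.diam (L : Set Plane) ≤ Metric.diam (K : Set Plane)

/-- `V_{h0}`: the complex piecewise affine functions that vanish on `ΓD`. -/
def Vh0 (𝒯 : Triangulation Ω) (ΓD : Set Plane) : Set (Plane → ℂ) :=
  {ζ | ζ ∈ 𝒯.P1 ℂ ∧ ∀ x ∈ ΓD, ζ x = 0}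

/-- `V_{hD}`: the complex piecewise affine functions whose real part equals `𝓘ₕ ζD` and whose
imaginary part vanishes on `ΓD`. -/
def VhD {𝒯 : Triangulation Ω} (s : 𝒯.EdgeChoice) (ΓD : Set Plane) (ζD : Plane → ℝ) :
    Set (Plane → ℂ) :=
  {ζ | ζ ∈ 𝒯.P1 ℂ ∧ ∀ x ∈ ΓD, (ζ x).re = scottZhang s ζD x ∧ (ζ x).im = 0}

end Triangulation

/-! ### The domain -/

/-- The boundary of `Ω` is locally the graph of a Lipschitz function, with `Ω` on one side. -/
def HasLipschitzBoundary (Ω : Set Plane) : Prop :=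
  ∀ x ∈ frontier Ω, ∃ (e : Plane ≃ₗᵢ[ℝ] Plane) (f : ℝ → ℝ) (L : NNReal) (U : Set Plane),
    U ∈ 𝓝 x ∧ LipschitzWith L f ∧ ∀ y ∈ U, y ∈ Ω ↔ f (e y 0) < e y 1

/-- A bounded polygonal domain with Lipschitz boundary. -/
structure IsPolygonalDomain (Ω : Set Plane) : Prop where
  isOpen : IsOpen Ω
  isConnected : IsConnected Ω
  isBounded : Bornology.IsBounded Ω
  lipschitz : HasLipschitzBoundary Ω
  polygonal : Nonempty (Triangulation Ω)

/-! ### The coefficients for rhombi slits -/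

def mu1 (α ξ : ℝ) : ℝ := Real.cos ξ - α * Real.sin ξ

def mu2 (β ξ : ℝ) : ℝ := Real.cos ξ + β * Real.sin ξ

def Gamma12 (α β ξ : ℝ) : ℝ := -deriv (mu1 α) ξ / mu2 β ξ

def Gamma21 (α β ξ : ℝ) : ℝ := deriv (mu2 β) ξ / mu1 α ξ

/-- The cut-off of a coefficient outside `[ξm, ξp]`. -/
def cutoff (ξm ξp : ℝ) (G : ℝ → ℝ) (ξ : ℝ) : ℝ :=
  if ξp ≤ ξ then G ξp else if ξ ≤ ξm then G ξm else G ξ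

/-- The cut-off matrix `B̂(ξ)`. -/
def Bhat (α β ξm ξp ξ : ℝ) : Matrix (Fin 2) (Fin 2) ℝ :=
  !![-cutoff ξm ξp (Gamma21 α β) ξ, 0; 0, cutoff ξm ξp (Gamma12 α β) ξ]

/-- The regularized form
`a_ε(ξ; ζ, η) = ∫_Ω (B(ξ) + i ε I) ∇ζ ⬝ conj ∇η`, for a matrix field `B`. -/
def regForm (Ω : Set Plane) (B : ℝ → Matrix (Fin 2) (Fin 2) ℝ) (ε : ℝ) (ξ : Plane → ℝ)
    (ζ η : Plane → ℂ) : ℂ :=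
  ∫ x in Ω, (((B (ξ x)).map Complex.ofReal + (Complex.I * ε) • (1 : Matrix (Fin 2) (Fin 2) ℂ))
    *ᵥ weakGrad Ω ζ x) ⬝ᵥ star (weakGrad Ω η x)

/-- The Neumann part of the boundary. -/
def neumannPart (Ω ΓD : Set Plane) : Set Plane := frontier Ω \ ΓD

/-- The arc length on the Neumann part of the boundary. -/
def neumannMeasure (Ω ΓD : Set Plane) : Measure Plane :=
  (μH[1] : Measure Plane).restrict (neumannPart Ω ΓD)

/-- The form `l(η) = ∫_{ΓN} g conj η`, for functions `η` continuous up to the boundary. -/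
def neumannForm (Ω ΓD : Set Plane) (g : Plane → ℝ) (η : Plane → ℂ) : ℂ :=
  ∫ x, (g x : ℂ) * star (η x) ∂(neumannMeasure Ω ΓD)

/-- `ζ ∈ V_{hD}` solves the discrete linear problem
`a_ε(Re ξ; ζ, η) = l(η)` for all `η ∈ V_{h0}`. -/
def IsDiscreteSolution {Ω : Set Plane} {𝒯 : Triangulation Ω} (s : 𝒯.EdgeChoice) (ΓD : Set Plane)
    (B : ℝ → Matrix (Fin 2) (Fin 2) ℝ) (ε : ℝ) (ζD g : Plane → ℝ) (ξ ζ : Plane → ℂ) : Prop :=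
  ζ ∈ Triangulation.VhD s ΓD ζD ∧
    ∀ η ∈ 𝒯.Vh0 ΓD, regForm Ω B ε (fun x => (ξ x).re) ζ η = neumannForm Ω ΓD g η

end Kirigami

end

open Kirigami

noncomputable section

namespace Kirigami

open Set Metric
open scoped ENNReal NNReal

/-! The form is coercive through its imaginary part: the matrix is real and diagonal, so testing
with the function itself gives `Im a = ε ‖∇z‖²`. Write a solution as `ζ = w + z`, where `w` is the
real Scott–Zhang interpolant and `z` vanishes on `ΓD`. On the finite-dimensional space `V_{h0}`
coercivity and the Poincaré inequality make the map from `z` to the functional `a(z; ·)` injective,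
hence bijective, which gives existence and uniqueness. Testing the equation for `z` with `z`, and
bounding the boundary functional by a trace inequality, gives the energy estimate. Stability of the
interpolation then bounds `w` by the lift, and the lift by the quotient norm.

The constants are only asked to be some Poincaré, lifting and interpolation constants, so they may
be enlarged. The trace constant of the Neumann data goes into `C`, all numerical losses go into
`C'`, and the lifting constant is `2` because the infimum in the quotient norm is only approached.
If the edge choice is adapted to `ΓD`, the boundary values of the interpolant depend only on the
trace `ξD`, so an arbitrary lift can be exchanged for a nearly optimal one.

The analysis rests on one device that serves smooth and piecewise affine functions alike: a bound of
increments along segments by the integral of an upper gradient (`IsUpperGradPair`). On a triangle it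
yields a Poincaré inequality (`UpperGradOn.exists_poincare`) and a trace inequality on edges
(`UpperGradOn.edge_le`). Hence each cell has a constant close to the function on the cell and on its
edges, and the constants of cells with a common edge are close to each other. Since the boundary is
Lipschitz, the cells of a triangulation, and also the cells around one vertex, are connected through
common edges (`exists_adjacent`, `exists_adjacent_star`), and cell constants can be compared along
chains.

Chains through one fixed triangulation of `Ω` give the global Poincaré inequality, and its edge
estimates the global trace inequality, with constants that do not see `h`. Chains around a vertex of
`𝒯_h`, whose length shape regularity and quasi-uniformity bound, give the stability of the
Scott–Zhang operator (`nodalEnergy_szMean_le`). Estimates for Sobolev functions follow by passing to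
the limit along the smooth approximations that are built into the definition of a trace; no density
theorem enters. -/

/-! ### Upper gradients along segments -/

/-- `ρ` is an upper gradient of `f` along all segments contained in `S`. -/
def UpperGradOn {F : Type*} [NormedAddCommGroup F] (S : Set Plane) (f : Plane → F)
    (ρ : Plane → ℝ≥0∞) : Prop :=
  ∀ x y, segment ℝ x y ⊆ S → ∀ t ∈ Icc (0 : ℝ) 1,
    ‖f (AffineMap.lineMap x y t) - f x‖ₑ ≤
      ‖y - x‖ₑ * ∫⁻ τ in Icc (0 : ℝ) 1, ρ (AffineMap.lineMap x y τ)

theorem sq_lintegral_le_lintegral_sq {α : Type*} [MeasurableSpace α] (μ : Measure α)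
    [IsProbabilityMeasure μ] {g : α → ℝ≥0∞} (hg : Measurable g) :
    (∫⁻ a, g a ∂μ) ^ 2 ≤ ∫⁻ a, g a ^ 2 ∂μ := by
  have h := ENNReal.lintegral_mul_le_Lp_mul_Lq μ Real.HolderConjugate.two_two
    (f := g) (g := fun _ => 1) hg.aemeasurable aemeasurable_const
  simp only [Pi.mul_apply, mul_one, ENNReal.one_rpow, lintegral_const, measure_univ] at h
  calc (∫⁻ a, g a ∂μ) ^ 2 ≤ ((∫⁻ a, g a ^ (2 : ℝ) ∂μ) ^ (1 / 2 : ℝ)) ^ 2 := by gcongr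
    _ = ∫⁻ a, g a ^ 2 ∂μ := by
      rw [← ENNReal.rpow_natCast, ← ENNReal.rpow_mul]
      norm_num

theorem measurable_lineMap_uncurry :
    Measurable fun p : (Plane × Plane) × ℝ => AffineMap.lineMap p.1.1 p.1.2 p.2 := by
  simp only [AffineMap.lineMap_apply_module]
  fun_prop

theorem measurable_lineMap_const (x y : Plane) :
    Measurable fun t : ℝ => (AffineMap.lineMap x y t : Plane) :=
  (AffineMap.lineMap_continuous).measurable

instance : IsProbabilityMeasure ((volume : Measure ℝ).restrict (Icc 0 1)) :=
  ⟨by simp⟩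

theorem add_sq_le_two_mul (a b : ℝ≥0∞) : (a + b) ^ 2 ≤ 2 * a ^ 2 + 2 * b ^ 2 := by
  have := ENNReal.rpow_add_le_mul_rpow_add_rpow a b (p := 2) (by norm_num)
  norm_num at this
  rwa [mul_add] at this

theorem enorm_sub_sq_le {F : Type*} [NormedAddCommGroup F] (a b c : F) :
    ‖a - b‖ₑ ^ 2 ≤ 2 * ‖a - c‖ₑ ^ 2 + 2 * ‖c - b‖ₑ ^ 2 := by
  refine le_trans ?_ (add_sq_le_two_mul _ _)
  gcongr
  calc ‖a - b‖ₑ = ‖(a - c) + (c - b)‖ₑ := by rw [sub_add_sub_cancel]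
    _ ≤ _ := enorm_add_le _ _

section

variable {F : Type*} [NormedAddCommGroup F] {S : Set Plane} {f : Plane → F} {ρ : Plane → ℝ≥0∞}

theorem UpperGradOn.mono {T : Set Plane} (h : UpperGradOn S f ρ) (hT : T ⊆ S) :
    UpperGradOn T f ρ :=
  fun x y hxy => h x y (hxy.trans hT)

theorem UpperGradOn.sq_le (h : UpperGradOn S f ρ) (hρ : Measurable ρ) {x y : Plane}
    (hxy : segment ℝ x y ⊆ S) {t : ℝ} (ht : t ∈ Icc (0 : ℝ) 1) :
    ‖f (AffineMap.lineMap x y t) - f x‖ₑ ^ 2 ≤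
      ‖y - x‖ₑ ^ 2 * ∫⁻ τ in Icc (0 : ℝ) 1, ρ (AffineMap.lineMap x y τ) ^ 2 := by
  calc ‖f (AffineMap.lineMap x y t) - f x‖ₑ ^ 2
      ≤ (‖y - x‖ₑ * ∫⁻ τ in Icc (0 : ℝ) 1, ρ (AffineMap.lineMap x y τ)) ^ 2 := by
        gcongr; exact h x y hxy t ht
    _ ≤ _ := by
      rw [mul_pow]
      gcongr
      exact sq_lintegral_le_lintegral_sq _ (hρ.comp (measurable_lineMap_const x y))

theorem lintegral_comp_lineMap {g : Plane → ℝ≥0∞} (hg : Measurable g) (x : Plane) {t : ℝ}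
    (ht : 0 < t) :
    ∫⁻ y, g (AffineMap.lineMap x y t) = ENNReal.ofReal (t ^ 2)⁻¹ * ∫⁻ y, g y := by
  have h1 : ∀ y : Plane, AffineMap.lineMap x y t = (1 - t) • x + t • y := fun y => by
    rw [AffineMap.lineMap_apply_module]
  simp only [h1]
  have hm : Measurable fun y : Plane => t • y := by fun_prop
  have hg' : Measurable fun y : Plane => g ((1 - t) • x + y) := by fun_prop
  rw [← lintegral_map hg' hm, Measure.map_addHaar_smul _ ht.ne', lintegral_smul_measure,
    lintegral_add_left_eq_self]
  simp [abs_of_pos ht]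

/-- The contraction towards `x` maps `S` into itself by convexity and has Jacobian `t²`; for `t ≥
1/2` the inverse Jacobian is at most `4`. -/
theorem setLIntegral_comp_lineMap_le (hS : Convex ℝ S) (hSm : MeasurableSet S)
    {g : Plane → ℝ≥0∞} (hg : Measurable g) {x : Plane} (hx : x ∈ S) {t : ℝ}
    (ht : t ∈ Icc (1 / 2 : ℝ) 1) :
    ∫⁻ y in S, g (AffineMap.lineMap x y t) ≤ 4 * ∫⁻ y in S, g y := by
  have h0 : 0 < t := lt_of_lt_of_le (by norm_num) ht.1
  rw [← lintegral_indicator hSm, ← lintegral_indicator hSm]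
  calc ∫⁻ y, S.indicator (fun y => g (AffineMap.lineMap x y t)) y
      ≤ ∫⁻ y, S.indicator g (AffineMap.lineMap x y t) := by
        refine lintegral_mono fun y => ?_
        by_cases hy : y ∈ S
        · rw [indicator_of_mem hy, indicator_of_mem]
          exact hS.segment_subset hx hy (lineMap_mem_segment ℝ x y ⟨h0.le, ht.2⟩)
        · rw [indicator_of_notMem hy]; exact zero_le
    _ = ENNReal.ofReal (t ^ 2)⁻¹ * ∫⁻ y, S.indicator g y :=
        lintegral_comp_lineMap (hg.indicator hSm) x h0
    _ ≤ 4 * ∫⁻ y, S.indicator g y := by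
        gcongr
        rw [show (4 : ℝ≥0∞) = ENNReal.ofReal 4 by simp]
        apply ENNReal.ofReal_le_ofReal
        rw [inv_le_comm₀ (by positivity) (by norm_num)]
        nlinarith [ht.1]

theorem lintegral_triple_rotate {α β γ : Type*} [MeasurableSpace α] [MeasurableSpace β]
    [MeasurableSpace γ] {μ : Measure α} {ν : Measure β} {η : Measure γ} [SFinite μ] [SFinite ν]
    [SFinite η] {G : (α × β) × γ → ℝ≥0∞} (hG : Measurable G) :
    ∫⁻ x, ∫⁻ y, ∫⁻ t, G ((x, y), t) ∂η ∂ν ∂μ = ∫⁻ t, ∫⁻ x, ∫⁻ y, G ((x, y), t) ∂ν ∂μ ∂η := by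
  have h1 : ∀ x, ∫⁻ y, ∫⁻ t, G ((x, y), t) ∂η ∂ν = ∫⁻ t, ∫⁻ y, G ((x, y), t) ∂ν ∂η := fun x =>
    lintegral_lintegral_swap
      (hG.comp (f := fun q : β × γ => ((x, q.1), q.2)) (by fun_prop)).aemeasurable
  simp only [h1]
  refine lintegral_lintegral_swap (f := fun x t => ∫⁻ y, G ((x, y), t) ∂ν) ?_
  have : Measurable fun q : (α × γ) × β => G ((q.1.1, q.2), q.1.2) :=
    hG.comp (f := fun q : (α × γ) × β => ((q.1.1, q.2), q.1.2)) (by fun_prop)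
  exact this.lintegral_prod_right'.aemeasurable

/-- The change of variables in `y` degenerates as `τ → 0`, the one in `x` as `τ → 1`. Using the
first for `τ ≥ 1/2` and the second for `τ ≤ 1/2` keeps the Jacobian bounded, so no singular kernel
appears. -/
theorem lintegral_lintegral_segment_le (hS : Convex ℝ S) (hSm : MeasurableSet S)
    {g : Plane → ℝ≥0∞} (hg : Measurable g) :
    ∫⁻ x in S, ∫⁻ y in S, ∫⁻ τ in Icc (0 : ℝ) 1, g (AffineMap.lineMap x y τ) ≤
      4 * volume S * ∫⁻ y in S, g y := by
  have hm : Measurable fun p : (Plane × Plane) × ℝ => g (AffineMap.lineMap p.1.1 p.1.2 p.2) :=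
    hg.comp measurable_lineMap_uncurry
  have hm2 : ∀ τ : ℝ, Measurable fun p : Plane × Plane => g (AffineMap.lineMap p.1 p.2 τ) :=
    fun τ => hm.comp (f := fun p : Plane × Plane => (p, τ)) (by fun_prop)
  have hswap : ∫⁻ x in S, ∫⁻ y in S, ∫⁻ τ in Icc (0 : ℝ) 1, g (AffineMap.lineMap x y τ)
      = ∫⁻ τ in Icc (0 : ℝ) 1, ∫⁻ x in S, ∫⁻ y in S, g (AffineMap.lineMap x y τ) :=
    lintegral_triple_rotate hm
  rw [hswap]
  have key : ∀ τ ∈ Icc (0 : ℝ) 1, ∫⁻ x in S, ∫⁻ y in S, g (AffineMap.lineMap x y τ) ≤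
      4 * volume S * ∫⁻ y in S, g y := by
    intro τ hτ
    rcases le_total (1 / 2) τ with h | h
    · calc ∫⁻ x in S, ∫⁻ y in S, g (AffineMap.lineMap x y τ)
          ≤ ∫⁻ x in S, 4 * ∫⁻ y in S, g y := setLIntegral_mono' hSm fun x hx =>
            setLIntegral_comp_lineMap_le hS hSm hg hx ⟨h, hτ.2⟩
        _ = _ := by rw [setLIntegral_const]; ring
    · rw [lintegral_lintegral_swap (hm2 τ).aemeasurable]
      calc ∫⁻ y in S, ∫⁻ x in S, g (AffineMap.lineMap x y τ)
          ≤ ∫⁻ x in S, 4 * ∫⁻ y in S, g y := setLIntegral_mono' hSm fun y hy => by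
            have := setLIntegral_comp_lineMap_le hS hSm hg hy (t := 1 - τ)
              ⟨by linarith, by linarith [hτ.1]⟩
            simpa only [AffineMap.lineMap_apply_one_sub] using this
        _ = _ := by rw [setLIntegral_const]; ring
  calc _ ≤ ∫⁻ τ in Icc (0 : ℝ) 1, 4 * volume S * ∫⁻ y in S, g y :=
        setLIntegral_mono' measurableSet_Icc key
    _ = _ := by simp

/-- The Poincaré inequality on a convex set, with a value of the function instead of the mean. -/
theorem UpperGradOn.exists_poincare (h : UpperGradOn S f ρ) (hρ : Measurable ρ)
    (hS : Convex ℝ S) (hSm : MeasurableSet S) (hf : ContinuousOn f S) (h0 : volume S ≠ 0)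
    (hfin : volume S ≠ ⊤) {d : ℝ≥0∞} (hd : ∀ x ∈ S, ∀ y ∈ S, ‖y - x‖ₑ ≤ d) :
    ∃ c : F, ∫⁻ x in S, ‖f x - c‖ₑ ^ 2 ≤ 4 * d ^ 2 * ∫⁻ x in S, ρ x ^ 2 := by
  have hprod : ∫⁻ y in S, ∫⁻ x in S, ‖f x - f y‖ₑ ^ 2 ≤
      d ^ 2 * (4 * volume S * ∫⁻ x in S, ρ x ^ 2) := by
    have hm : Measurable fun p : (Plane × Plane) × ℝ =>
        ρ (AffineMap.lineMap p.1.1 p.1.2 p.2) ^ 2 :=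
      (hρ.comp measurable_lineMap_uncurry).pow_const 2
    calc ∫⁻ y in S, ∫⁻ x in S, ‖f x - f y‖ₑ ^ 2
        ≤ ∫⁻ y in S, ∫⁻ x in S,
            d ^ 2 * ∫⁻ τ in Icc (0 : ℝ) 1, ρ (AffineMap.lineMap y x τ) ^ 2 := by
          refine setLIntegral_mono' hSm fun y hy => setLIntegral_mono' hSm fun x hx => ?_
          have := h.sq_le hρ (hS.segment_subset hy hx) (t := 1) (by simp)
          rw [AffineMap.lineMap_apply_one] at this
          exact this.trans (by gcongr; exact hd y hy x hx)
      _ = d ^ 2 * ∫⁻ y in S, ∫⁻ x in S,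
            ∫⁻ τ in Icc (0 : ℝ) 1, ρ (AffineMap.lineMap y x τ) ^ 2 := by
          have hm1 : Measurable fun p : Plane × Plane =>
              ∫⁻ τ in Icc (0 : ℝ) 1, ρ (AffineMap.lineMap p.1 p.2 τ) ^ 2 :=
            hm.lintegral_prod_right'
          rw [← lintegral_const_mul _ hm1.lintegral_prod_right']
          refine lintegral_congr fun y => ?_
          exact lintegral_const_mul _ (hm1.comp (f := fun x : Plane => (y, x)) (by fun_prop))
      _ ≤ _ := by
          gcongr
          exact lintegral_lintegral_segment_le hS hSm (hρ.pow_const 2)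
  have hcont : AEMeasurable (fun y => ∫⁻ x in S, ‖f x - f y‖ₑ ^ 2) (volume.restrict S) := by
    have h2 : ContinuousOn (fun p : Plane × Plane => ‖f p.2 - f p.1‖ₑ) (S ×ˢ S) := by
      refine ContinuousOn.enorm ?_
      exact (hf.comp continuousOn_snd fun p hp => hp.2).sub
        (hf.comp continuousOn_fst fun p hp => hp.1)
    have h3 : AEMeasurable (fun p : Plane × Plane => ‖f p.2 - f p.1‖ₑ ^ 2)
        ((volume.restrict S).prod (volume.restrict S)) := by
      rw [Measure.prod_restrict]
      exact (h2.aemeasurable (hSm.prod hSm)).pow_const 2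
    exact h3.lintegral_prod_right'
  -- The double integral is an average over `y`; some `y` does no worse than the average, and `f y`
  -- replaces the mean value.
  obtain ⟨y, -, hle⟩ := exists_le_setLAverage h0 hfin hcont
  refine ⟨f y, hle.trans ?_⟩
  rw [setLAverage_eq]
  calc _ ≤ d ^ 2 * (4 * volume S * ∫⁻ x in S, ρ x ^ 2) / volume S := by gcongr
    _ = (volume S / volume S) * (4 * d ^ 2 * ∫⁻ x in S, ρ x ^ 2) := by
      rw [div_eq_mul_inv, div_eq_mul_inv]; ring
    _ = _ := by rw [ENNReal.div_self h0 hfin, one_mul]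

end

/-! ### A trace inequality on the edges of a triangle -/

theorem mem_convexHull_triple_iff {p q r x : Plane} :
    x ∈ convexHull ℝ ({p, q, r} : Set Plane) ↔
      ∃ a b : ℝ, 0 ≤ a ∧ 0 ≤ b ∧ a + b ≤ 1 ∧ x = p + (a • (q - p) + b • (r - p)) := by
  constructor
  · intro hx
    have hconv : Convex ℝ {x : Plane | ∃ a b : ℝ, 0 ≤ a ∧ 0 ≤ b ∧ a + b ≤ 1 ∧
        x = p + (a • (q - p) + b • (r - p))} := by
      rintro _ ⟨a, b, ha, hb, hab, rfl⟩ _ ⟨a', b', ha', hb', hab', rfl⟩ s t hs ht hst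
      refine ⟨s * a + t * a', s * b + t * b', by positivity, by positivity, by nlinarith, ?_⟩
      obtain rfl : t = 1 - s := by linarith
      module
    refine convexHull_min ?_ hconv hx
    rintro y (rfl | rfl | rfl)
    · exact ⟨0, 0, by norm_num, by norm_num, by norm_num, by simp⟩
    · exact ⟨1, 0, by norm_num, by norm_num, by norm_num, by simp⟩
    · exact ⟨0, 1, by norm_num, by norm_num, by norm_num, by simp⟩
  · rintro ⟨a, b, ha, hb, hab, rfl⟩
    have h := (convex_convexHull ℝ ({p, q, r} : Set Plane)).sum_mem (t := Finset.univ)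
      (w := ![1 - a - b, a, b]) (z := ![p, q, r])
      (by intro i _; fin_cases i <;> simp <;> linarith)
      (by simp only [Fin.sum_univ_three, Matrix.cons_val_zero, Matrix.cons_val_one,
        Matrix.cons_val]; ring)
      (by intro i _; fin_cases i <;> exact subset_convexHull ℝ _ (by simp))
    simp only [Fin.sum_univ_three, Matrix.cons_val_zero, Matrix.cons_val_one,
      Matrix.cons_val] at h
    convert h using 1
    module

theorem measurableSet_convexHull_triple (p q r : Plane) :
    MeasurableSet (convexHull ℝ ({p, q, r} : Set Plane)) :=
  ((Set.toFinite ({p, q, r} : Set Plane)).isCompact_convexHull (𝕜 := ℝ)).isClosed.measurableSet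

/-- The linear parametrization of a parallelogram. -/
def paraMap (u w : Plane) : ℝ × ℝ →ₗ[ℝ] Plane :=
  (LinearMap.toSpanSingleton ℝ Plane u).coprod (LinearMap.toSpanSingleton ℝ Plane w)

theorem paraMap_apply (u w : Plane) (z : ℝ × ℝ) : paraMap u w z = z.1 • u + z.2 • w := rfl

/-- Otherwise the triangle would lie in a translate of a proper subspace and have area zero. -/
theorem paraMap_surjective {p q r : Plane}
    (h : volume (convexHull ℝ ({p, q, r} : Set Plane)) ≠ 0) :
    Function.Surjective (paraMap ((1 / 2 : ℝ) • (q - p)) ((1 / 2 : ℝ) • (r - p))) := by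
  set L := paraMap ((1 / 2 : ℝ) • (q - p)) ((1 / 2 : ℝ) • (r - p))
  rw [← LinearMap.range_eq_top]
  by_contra hne
  apply h
  have h0 := Measure.addHaar_submodule (volume : Measure Plane) _ hne
  rw [← measure_preimage_add volume (-p)] at h0
  refine measure_mono_null ?_ h0
  intro x hx
  obtain ⟨a, b, -, -, -, rfl⟩ := mem_convexHull_triple_iff.1 hx
  refine ⟨(2 * a, 2 * b), ?_⟩
  rw [paraMap_apply]
  module

/-- The factor `c` is the reciprocal of the area of the image of the unit square, the parallelogram
with half the sides of the triangle. -/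
theorem map_paraMap {p q r : Plane} (h : volume (convexHull ℝ ({p, q, r} : Set Plane)) ≠ 0) :
    ∃ c : ℝ≥0∞, c ≤ 4 / volume (convexHull ℝ ({p, q, r} : Set Plane)) ∧
      (volume : Measure (ℝ × ℝ)).map
        (paraMap ((1 / 2 : ℝ) • (q - p)) ((1 / 2 : ℝ) • (r - p))) = c • volume := by
  have hs := paraMap_surjective h
  set L := paraMap ((1 / 2 : ℝ) • (q - p)) ((1 / 2 : ℝ) • (r - p)) with hL
  set K := convexHull ℝ ({p, q, r} : Set Plane) with hK
  obtain ⟨c, hc0, hc⟩ := L.exists_map_addHaar_eq_smul_addHaar volume volume hs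
  refine ⟨c, ?_, hc⟩
  have hinj : Function.Injective L :=
    (LinearMap.injective_iff_surjective_of_finrank_eq_finrank (by simp)).2 hs
  have hcomp : IsCompact (L '' (Icc (0 : ℝ) 1 ×ˢ Icc (0 : ℝ) 1)) :=
    (isCompact_Icc.prod isCompact_Icc).image L.continuous_of_finiteDimensional
  have h1 : c * volume (L '' (Icc (0 : ℝ) 1 ×ˢ Icc (0 : ℝ) 1)) = 1 := by
    have := congrArg (fun m => m (L '' (Icc (0 : ℝ) 1 ×ˢ Icc (0 : ℝ) 1))) hc
    simp only [Measure.smul_apply, smul_eq_mul] at this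
    rw [← this, Measure.map_apply L.continuous_of_finiteDimensional.measurable
      hcomp.isClosed.measurableSet, preimage_image_eq _ hinj, Measure.volume_eq_prod,
      Measure.prod_prod]
    simp
  -- Doubling the parallelogram and translating it by `p` covers the triangle, and doubling
  -- multiplies areas by `4`.
  have h2 : volume K ≤ 4 * volume (L '' (Icc (0 : ℝ) 1 ×ˢ Icc (0 : ℝ) 1)) := by
    calc volume K ≤ volume ((p + ·) '' (AffineMap.homothety (0 : Plane) (2 : ℝ) ''
          (L '' (Icc (0 : ℝ) 1 ×ˢ Icc (0 : ℝ) 1)))) := by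
          refine measure_mono fun x hx => ?_
          obtain ⟨a, b, ha, hb, hab, rfl⟩ := mem_convexHull_triple_iff.1 hx
          refine ⟨_, ⟨_, ⟨(a, b), ⟨⟨ha, by linarith⟩, hb, by linarith⟩, rfl⟩, rfl⟩, ?_⟩
          simp only [AffineMap.homothety_apply, hL, paraMap_apply, vsub_eq_sub, vadd_eq_add]
          module
      _ = _ := by
          rw [image_add_left, measure_preimage_add, Measure.addHaar_image_homothety]
          congr 1
          norm_num
  rw [ENNReal.le_div_iff_mul_le (Or.inl h) (Or.inr (by norm_num))]
  calc c * volume K ≤ c * (4 * volume (L '' (Icc (0 : ℝ) 1 ×ˢ Icc (0 : ℝ) 1))) := by gcongr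
    _ = 4 * (c * volume (L '' (Icc (0 : ℝ) 1 ×ˢ Icc (0 : ℝ) 1))) := by ring
    _ = 4 := by rw [h1, mul_one]

/-- The parallelogram at `p` with half the sides lies inside the triangle, since `s/2 + t/2 ≤ 1`;
this is the reason for halving the sides. -/
theorem lintegral_para_le {p q r : Plane}
    (h : volume (convexHull ℝ ({p, q, r} : Set Plane)) ≠ 0) {g : Plane → ℝ≥0∞}
    (hg : Measurable ((convexHull ℝ ({p, q, r} : Set Plane)).indicator g)) :
    ∫⁻ s in Icc (0 : ℝ) 1, ∫⁻ t in Icc (0 : ℝ) 1,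
        g (p + (s • ((1 / 2 : ℝ) • (q - p)) + t • ((1 / 2 : ℝ) • (r - p)))) ≤
      4 / volume (convexHull ℝ ({p, q, r} : Set Plane)) *
        ∫⁻ x in convexHull ℝ ({p, q, r} : Set Plane), g x := by
  obtain ⟨c, hc, hmap⟩ := map_paraMap h
  set L := paraMap ((1 / 2 : ℝ) • (q - p)) ((1 / 2 : ℝ) • (r - p)) with hL
  set K := convexHull ℝ ({p, q, r} : Set Plane) with hK
  have hLm : Measurable L := L.continuous_of_finiteDimensional.measurable
  have hg' : Measurable fun x : Plane => K.indicator g (p + x) :=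
    hg.comp (measurable_const_add p)
  calc _ ≤ ∫⁻ s in Icc (0 : ℝ) 1, ∫⁻ t in Icc (0 : ℝ) 1, K.indicator g (p + L (s, t)) := by
        refine setLIntegral_mono' measurableSet_Icc fun s hs =>
          setLIntegral_mono' measurableSet_Icc fun t ht => ?_
        rw [indicator_of_mem, hL, paraMap_apply]
        exact mem_convexHull_triple_iff.2 ⟨s / 2, t / 2, by linarith [hs.1], by linarith [ht.1],
          by linarith [hs.2, ht.2], by rw [hL, paraMap_apply]; module⟩
    _ ≤ ∫⁻ s, ∫⁻ t, K.indicator g (p + L (s, t)) :=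
        (setLIntegral_le_lintegral _ _).trans
          (lintegral_mono fun s => setLIntegral_le_lintegral _ _)
    _ = ∫⁻ z : ℝ × ℝ, K.indicator g (p + L z) := by
        rw [Measure.volume_eq_prod]
        exact (lintegral_prod (fun z : ℝ × ℝ => K.indicator g (p + L z))
          (hg'.comp hLm).aemeasurable).symm
    _ = ∫⁻ x, K.indicator g (p + x) ∂((volume : Measure (ℝ × ℝ)).map L) :=
        (lintegral_map hg' hLm).symm
    _ = c * ∫⁻ x in K, g x := by
        rw [hmap, lintegral_smul_measure, lintegral_add_left_eq_self,
          lintegral_indicator (measurableSet_convexHull_triple p q r), smul_eq_mul]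
    _ ≤ _ := by gcongr

theorem lintegral_Icc_half (G : ℝ → ℝ≥0∞) :
    ∫⁻ s in Icc (0 : ℝ) (1 / 2), G s = 2⁻¹ * ∫⁻ s in Icc (0 : ℝ) 1, G (s / 2) := by
  have hemb : MeasurableEmbedding fun s : ℝ => (1 / 2 : ℝ) • s :=
    (Homeomorph.smulOfNeZero (1 / 2 : ℝ) (by norm_num)).measurableEmbedding
  have h1 : ∫⁻ s in Icc (0 : ℝ) 1, G (s / 2) =
      ∫⁻ s, (Icc (0 : ℝ) (1 / 2)).indicator G ((1 / 2 : ℝ) • s) := by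
    rw [← lintegral_indicator measurableSet_Icc]
    refine lintegral_congr fun s => ?_
    have : (s ∈ Icc (0 : ℝ) 1) ↔ ((1 / 2 : ℝ) • s ∈ Icc (0 : ℝ) (1 / 2)) := by
      simp only [mem_Icc, smul_eq_mul]
      constructor <;> rintro ⟨h, h'⟩ <;> constructor <;> linarith
    by_cases hs : s ∈ Icc (0 : ℝ) 1
    · rw [indicator_of_mem hs, indicator_of_mem (this.1 hs), smul_eq_mul]
      congr 1; ring
    · rw [indicator_of_notMem hs, indicator_of_notMem (fun h => hs (this.2 h))]
  rw [h1, ← hemb.lintegral_map, Measure.map_addHaar_smul _ (by norm_num), lintegral_smul_measure,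
    lintegral_indicator measurableSet_Icc, smul_eq_mul, ← mul_assoc]
  simp
  rw [ENNReal.inv_mul_cancel (by norm_num) (by norm_num), one_mul]

theorem lintegral_Icc_reflect (G : ℝ → ℝ≥0∞) :
    ∫⁻ s in Icc (1 / 2 : ℝ) 1, G s = ∫⁻ s in Icc (0 : ℝ) (1 / 2), G (1 - s) := by
  have h1 : ∫⁻ s in Icc (0 : ℝ) (1 / 2), G (1 - s) =
      ∫⁻ s, (Icc (1 / 2 : ℝ) 1).indicator G (1 - s) := by
    rw [← lintegral_indicator measurableSet_Icc]
    refine lintegral_congr fun s => ?_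
    have : (s ∈ Icc (0 : ℝ) (1 / 2)) ↔ (1 - s ∈ Icc (1 / 2 : ℝ) 1) := by
      simp only [mem_Icc]
      constructor <;> rintro ⟨h, h'⟩ <;> constructor <;> linarith
    by_cases hs : s ∈ Icc (0 : ℝ) (1 / 2)
    · rw [indicator_of_mem hs, indicator_of_mem (this.1 hs)]
    · rw [indicator_of_notMem hs, indicator_of_notMem (fun h => hs (this.2 h))]
  rw [h1, lintegral_sub_left_eq_self, lintegral_indicator measurableSet_Icc]

theorem lintegral_Icc_le_halves (G : ℝ → ℝ≥0∞) :
    ∫⁻ s in Icc (0 : ℝ) 1, G s ≤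
      2⁻¹ * (∫⁻ s in Icc (0 : ℝ) 1, G (s / 2)) + 2⁻¹ * ∫⁻ s in Icc (0 : ℝ) 1, G (1 - s / 2) := by
  have : Icc (0 : ℝ) 1 ⊆ Icc (0 : ℝ) (1 / 2) ∪ Icc (1 / 2 : ℝ) 1 := by
    rw [Icc_union_Icc_eq_Icc (by norm_num) (by norm_num)]
  calc _ ≤ ∫⁻ s in Icc (0 : ℝ) (1 / 2) ∪ Icc (1 / 2 : ℝ) 1, G s := lintegral_mono_set this
    _ ≤ _ := lintegral_union_le _ _ _
    _ = _ := by
      rw [lintegral_Icc_reflect, lintegral_Icc_half, lintegral_Icc_half (fun s => G (1 - s))]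

section

variable {F : Type*} [NormedAddCommGroup F] {f : Plane → F} {ρ : Plane → ℝ≥0∞}

theorem ContinuousOn.measurable_indicator_enorm_sub {S : Set Plane} (hf : ContinuousOn f S)
    (hS : MeasurableSet S) (c : F) : Measurable (S.indicator fun x => ‖f x - c‖ₑ ^ 2) := by
  classical
  have h : Measurable (S.piecewise (fun x => ‖f x - c‖ₑ) (fun _ => 0)) :=
    ContinuousOn.measurable_piecewise (hf.sub continuousOn_const).enorm continuousOn_const hS
  convert h.pow_const 2 using 1
  ext x
  by_cases hx : x ∈ S <;> simp [hx]

/-- From every point of the half edge at `p` the segment in direction `(r - p)/2` stays in the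
triangle. Comparing `f` at its foot with `f` along it, averaging over it and integrating over the
half edge sweeps out the parallelogram of `lintegral_para_le`. -/
theorem UpperGradOn.half_edge_le {p q r : Plane}
    (hfg : UpperGradOn (convexHull ℝ ({p, q, r} : Set Plane)) f ρ) (hρ : Measurable ρ)
    (hf : ContinuousOn f (convexHull ℝ ({p, q, r} : Set Plane)))
    (h : volume (convexHull ℝ ({p, q, r} : Set Plane)) ≠ 0) {d : ℝ≥0∞} (hd : ‖r - p‖ₑ ≤ d)
    (c : F) :
    ∫⁻ s in Icc (0 : ℝ) 1, ‖f (AffineMap.lineMap p q (s / 2)) - c‖ₑ ^ 2 ≤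
      8 / volume (convexHull ℝ ({p, q, r} : Set Plane)) *
          (∫⁻ x in convexHull ℝ ({p, q, r} : Set Plane), ‖f x - c‖ₑ ^ 2) +
        8 * d ^ 2 / volume (convexHull ℝ ({p, q, r} : Set Plane)) *
          ∫⁻ x in convexHull ℝ ({p, q, r} : Set Plane), ρ x ^ 2 := by
  set K := convexHull ℝ ({p, q, r} : Set Plane) with hK
  have hKm : MeasurableSet K := measurableSet_convexHull_triple p q r
  have hKc : Convex ℝ K := convex_convexHull ℝ _
  let e : ℝ → Plane := fun s => p + s • ((1 / 2 : ℝ) • (q - p))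
  let y : ℝ → Plane := fun s => e s + (1 / 2 : ℝ) • (r - p)
  have he : ∀ s : ℝ, AffineMap.lineMap p q (s / 2) = e s := fun s => by
    simp only [e, AffineMap.lineMap_apply_module]; module
  have hy : ∀ s t : ℝ, AffineMap.lineMap (e s) (y s) t =
      p + (s • ((1 / 2 : ℝ) • (q - p)) + t • ((1 / 2 : ℝ) • (r - p))) := fun s t => by
    simp only [e, y, AffineMap.lineMap_apply_module]; module
  have heK : ∀ s ∈ Icc (0 : ℝ) 1, e s ∈ K := fun s hs =>
    mem_convexHull_triple_iff.2 ⟨s / 2, 0, by linarith [hs.1], le_rfl, by linarith [hs.2],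
      by simp only [e]; module⟩
  have hyK : ∀ s ∈ Icc (0 : ℝ) 1, y s ∈ K := fun s hs =>
    mem_convexHull_triple_iff.2 ⟨s / 2, 1 / 2, by linarith [hs.1], by norm_num,
      by linarith [hs.2], by simp only [e, y]; module⟩
  have hmf := ContinuousOn.measurable_indicator_enorm_sub hf hKm c
  have hmρ : Measurable (K.indicator fun x => ρ x ^ 2) := (hρ.pow_const 2).indicator hKm
  have hyd : ∀ s, ‖y s - e s‖ₑ ≤ d := fun s => by
    simp only [y, add_sub_cancel_left]
    refine le_trans ?_ hd
    rw [enorm_smul]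
    calc _ ≤ 1 * ‖r - p‖ₑ := by
          gcongr
          rw [Real.enorm_eq_ofReal (by norm_num)]
          simp only [ENNReal.ofReal_le_one]
          norm_num
      _ = _ := one_mul _
  have hpt : ∀ s ∈ Icc (0 : ℝ) 1, ‖f (AffineMap.lineMap p q (s / 2)) - c‖ₑ ^ 2 ≤
      2 * (∫⁻ t in Icc (0 : ℝ) 1, ‖f (p + (s • ((1 / 2 : ℝ) • (q - p)) +
          t • ((1 / 2 : ℝ) • (r - p)))) - c‖ₑ ^ 2) +
        2 * d ^ 2 * ∫⁻ t in Icc (0 : ℝ) 1, ρ (p + (s • ((1 / 2 : ℝ) • (q - p)) +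
          t • ((1 / 2 : ℝ) • (r - p)))) ^ 2 := by
    intro s hs
    rw [he]
    have hseg : segment ℝ (e s) (y s) ⊆ K := hKc.segment_subset (heK s hs) (hyK s hs)
    have h1 : ∀ t ∈ Icc (0 : ℝ) 1, ‖f (e s) - c‖ₑ ^ 2 ≤
        2 * (d ^ 2 * ∫⁻ t in Icc (0 : ℝ) 1, ρ (p + (s • ((1 / 2 : ℝ) • (q - p)) +
          t • ((1 / 2 : ℝ) • (r - p)))) ^ 2) + 2 * ‖f (p + (s • ((1 / 2 : ℝ) • (q - p)) +
          t • ((1 / 2 : ℝ) • (r - p)))) - c‖ₑ ^ 2 := by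
      intro t ht
      have h2 := hfg.sq_le hρ hseg ht
      simp only [hy] at h2
      refine (enorm_sub_sq_le _ _ (f (p + (s • ((1 / 2 : ℝ) • (q - p)) +
          t • ((1 / 2 : ℝ) • (r - p)))))).trans ?_
      gcongr
      rw [← enorm_neg, neg_sub]
      refine h2.trans ?_
      gcongr
      exact hyd s
    -- The left side does not depend on `t`, so the pointwise comparison may be averaged over the
    -- transversal segment.
    calc ‖f (e s) - c‖ₑ ^ 2 = ∫⁻ t in Icc (0 : ℝ) 1, ‖f (e s) - c‖ₑ ^ 2 := by simp
      _ ≤ _ := setLIntegral_mono' measurableSet_Icc h1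
      _ = 2 * (d ^ 2 * ∫⁻ t in Icc (0 : ℝ) 1, ρ (p + (s • ((1 / 2 : ℝ) • (q - p)) +
          t • ((1 / 2 : ℝ) • (r - p)))) ^ 2) +
          ∫⁻ t in Icc (0 : ℝ) 1, 2 * ‖f (p + (s • ((1 / 2 : ℝ) • (q - p)) +
          t • ((1 / 2 : ℝ) • (r - p)))) - c‖ₑ ^ 2 := by
        rw [lintegral_add_left measurable_const]; simp
      _ = _ := by
        rw [lintegral_const_mul' _ _ (by norm_num)]; ring
  have hm3 : AEMeasurable (fun s => 2 * d ^ 2 * ∫⁻ t in Icc (0 : ℝ) 1,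
      ρ (p + (s • ((1 / 2 : ℝ) • (q - p)) + t • ((1 / 2 : ℝ) • (r - p)))) ^ 2)
      (volume.restrict (Icc (0 : ℝ) 1)) := by
    have h3 : Measurable fun z : ℝ × ℝ =>
        ρ (p + (z.1 • ((1 / 2 : ℝ) • (q - p)) + z.2 • ((1 / 2 : ℝ) • (r - p)))) ^ 2 := by
      fun_prop
    exact (h3.lintegral_prod_right'.const_mul _).aemeasurable
  have hm4 : Measurable fun s : ℝ => ∫⁻ t in Icc (0 : ℝ) 1,
      ρ (p + (s • ((1 / 2 : ℝ) • (q - p)) + t • ((1 / 2 : ℝ) • (r - p)))) ^ 2 := by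
    have h3 : Measurable fun z : ℝ × ℝ =>
        ρ (p + (z.1 • ((1 / 2 : ℝ) • (q - p)) + z.2 • ((1 / 2 : ℝ) • (r - p)))) ^ 2 := by
      fun_prop
    exact h3.lintegral_prod_right'
  calc _ ≤ _ := setLIntegral_mono' measurableSet_Icc hpt
    _ = 2 * (∫⁻ s in Icc (0 : ℝ) 1, ∫⁻ t in Icc (0 : ℝ) 1,
          ‖f (p + (s • ((1 / 2 : ℝ) • (q - p)) + t • ((1 / 2 : ℝ) • (r - p)))) - c‖ₑ ^ 2) +
        2 * d ^ 2 * ∫⁻ s in Icc (0 : ℝ) 1, ∫⁻ t in Icc (0 : ℝ) 1,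
          ρ (p + (s • ((1 / 2 : ℝ) • (q - p)) + t • ((1 / 2 : ℝ) • (r - p)))) ^ 2 := by
        rw [lintegral_add_right' _ hm3, lintegral_const_mul' _ _ (by norm_num),
          lintegral_const_mul _ hm4]
    _ ≤ 2 * (4 / volume K * ∫⁻ x in K, ‖f x - c‖ₑ ^ 2) +
        2 * d ^ 2 * (4 / volume K * ∫⁻ x in K, ρ x ^ 2) := by
        gcongr
        · exact lintegral_para_le h hmf
        · exact lintegral_para_le h hmρ
    _ = _ := by
        simp only [div_eq_mul_inv]
        ring

/-- The trace inequality on an edge of a triangle. -/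
theorem UpperGradOn.edge_le {p q r : Plane}
    (hfg : UpperGradOn (convexHull ℝ ({p, q, r} : Set Plane)) f ρ) (hρ : Measurable ρ)
    (hf : ContinuousOn f (convexHull ℝ ({p, q, r} : Set Plane)))
    (h : volume (convexHull ℝ ({p, q, r} : Set Plane)) ≠ 0) {d : ℝ≥0∞} (hd : ‖r - p‖ₑ ≤ d)
    (hd' : ‖r - q‖ₑ ≤ d) (c : F) :
    ∫⁻ s in Icc (0 : ℝ) 1, ‖f (AffineMap.lineMap p q s) - c‖ₑ ^ 2 ≤
      8 / volume (convexHull ℝ ({p, q, r} : Set Plane)) *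
          (∫⁻ x in convexHull ℝ ({p, q, r} : Set Plane), ‖f x - c‖ₑ ^ 2) +
        8 * d ^ 2 / volume (convexHull ℝ ({p, q, r} : Set Plane)) *
          ∫⁻ x in convexHull ℝ ({p, q, r} : Set Plane), ρ x ^ 2 := by
  have h1 := hfg.half_edge_le hρ hf h hd c
  have hsw : ({p, q, r} : Set Plane) = {q, p, r} := insert_comm p q {r}
  -- The other half of the edge is the half edge at `q`.
  have h2 := UpperGradOn.half_edge_le (p := q) (q := p) (r := r) (hsw ▸ hfg) hρ (hsw ▸ hf)
    (hsw ▸ h) hd' c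
  rw [← hsw] at h2
  have h3 := lintegral_Icc_le_halves fun s => ‖f (AffineMap.lineMap p q s) - c‖ₑ ^ 2
  simp only [AffineMap.lineMap_apply_one_sub] at h3
  refine h3.trans ?_
  calc _ ≤ _ := add_le_add (mul_le_mul_right h1 2⁻¹) (mul_le_mul_right h2 2⁻¹)
    _ = _ := by rw [← add_mul, ENNReal.inv_two_add_inv_two, one_mul]

end

/-! ### Geometry of triangulations -/

namespace Triangulation

variable {Ω : Set Plane} (𝒯 : Triangulation Ω)

theorem isCompact_hull (K : Finset Plane) : IsCompact (convexHull ℝ (K : Set Plane)) :=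
  K.finite_toSet.isCompact_convexHull (𝕜 := ℝ)

theorem measurableSet_hull (K : Finset Plane) : MeasurableSet (convexHull ℝ (K : Set Plane)) :=
  (isCompact_hull K).isClosed.measurableSet

theorem volume_hull_ne_top (K : Finset Plane) :
    volume (convexHull ℝ (K : Set Plane)) ≠ ⊤ :=
  (isCompact_hull K).measure_lt_top.ne

variable {𝒯} {K L : Finset Plane}

theorem affineSpan_cell (hK : K ∈ 𝒯.cells) : affineSpan ℝ (K : Set Plane) = ⊤ := by
  have htop : affineSpan ℝ (Set.range ((↑) : K → Plane)) = ⊤ := by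
    rw [(𝒯.indep K hK).affineSpan_eq_top_iff_card_eq_finrank_add_one]
    simp [𝒯.card_eq K hK]
  simpa using htop

theorem interior_hull_nonempty (hK : K ∈ 𝒯.cells) :
    (interior (convexHull ℝ (K : Set Plane))).Nonempty :=
  interior_convexHull_nonempty_iff_affineSpan_eq_top.2 (affineSpan_cell hK)

theorem volume_hull_ne_zero (hK : K ∈ 𝒯.cells) : volume (convexHull ℝ (K : Set Plane)) ≠ 0 :=
  ((isOpen_interior.measure_pos _ (interior_hull_nonempty hK)).trans_le
    (measure_mono interior_subset)).ne'

theorem exists_third (hK : K ∈ 𝒯.cells) {p q : Plane} (hp : p ∈ K) (hq : q ∈ K) (hpq : p ≠ q) :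
    ∃ r ∈ K, (K : Set Plane) = {p, q, r} := by
  classical
  have h1 : ((K.erase p).erase q).card = 1 := by
    rw [Finset.card_erase_of_mem (Finset.mem_erase.2 ⟨hpq.symm, hq⟩), Finset.card_erase_of_mem hp,
      𝒯.card_eq K hK]
  obtain ⟨r, hr⟩ := Finset.card_eq_one.1 h1
  have hrK : r ∈ K := by
    have : r ∈ (K.erase p).erase q := hr ▸ Finset.mem_singleton_self r
    exact Finset.mem_of_mem_erase (Finset.mem_of_mem_erase this)
  refine ⟨r, hrK, ?_⟩
  have h2 : K = {p, q, r} := by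
    rw [← Finset.insert_erase hp, ← Finset.insert_erase (Finset.mem_erase.2 ⟨hpq.symm, hq⟩), hr]
  rw [h2]; simp

theorem exists_triple (hK : K ∈ 𝒯.cells) :
    ∃ p ∈ K, ∃ q ∈ K, ∃ r ∈ K, p ≠ q ∧ p ≠ r ∧ q ≠ r ∧ (K : Set Plane) = {p, q, r} := by
  obtain ⟨p, q, r, hpq, hpr, hqr, h⟩ := Finset.card_eq_three.1 (𝒯.card_eq K hK)
  exact ⟨p, by simp [h], q, by simp [h], r, by simp [h], hpq, hpr, hqr, by simp [h]⟩

/-- By conformity the overlap lies in the span of the common vertices. As both cells have three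
vertices, some vertex of `K` is missing there, and by affine independence the span is not the whole
plane. -/
theorem volume_hull_inter (hK : K ∈ 𝒯.cells) (hL : L ∈ 𝒯.cells) (hKL : K ≠ L) :
    volume (convexHull ℝ (K : Set Plane) ∩ convexHull ℝ (L : Set Plane)) = 0 := by
  obtain ⟨r, hrK, hrL⟩ : ∃ r ∈ K, r ∉ L := by
    by_contra! h
    exact hKL (Finset.eq_of_subset_of_card_le h (by rw [𝒯.card_eq K hK, 𝒯.card_eq L hL]))
  have h1 := (𝒯.indep K hK).notMem_affineSpan_sdiff ⟨r, hrK⟩ univ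
  have h2 : (K : Set Plane) ∩ L ⊆ ((↑) : K → Plane) '' (univ \ {⟨r, hrK⟩}) := by
    rintro x ⟨hxK, hxL⟩
    refine ⟨⟨x, hxK⟩, ⟨trivial, ?_⟩, rfl⟩
    rintro h
    obtain rfl : x = r := congrArg Subtype.val h
    exact hrL hxL
  refine measure_mono_null (((𝒯.inter K hK L hL).trans (convexHull_subset_affineSpan _)).trans
    (affineSpan_mono ℝ h2)) (Measure.addHaar_affineSubspace _ _ fun htop => h1 ?_)
  rw [htop]
  trivial

/-- A vanishing barycentric coordinate puts the point on an edge. The points with three positive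
coordinates are the image of an open set under an open linear map. -/
theorem interior_or_edge {p q r x : Plane}
    (h : volume (convexHull ℝ ({p, q, r} : Set Plane)) ≠ 0)
    (hx : x ∈ convexHull ℝ ({p, q, r} : Set Plane)) :
    x ∈ interior (convexHull ℝ ({p, q, r} : Set Plane)) ∨ x ∈ segment ℝ p q ∨
      x ∈ segment ℝ p r ∨ x ∈ segment ℝ q r := by
  obtain ⟨a, b, ha, hb, hab, rfl⟩ := mem_convexHull_triple_iff.1 hx
  rcases ha.eq_or_lt with rfl | ha
  · right; right; left
    exact ⟨1 - b, b, by linarith, hb, by ring, by module⟩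
  rcases hb.eq_or_lt with rfl | hb
  · right; left
    exact ⟨1 - a, a, by linarith, ha.le, by ring, by module⟩
  rcases hab.eq_or_lt with hab | hab
  · right; right; right
    obtain rfl : b = 1 - a := by linarith
    exact ⟨a, 1 - a, ha.le, hb.le, by ring, by module⟩
  left
  set M := paraMap ((1 / 2 : ℝ) • (q - p)) ((1 / 2 : ℝ) • (r - p)) with hM
  have hopen : IsOpenMap M := M.isOpenMap_of_finiteDimensional (paraMap_surjective h)
  have hT : IsOpen {z : ℝ × ℝ | 0 < z.1 ∧ 0 < z.2 ∧ z.1 + z.2 < 2} := by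
    refine (isOpen_lt continuous_const continuous_fst).inter
      ((isOpen_lt continuous_const continuous_snd).inter
        (isOpen_lt (continuous_fst.add continuous_snd) continuous_const))
  refine mem_interior.2 ⟨(p + ·) '' (M '' {z : ℝ × ℝ | 0 < z.1 ∧ 0 < z.2 ∧ z.1 + z.2 < 2}), ?_,
    isOpenMap_add_left p _ (hopen _ hT), ?_⟩
  · rintro _ ⟨_, ⟨⟨s, t⟩, ⟨hs, ht, hst⟩, rfl⟩, rfl⟩
    simp only at hs ht hst
    refine mem_convexHull_triple_iff.2 ⟨s / 2, t / 2, by linarith, by linarith, by linarith, ?_⟩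
    rw [hM, paraMap_apply]
    module
  · refine ⟨_, ⟨(2 * a, 2 * b), ⟨by simp [ha], by simp [hb], by simp only; linarith⟩, rfl⟩, ?_⟩
    rw [hM, paraMap_apply]
    module

end Triangulation

/-! ### Lipschitz boundaries -/

theorem continuous_coord (i : Fin 2) : Continuous fun x : Plane => x i :=
  (EuclideanSpace.proj (𝕜 := ℝ) i).continuous

/-- Points just below the graph have a neighbourhood that misses `Ω`, hence are not in its closure,
and they converge to `x`. This excludes slits. -/
theorem HasLipschitzBoundary.notMem_interior_closure {Ω : Set Plane}
    (h : HasLipschitzBoundary Ω) (hΩ : IsOpen Ω) {x : Plane} (hx : x ∈ frontier Ω) :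
    x ∉ interior (closure Ω) := by
  obtain ⟨e, f, Lc, U, hU, hf, hgraph⟩ := h x hx
  intro hxi
  have hxΩ : x ∉ Ω := fun h' => by
    rw [hΩ.frontier_eq] at hx
    exact hx.2 h'
  have hle : e x 1 ≤ f (e x 0) := not_lt.1 fun h' => hxΩ ((hgraph x (mem_of_mem_nhds hU)).2 h')
  let y : ℝ → Plane := fun δ => e.symm (e x - δ • EuclideanSpace.single 1 (1 : ℝ))
  have hy0 : Tendsto y (𝓝[>] 0) (𝓝 x) := by
    have : Continuous y := by fun_prop
    have h2 := this.tendsto 0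
    simp only [y, zero_smul, sub_zero, LinearIsometryEquiv.symm_apply_apply] at h2
    exact h2.mono_left nhdsWithin_le_nhds
  have hev := hy0.eventually (inter_mem (interior_mem_nhds.2 hU) (isOpen_interior.mem_nhds hxi))
  obtain ⟨δ, ⟨hδU, hδc⟩, hδ⟩ := (hev.and self_mem_nhdsWithin).exists
  have hδ0 : (0 : ℝ) < δ := hδ
  have hlow : IsOpen (interior U ∩ {z : Plane | e z 1 < f (e z 0)}) := by
    refine isOpen_interior.inter (isOpen_lt ?_ ?_)
    · exact (continuous_coord 1).comp e.continuous
    · exact hf.continuous.comp ((continuous_coord 0).comp e.continuous)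
  have hmem : y δ ∈ interior U ∩ {z : Plane | e z 1 < f (e z 0)} := by
    refine ⟨hδU, ?_⟩
    simp only [y, mem_ofPred_eq, LinearIsometryEquiv.apply_symm_apply, PiLp.sub_apply,
      PiLp.smul_apply, PiLp.single_apply]
    norm_num
    linarith
  obtain ⟨z, hz1, hz2⟩ := mem_closure_iff.1 (interior_subset hδc) _ hlow hmem
  have := (hgraph z (interior_subset hz1.1)).1 hz2
  exact lt_asymm this hz1.2

/-- The radial compression `x ↦ a + δ x / (1 + ‖x‖)` maps the punctured plane onto the punctured
disc. -/
theorem isPreconnected_ball_diff_center (a : Plane) {δ : ℝ} (hδ : 0 < δ) :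
    IsPreconnected (ball a δ \ {a}) := by
  have hc : IsPreconnected ({0}ᶜ : Set Plane) :=
    (isConnected_compl_singleton_of_one_lt_rank (by
      rw [← Module.finrank_eq_rank]; simp) 0).isPreconnected
  have hcont : Continuous fun x : Plane => a + (δ / (1 + ‖x‖)) • x := by
    have h1 : Continuous fun x : Plane => δ / (1 + ‖x‖) :=
      continuous_const.div (continuous_const.add continuous_norm) fun x => by positivity
    fun_prop
  convert hc.image _ hcont.continuousOn using 1
  ext y
  simp only [Set.mem_sdiff, mem_ball, mem_singleton_iff, mem_image, mem_compl_iff]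
  constructor
  · rintro ⟨hy, hne⟩
    rw [dist_eq_norm] at hy
    have hpos : 0 < δ - ‖y - a‖ := by linarith
    refine ⟨(1 / (δ - ‖y - a‖)) • (y - a), ?_, ?_⟩
    · simp [sub_eq_zero, hne, hpos.ne']
    · rw [norm_smul, smul_smul, Real.norm_of_nonneg (by positivity)]
      have : δ / (1 + 1 / (δ - ‖y - a‖) * ‖y - a‖) * (1 / (δ - ‖y - a‖)) = 1 := by
        have h3 : (1 + 1 / (δ - ‖y - a‖) * ‖y - a‖) = δ / (δ - ‖y - a‖) := by
          field_simp; ring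
        rw [h3]; field_simp
      rw [this, one_smul]; abel
  · rintro ⟨x, hx, rfl⟩
    have hxn : 0 < ‖x‖ := norm_pos_iff.2 hx
    refine ⟨?_, ?_⟩
    · rw [dist_eq_norm, add_sub_cancel_left, norm_smul, Real.norm_of_nonneg (by positivity),
        div_mul_eq_mul_div, div_lt_iff₀ (by positivity)]
      nlinarith
    · intro h0
      have : (δ / (1 + ‖x‖)) • x = 0 := by simpa using h0
      rcases smul_eq_zero.1 this with h1 | h1
      · have : 0 < δ / (1 + ‖x‖) := by positivity
        linarith
      · exact hx h1

/-- Every point of the closure of a Lipschitz domain has small neighbourhoods whose intersection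
with the domain, without the point, is connected. -/
theorem HasLipschitzBoundary.exists_isPreconnected {Ω : Set Plane} (h : HasLipschitzBoundary Ω)
    (hΩ : IsOpen Ω) {a : Plane} (ha : a ∈ closure Ω) {U : Set Plane} (hU : U ∈ 𝓝 a) :
    ∃ B ∈ 𝓝 a, B ⊆ U ∧ IsPreconnected ((Ω ∩ B) \ {a}) := by
  by_cases haΩ : a ∈ Ω
  · obtain ⟨δ, hδ, hball⟩ := Metric.mem_nhds_iff.1 (inter_mem hU (hΩ.mem_nhds haΩ))
    refine ⟨ball a δ, ball_mem_nhds a hδ, fun x hx => (hball hx).1, ?_⟩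
    rw [inter_eq_self_of_subset_right fun x hx => (hball hx).2]
    exact isPreconnected_ball_diff_center a hδ
  have haf : a ∈ frontier Ω := by rw [hΩ.frontier_eq]; exact ⟨ha, haΩ⟩
  obtain ⟨e, f, Lc, W, hW, hf, hgraph⟩ := h a haf
  have hge : e a 1 ≤ f (e a 0) := not_lt.1 fun h' => haΩ ((hgraph a (mem_of_mem_nhds hW)).2 h')
  have hc1 : Continuous fun z : Plane => e z 1 := (continuous_coord 1).comp e.continuous
  have hc0 : Continuous fun z : Plane => e z 0 := (continuous_coord 0).comp e.continuous
  have hle : f (e a 0) ≤ e a 1 := by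
    by_contra! hlt
    have hopen : IsOpen {z : Plane | e z 1 < f (e z 0)} :=
      isOpen_lt hc1 (hf.continuous.comp hc0)
    obtain ⟨z, hz, hzΩ⟩ := mem_closure_iff_nhds.1 ha _ (inter_mem hW (hopen.mem_nhds hlt))
    exact lt_asymm ((hgraph z hz.1).1 hzΩ) hz.2
  have heq : f (e a 0) = e a 1 := le_antisymm hle hge
  -- Flattening the boundary: height is measured from the graph, so near `a` the domain becomes the
  -- image of an open rectangle. Here `a` is on the boundary, so removing it from the domain changes
  -- nothing.
  let Φ : ℝ × ℝ → Plane := fun z => e.symm (!₂[z.1, f z.1 + z.2])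
  have hΦ : Continuous Φ := by
    refine e.symm.continuous.comp ?_
    refine (PiLp.continuous_toLp 2 _).comp (continuous_pi fun i => ?_)
    fin_cases i
    · exact continuous_fst
    · exact (hf.continuous.comp continuous_fst).add continuous_snd
  have hΦa : Φ (e a 0, 0) = a := by
    simp only [Φ, add_zero, heq]
    rw [LinearIsometryEquiv.symm_apply_eq]
    ext i; fin_cases i <;> simp
  have hpre : Φ ⁻¹' (U ∩ W) ∈ 𝓝 (e a 0, (0 : ℝ)) :=
    hΦ.continuousAt.preimage_mem_nhds (by rw [hΦa]; exact inter_mem hU hW)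
  obtain ⟨δ, hδ, hball⟩ := Metric.mem_nhds_iff.1 hpre
  have hΦe : ∀ z : Plane, Φ (e z 0, e z 1 - f (e z 0)) = z := fun z => by
    simp only [Φ, add_sub_cancel]
    rw [LinearIsometryEquiv.symm_apply_eq]
    ext i; fin_cases i <;> simp
  refine ⟨{z | |e z 0 - e a 0| < δ ∧ |e z 1 - f (e z 0)| < δ}, ?_, ?_, ?_⟩
  · refine IsOpen.mem_nhds ?_ ?_
    · exact (isOpen_lt (hc0.sub continuous_const).abs continuous_const).inter
        (isOpen_lt (hc1.sub (hf.continuous.comp hc0)).abs continuous_const)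
    · simp [heq, hδ]
  · rintro z ⟨h0, h1⟩
    have : (e z 0, e z 1 - f (e z 0)) ∈ ball (e a 0, (0 : ℝ)) δ := by
      rw [mem_ball, Prod.dist_eq, max_lt_iff, Real.dist_eq, Real.dist_eq, sub_zero]
      exact ⟨h0, h1⟩
    have := hball this
    rw [mem_preimage, hΦe] at this
    exact this.1
  · have himg : (Ω ∩ {z | |e z 0 - e a 0| < δ ∧ |e z 1 - f (e z 0)| < δ}) \ {a} =
        Φ '' (Ioo (e a 0 - δ) (e a 0 + δ) ×ˢ Ioo 0 δ) := by
      ext z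
      constructor
      · rintro ⟨⟨hzΩ, h0, h1⟩, -⟩
        refine ⟨(e z 0, e z 1 - f (e z 0)), ⟨?_, ?_⟩, hΦe z⟩
        · rw [abs_lt] at h0
          constructor <;> simp only <;> linarith [h0.1, h0.2]
        · have hmem : (e z 0, e z 1 - f (e z 0)) ∈ ball (e a 0, (0 : ℝ)) δ := by
            rw [mem_ball, Prod.dist_eq, max_lt_iff, Real.dist_eq, Real.dist_eq, sub_zero]
            exact ⟨h0, h1⟩
          have hzW := hball hmem
          rw [mem_preimage, hΦe] at hzW
          have := (hgraph z hzW.2).1 hzΩ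
          rw [abs_lt] at h1
          constructor <;> simp only <;> linarith [h1.2]
      · rintro ⟨⟨s, t⟩, ⟨hs, ht⟩, rfl⟩
        simp only [mem_Ioo] at hs ht
        have hmem : ((s, t) : ℝ × ℝ) ∈ ball (e a 0, (0 : ℝ)) δ := by
          rw [mem_ball, Prod.dist_eq, max_lt_iff, Real.dist_eq, Real.dist_eq, sub_zero, abs_lt,
            abs_lt]
          constructor <;> constructor <;> simp only <;> linarith [hs.1, hs.2, ht.1, ht.2]
        have hzW := (hball hmem).2
        have he0 : e (Φ (s, t)) 0 = s := by simp [Φ]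
        have he1 : e (Φ (s, t)) 1 = f s + t := by simp [Φ]
        have hΩz : Φ (s, t) ∈ Ω := (hgraph _ hzW).2 (by rw [he0, he1]; linarith [ht.1])
        refine ⟨⟨hΩz, ?_, ?_⟩, fun h' => haΩ (h' ▸ hΩz)⟩
        · rw [he0, abs_lt]; constructor <;> linarith [hs.1, hs.2]
        · rw [he0, he1, abs_lt]; constructor <;> linarith [ht.1, ht.2]
    rw [himg]
    exact (((convex_Ioo _ _).prod (convex_Ioo _ _)).isPreconnected).image _ hΦ.continuousOn

/-! ### Connectivity of a triangulation through edges -/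

namespace Triangulation

variable {Ω : Set Plane} {𝒯 : Triangulation Ω}

/-- An interior point of a cell is interior to the closure of `Ω`, which is impossible for a
boundary point of a Lipschitz domain. -/
theorem frontier_subset_edges (h : HasLipschitzBoundary Ω) (hΩ : IsOpen Ω) :
    frontier Ω ⊆ ⋃ K ∈ 𝒯.cells, ⋃ z ∈ K.offDiag, segment ℝ z.1 z.2 := by
  intro x hx
  have hxc : x ∈ closure Ω := frontier_subset_closure hx
  rw [← 𝒯.cover, mem_iUnion₂] at hxc
  obtain ⟨K, hK, hxK⟩ := hxc
  simp only [mem_iUnion, Finset.mem_offDiag, exists_prop]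
  refine ⟨K, hK, ?_⟩
  obtain ⟨p, hp, q, hq, r, hr, hpq, hpr, hqr, hKe⟩ := exists_triple hK
  have hv := volume_hull_ne_zero hK
  rw [hKe] at hxK hv
  rcases interior_or_edge hv hxK with h' | h' | h' | h'
  · refine absurd (interior_mono ?_ h') (h.notMem_interior_closure hΩ hx)
    rw [← hKe]
    exact 𝒯.convexHull_subset_closure hK
  · exact ⟨(p, q), ⟨hp, hq, hpq⟩, h'⟩
  · exact ⟨(p, r), ⟨hp, hr, hpr⟩, h'⟩
  · exact ⟨(q, r), ⟨hq, hr, hqr⟩, h'⟩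

theorem volume_segment (x y : Plane) : volume (segment ℝ x y) = 0 := by
  rw [← convexHull_pair]
  refine measure_mono_null (convexHull_subset_affineSpan _)
    (Measure.addHaar_affineSubspace _ _ fun htop => ?_)
  have h1 := (collinear_pair ℝ x y).finrank_le_one
  rw [← direction_affineSpan, htop, AffineSubspace.direction_top, finrank_top] at h1
  simp at h1

theorem volume_frontier (𝒯 : Triangulation Ω) (h : HasLipschitzBoundary Ω) (hΩ : IsOpen Ω) :
    volume (frontier Ω) = 0 := by
  refine measure_mono_null (𝒯.frontier_subset_edges h hΩ) ?_
  refine (measure_biUnion_null_iff (Finset.countable_toSet _)).2 fun K _ => ?_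
  exact (measure_biUnion_null_iff (Finset.countable_toSet _)).2 fun z _ => volume_segment _ _

/-- The triangles around a vertex are connected through edges. -/
theorem exists_adjacent_star (h : HasLipschitzBoundary Ω) (hΩ : IsOpen Ω) {a : Plane}
    {P : Finset Plane → Prop} {K₀ L₀ : Finset Plane} (hK₀ : K₀ ∈ 𝒯.cells) (hL₀ : L₀ ∈ 𝒯.cells)
    (haK : a ∈ K₀) (haL : a ∈ L₀) (hPK : P K₀) (hPL : ¬ P L₀) :
    ∃ K ∈ 𝒯.cells, ∃ L ∈ 𝒯.cells, a ∈ K ∧ a ∈ L ∧ P K ∧ ¬ P L ∧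
      ∃ p ∈ K, p ∈ L ∧ ∃ q ∈ K, q ∈ L ∧ p ≠ q := by
  classical
  by_contra! hno
  have hac : a ∈ closure Ω := 𝒯.convexHull_subset_closure hK₀ (subset_convexHull ℝ _ haK)
  let hull : Finset Plane → Set Plane := fun K => convexHull ℝ (K : Set Plane)
  have hclosed : ∀ s : Finset (Finset Plane), IsClosed (⋃ K ∈ s, hull K) := fun s =>
    s.finite_toSet.isClosed_biUnion fun K _ => (isCompact_hull K).isClosed
  -- Conformity forbids hanging nodes: if `a` were in the cell `K` without being its vertex, it
  -- would be in the span of the other two vertices of `K₀`.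
  have hvert : ∀ K ∈ 𝒯.cells, a ∈ hull K → a ∈ K := by
    intro K hK haK'
    have h1 := 𝒯.inter K hK K₀ hK₀ ⟨haK', subset_convexHull ℝ _ haK⟩
    by_contra hcon
    have h2 := (𝒯.indep K₀ hK₀).notMem_affineSpan_sdiff ⟨a, haK⟩ univ
    refine h2 (affineSpan_mono ℝ ?_ (convexHull_subset_affineSpan _ h1))
    rintro x ⟨hxK, hxL⟩
    refine ⟨⟨x, hxL⟩, ⟨trivial, ?_⟩, rfl⟩
    intro hx
    obtain rfl : x = a := congrArg Subtype.val hx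
    exact hcon hxK
  have hU : (⋃ K ∈ 𝒯.cells.filter (a ∉ ·), hull K)ᶜ ∈ 𝓝 a := by
    refine (hclosed _).isOpen_compl.mem_nhds ?_
    simp only [mem_compl_iff, mem_iUnion, Finset.mem_filter, not_exists]
    rintro K ⟨hK, haK'⟩ hx
    exact haK' (hvert K hK hx)
  obtain ⟨B, hB, hBU, hconn⟩ := h.exists_isPreconnected hΩ hac hU
  -- The interior of a cell accumulates at its vertex `a` and lies in the closure of `Ω`; a nonempty
  -- open set still has points after `a` is removed.
  have hmeet : ∀ K ∈ 𝒯.cells, a ∈ K → ((Ω ∩ B) \ {a} ∩ hull K).Nonempty := by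
    intro K hK haK'
    have h1 : a ∈ closure (interior (hull K)) := by
      rw [(convex_convexHull ℝ _).closure_interior_eq_closure_of_nonempty_interior
        (interior_hull_nonempty hK)]
      exact subset_closure (subset_convexHull ℝ _ haK')
    have h2 : (interior (hull K) ∩ interior B).Nonempty := by
      obtain ⟨y, hy1, hy2⟩ := mem_closure_iff_nhds.1 h1 _ (interior_mem_nhds.2 hB)
      exact ⟨y, hy2, hy1⟩
    obtain ⟨y, hy⟩ := h2
    have hopen := (isOpen_interior (s := hull K)).inter (isOpen_interior (s := B))
    obtain ⟨z, hz1, hz2⟩ := mem_closure_iff.1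
      (𝒯.convexHull_subset_closure hK (interior_subset hy.1)) _ hopen hy
    obtain ⟨w, hw1, hw2⟩ := (dense_compl_singleton a).inter_open_nonempty _ (hopen.inter hΩ)
      ⟨z, hz1, hz2⟩
    exact ⟨w, ⟨⟨hw1.2, interior_subset hw1.1.2⟩, hw2⟩, interior_subset hw1.1.1⟩
  have hcov : (Ω ∩ B) \ {a} ⊆ (⋃ K ∈ 𝒯.cells.filter fun K => a ∈ K ∧ P K, hull K) ∪
      ⋃ K ∈ 𝒯.cells.filter fun K => a ∈ K ∧ ¬ P K, hull K := by
    rintro x ⟨⟨hxΩ, hxB⟩, -⟩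
    have hxc := subset_closure hxΩ
    rw [← 𝒯.cover, mem_iUnion₂] at hxc
    obtain ⟨K, hK, hxK⟩ := hxc
    have haK' : a ∈ K := by
      by_contra hn
      exact hBU hxB (mem_iUnion₂.2 ⟨K, Finset.mem_filter.2 ⟨hK, hn⟩, hxK⟩)
    by_cases hP : P K
    · exact Or.inl (mem_iUnion₂.2 ⟨K, Finset.mem_filter.2 ⟨hK, haK', hP⟩, hxK⟩)
    · exact Or.inr (mem_iUnion₂.2 ⟨K, Finset.mem_filter.2 ⟨hK, haK', hP⟩, hxK⟩)
  -- The cells at `a` with and without `P` form two closed sets that cover a connected punctured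
  -- neighbourhood, so they share a point `x ≠ a`. If the two cells through `x` had only the vertex
  -- `a` in common, conformity would force `x = a`.
  obtain ⟨x, hx, hx1, hx2⟩ := isPreconnected_closed_iff.1 hconn _ _ (hclosed _) (hclosed _) hcov
    ((hmeet K₀ hK₀ haK).mono (inter_subset_inter_right _ (subset_biUnion_of_mem
      (u := hull) (Finset.mem_filter.2 ⟨hK₀, haK, hPK⟩))))
    ((hmeet L₀ hL₀ haL).mono (inter_subset_inter_right _ (subset_biUnion_of_mem
      (u := hull) (Finset.mem_filter.2 ⟨hL₀, haL, hPL⟩))))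
  obtain ⟨K, hK, hxK⟩ := mem_iUnion₂.1 hx1
  obtain ⟨L, hL, hxL⟩ := mem_iUnion₂.1 hx2
  rw [Finset.mem_filter] at hK hL
  have h1 := 𝒯.inter K hK.1 L hL.1 ⟨hxK, hxL⟩
  have h2 : (K : Set Plane) ∩ L ⊆ {a} := fun y hy =>
    hno K hK.1 L hL.1 hK.2.1 hL.2.1 hK.2.2 hL.2.2 y hy.1 hy.2 a hK.2.1 hL.2.1
  have h3 := convexHull_mono h2 h1
  rw [convexHull_singleton] at h3
  exact hx.2 h3

/-- All triangles are connected through edges. -/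
theorem exists_adjacent (h : HasLipschitzBoundary Ω) (hΩ : IsOpen Ω) (hconn : IsPreconnected Ω)
    {P : Finset Plane → Prop} {K₀ L₀ : Finset Plane} (hK₀ : K₀ ∈ 𝒯.cells) (hL₀ : L₀ ∈ 𝒯.cells)
    (hPK : P K₀) (hPL : ¬ P L₀) :
    ∃ K ∈ 𝒯.cells, ∃ L ∈ 𝒯.cells, P K ∧ ¬ P L ∧ ∃ p ∈ K, p ∈ L ∧ ∃ q ∈ K, q ∈ L ∧ p ≠ q := by
  classical
  let hull : Finset Plane → Set Plane := fun K => convexHull ℝ (K : Set Plane)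
  have hclosed : ∀ s : Finset (Finset Plane), IsClosed (⋃ K ∈ s, hull K) := fun s =>
    s.finite_toSet.isClosed_biUnion fun K _ => (isCompact_hull K).isClosed
  have hmeet : ∀ K ∈ 𝒯.cells, (Ω ∩ hull K).Nonempty := by
    intro K hK
    obtain ⟨y, hy⟩ := interior_hull_nonempty hK
    obtain ⟨z, hz1, hz2⟩ := mem_closure_iff.1
      (𝒯.convexHull_subset_closure hK (interior_subset hy)) _ isOpen_interior hy
    exact ⟨z, hz2, interior_subset hz1⟩
  have hcov : Ω ⊆ (⋃ K ∈ 𝒯.cells.filter P, hull K) ∪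
      ⋃ K ∈ 𝒯.cells.filter fun K => ¬ P K, hull K := by
    intro x hxΩ
    have hxc := subset_closure hxΩ
    rw [← 𝒯.cover, mem_iUnion₂] at hxc
    obtain ⟨K, hK, hxK⟩ := hxc
    by_cases hP : P K
    · exact Or.inl (mem_iUnion₂.2 ⟨K, Finset.mem_filter.2 ⟨hK, hP⟩, hxK⟩)
    · exact Or.inr (mem_iUnion₂.2 ⟨K, Finset.mem_filter.2 ⟨hK, hP⟩, hxK⟩)
  obtain ⟨x, hx, hx1, hx2⟩ := isPreconnected_closed_iff.1 hconn _ _ (hclosed _) (hclosed _) hcov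
    ((hmeet K₀ hK₀).mono (inter_subset_inter_right _ (subset_biUnion_of_mem
      (u := hull) (Finset.mem_filter.2 ⟨hK₀, hPK⟩))))
    ((hmeet L₀ hL₀).mono (inter_subset_inter_right _ (subset_biUnion_of_mem
      (u := hull) (Finset.mem_filter.2 ⟨hL₀, hPL⟩))))
  obtain ⟨K, hK, hxK⟩ := mem_iUnion₂.1 hx1
  obtain ⟨L, hL, hxL⟩ := mem_iUnion₂.1 hx2
  rw [Finset.mem_filter] at hK hL
  have h1 := 𝒯.inter K hK.1 L hL.1 ⟨hxK, hxL⟩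
  -- Connectedness of `Ω` only gives two touching cells, hence a common vertex; the star of that
  -- vertex provides a crossing through an edge.
  obtain ⟨a, haK, haL⟩ : ((K : Set Plane) ∩ L).Nonempty := convexHull_nonempty_iff.1 ⟨x, h1⟩
  obtain ⟨K', hK', L', hL', -, -, hPK', hPL', hpq⟩ :=
    exists_adjacent_star h hΩ hK.1 hL.1 haK haL hK.2 hL.2
  exact ⟨K', hK', L', hL', hPK', hPL', hpq⟩

end Triangulation

/-- A function on a finite set which varies by at most `D` across a connected adjacency relation
varies by at most `card * D`. -/
theorem norm_sub_le_card_mul {α F : Type*} [NormedAddCommGroup F] (s : Finset α) (m : α → F)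
    {D : ℝ} (hD : 0 ≤ D) (adj : α → α → Prop)
    (hadj : ∀ i ∈ s, ∀ j ∈ s, adj i j → ‖m i - m j‖ ≤ D)
    (hconn : ∀ P : α → Prop, ∀ i ∈ s, ∀ j ∈ s, P i → ¬ P j →
      ∃ i' ∈ s, ∃ j' ∈ s, P i' ∧ ¬ P j' ∧ adj i' j')
    {i j : α} (hi : i ∈ s) (hj : j ∈ s) : ‖m i - m j‖ ≤ s.card * D := by
  classical
  -- Within distance `n D` of `m i` there are either all indices or at least `n + 1` of them,
  -- because each further step across an adjacency reaches a new index. For `n = card` only the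
  -- first case is possible.
  have key : ∀ n : ℕ, (∀ k ∈ s, ‖m i - m k‖ ≤ n * D) ∨
      n + 1 ≤ (s.filter fun k => ‖m i - m k‖ ≤ n * D).card := by
    intro n
    induction n with
    | zero =>
      right
      exact Finset.card_pos.2 ⟨i, by simp [hi]⟩
    | succ n ih =>
      have hmono : ∀ x : ℝ, x ≤ n * D → x ≤ ((n + 1 : ℕ) : ℝ) * D := fun x hx => by
        push_cast; nlinarith
      rcases ih with ih | ih
      · exact Or.inl fun k hk => hmono _ (ih k hk)
      by_cases hall : ∀ k ∈ s, ‖m i - m k‖ ≤ n * D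
      · exact Or.inl fun k hk => hmono _ (hall k hk)
      push Not at hall
      obtain ⟨k, hk, hlt⟩ := hall
      obtain ⟨i', hi', j', hj', hPi, hPj, ha⟩ := hconn (fun k => ‖m i - m k‖ ≤ n * D) i hi k hk
        (by simp; positivity) (not_le.2 hlt)
      right
      have hlt' : (s.filter fun k => ‖m i - m k‖ ≤ n * D) ⊂
          s.filter fun k => ‖m i - m k‖ ≤ ((n + 1 : ℕ) : ℝ) * D := by
        refine Finset.ssubset_iff_subset_ne.2 ⟨fun k hk => ?_, fun heq => ?_⟩
        · rw [Finset.mem_filter] at hk ⊢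
          exact ⟨hk.1, hmono _ hk.2⟩
        · have : j' ∈ s.filter fun k => ‖m i - m k‖ ≤ n * D := by
            rw [heq, Finset.mem_filter]
            refine ⟨hj', ?_⟩
            calc ‖m i - m j'‖ = ‖(m i - m i') + (m i' - m j')‖ := by rw [sub_add_sub_cancel]
              _ ≤ ‖m i - m i'‖ + ‖m i' - m j'‖ := norm_add_le _ _
              _ ≤ n * D + D := add_le_add hPi (hadj i' hi' j' hj' ha)
              _ = _ := by push_cast; ring
          exact hPj (Finset.mem_filter.1 this).2
      exact Nat.succ_le_of_lt (lt_of_le_of_lt ih (Finset.card_lt_card hlt') |>.trans_le le_rfl)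
  rcases key s.card with h | h
  · exact h j hj
  · exact absurd (h.trans (Finset.card_filter_le _ _)) (by omega)

/-! ### Estimates on the cells of a triangulation -/

/-- A function continuous up to the boundary with a square integrable upper gradient. -/
structure IsUpperGradPair {F : Type*} [NormedAddCommGroup F] (Ω : Set Plane) (f : Plane → F)
    (ρ : Plane → ℝ≥0∞) : Prop where
  cont : ContinuousOn f (closure Ω)
  upper : UpperGradOn (closure Ω) f ρ
  meas : Measurable ρ
  fin : ∫⁻ x in closure Ω, ρ x ^ 2 ≠ ⊤

/-- The energy of an upper gradient on the convex hull of `K`. -/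
def cellEnergy (ρ : Plane → ℝ≥0∞) (K : Finset Plane) : ℝ :=
  (∫⁻ x in convexHull ℝ (K : Set Plane), ρ x ^ 2).toReal

/-- The squared `L²` norm on the convex hull of `K`. -/
def cellMass {F : Type*} [NormedAddCommGroup F] (f : Plane → F) (K : Finset Plane) : ℝ :=
  (∫⁻ x in convexHull ℝ (K : Set Plane), ‖f x‖ₑ ^ 2).toReal

/-- The squared `L²` norm on an edge, in the normalized parameter. -/
def edgeMass {F : Type*} [NormedAddCommGroup F] (f : Plane → F) (p q : Plane) : ℝ≥0∞ :=
  ∫⁻ s in Icc (0 : ℝ) 1, ‖f (AffineMap.lineMap p q s)‖ₑ ^ 2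

theorem cellEnergy_nonneg (ρ : Plane → ℝ≥0∞) (K : Finset Plane) : 0 ≤ cellEnergy ρ K :=
  ENNReal.toReal_nonneg

namespace IsUpperGradPair

variable {F : Type*} [NormedAddCommGroup F] {Ω : Set Plane} {𝒯 : Triangulation Ω}
  {f : Plane → F} {ρ : Plane → ℝ≥0∞} {K L : Finset Plane}

theorem lintegral_eq_cellEnergy (h : IsUpperGradPair Ω f ρ) (hK : K ∈ 𝒯.cells) :
    ∫⁻ x in convexHull ℝ (K : Set Plane), ρ x ^ 2 = ENNReal.ofReal (cellEnergy ρ K) :=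
  (ENNReal.ofReal_toReal (ne_top_of_le_ne_top h.fin
    (lintegral_mono_set (𝒯.convexHull_subset_closure hK)))).symm

theorem _root_.ContinuousOn.lintegral_enorm_sq_ne_top {S : Set Plane} {g : Plane → F}
    (hg : ContinuousOn g S) (hS : IsCompact S) : ∫⁻ x in S, ‖g x‖ₑ ^ 2 ≠ ⊤ := by
  obtain ⟨C, hC⟩ := hS.exists_bound_of_continuousOn hg
  refine ne_top_of_le_ne_top (b := ∫⁻ x in S, ENNReal.ofReal C ^ 2) ?_ ?_
  · rw [setLIntegral_const]
    exact ENNReal.mul_ne_top (by simp) hS.measure_lt_top.ne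
  · refine setLIntegral_mono' hS.measurableSet fun x hx => ?_
    gcongr
    rw [← ofReal_norm]
    exact ENNReal.ofReal_le_ofReal (hC x hx)

theorem lintegral_eq_cellMass (h : IsUpperGradPair Ω f ρ) (hK : K ∈ 𝒯.cells) :
    ∫⁻ x in convexHull ℝ (K : Set Plane), ‖f x‖ₑ ^ 2 = ENNReal.ofReal (cellMass f K) :=
  (ENNReal.ofReal_toReal ((h.cont.mono
    (𝒯.convexHull_subset_closure hK)).lintegral_enorm_sq_ne_top
      (Triangulation.isCompact_hull K))).symm

theorem enorm_sub_le_diam {x y : Plane} (hx : x ∈ convexHull ℝ (K : Set Plane))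
    (hy : y ∈ convexHull ℝ (K : Set Plane)) :
    ‖y - x‖ₑ ≤ ENNReal.ofReal (diam (K : Set Plane)) := by
  rw [← ofReal_norm, ← dist_eq_norm, ← convexHull_diam]
  exact ENNReal.ofReal_le_ofReal
    (dist_le_diam_of_mem (Triangulation.isCompact_hull K).isBounded hy hx)

theorem volume_hull_eq (K : Finset Plane) : volume (convexHull ℝ (K : Set Plane)) =
    ENNReal.ofReal (volume.real (convexHull ℝ (K : Set Plane))) :=
  (ENNReal.ofReal_toReal (Triangulation.volume_hull_ne_top K)).symm

theorem volume_real_pos (hK : K ∈ 𝒯.cells) : 0 < volume.real (convexHull ℝ (K : Set Plane)) :=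
  ENNReal.toReal_pos (Triangulation.volume_hull_ne_zero hK) (Triangulation.volume_hull_ne_top K)

theorem cell_poincare (h : IsUpperGradPair Ω f ρ) (hK : K ∈ 𝒯.cells) :
    ∃ c : F, ∫⁻ x in convexHull ℝ (K : Set Plane), ‖f x - c‖ₑ ^ 2 ≤
      ENNReal.ofReal (4 * diam (K : Set Plane) ^ 2 * cellEnergy ρ K) := by
  have hsub := 𝒯.convexHull_subset_closure hK
  obtain ⟨c, hc⟩ := (h.upper.mono hsub).exists_poincare h.meas (convex_convexHull ℝ _)
    (Triangulation.measurableSet_hull K) (h.cont.mono hsub) (Triangulation.volume_hull_ne_zero hK)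
    (Triangulation.volume_hull_ne_top K) (d := ENNReal.ofReal (diam (K : Set Plane)))
    fun x hx y hy => enorm_sub_le_diam hx hy
  refine ⟨c, hc.trans_eq ?_⟩
  rw [h.lintegral_eq_cellEnergy hK, ← ENNReal.ofReal_pow diam_nonneg,
    ENNReal.ofReal_mul (by positivity), ENNReal.ofReal_mul (by norm_num)]
  simp

/-- The shape constant `κ` turns the factor `diam² / area` of the energy in `UpperGradOn.edge_le`
into a constant that does not depend on the size of the cell. -/
theorem cell_edge (h : IsUpperGradPair Ω f ρ) (hK : K ∈ 𝒯.cells) {κ : ℝ}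
    (hκ : diam (K : Set Plane) ^ 2 ≤ κ * volume.real (convexHull ℝ (K : Set Plane)))
    {p q : Plane} (hp : p ∈ K) (hq : q ∈ K) (hpq : p ≠ q) (c : F) {I : ℝ} (hI0 : 0 ≤ I)
    (hI : ∫⁻ x in convexHull ℝ (K : Set Plane), ‖f x - c‖ₑ ^ 2 ≤ ENNReal.ofReal I) :
    edgeMass (fun x => f x - c) p q ≤ ENNReal.ofReal
      (8 / volume.real (convexHull ℝ (K : Set Plane)) * I + 8 * κ * cellEnergy ρ K) := by
  have hsub := 𝒯.convexHull_subset_closure hK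
  have hV := volume_real_pos hK
  obtain ⟨r, hr, hKe⟩ := Triangulation.exists_third hK hp hq hpq
  have hd1 : ‖r - p‖ₑ ≤ ENNReal.ofReal (diam (K : Set Plane)) :=
    enorm_sub_le_diam (subset_convexHull ℝ _ hp) (subset_convexHull ℝ _ hr)
  have hd2 : ‖r - q‖ₑ ≤ ENNReal.ofReal (diam (K : Set Plane)) :=
    enorm_sub_le_diam (subset_convexHull ℝ _ hq) (subset_convexHull ℝ _ hr)
  have key := UpperGradOn.edge_le (p := p) (q := q) (r := r) (hKe ▸ h.upper.mono hsub) h.meas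
    (hKe ▸ h.cont.mono hsub) (hKe ▸ Triangulation.volume_hull_ne_zero hK) hd1 hd2 c
  rw [← hKe] at key
  refine key.trans ?_
  rw [h.lintegral_eq_cellEnergy hK, volume_hull_eq, ENNReal.ofReal_add (by positivity)
    (by
      have : 0 ≤ κ := by
        by_contra! hneg
        nlinarith [sq_nonneg (diam (K : Set Plane))]
      have := cellEnergy_nonneg ρ K
      positivity)]
  gcongr ?_ + ?_
  · rw [ENNReal.ofReal_mul (by positivity), ENNReal.ofReal_div_of_pos hV]
    gcongr
    simp
  · rw [← ENNReal.ofReal_pow diam_nonneg, show (8 : ℝ≥0∞) = ENNReal.ofReal 8 by simp,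
      ← ENNReal.ofReal_mul (by norm_num), ← ENNReal.ofReal_div_of_pos hV,
      ← ENNReal.ofReal_mul (by positivity)]
    apply ENNReal.ofReal_le_ofReal
    gcongr
    · exact cellEnergy_nonneg ρ K
    · rw [div_le_iff₀ hV]; linarith

theorem shape_nonneg (hK : K ∈ 𝒯.cells) {κ : ℝ}
    (hκ : diam (K : Set Plane) ^ 2 ≤ κ * volume.real (convexHull ℝ (K : Set Plane))) : 0 ≤ κ := by
  have hV := volume_real_pos hK
  by_contra! hneg
  nlinarith [sq_nonneg (diam (K : Set Plane))]

/-- Constants on the cells that approximate `f` on the cells and on their edges. -/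
theorem exists_cell_constants (h : IsUpperGradPair Ω f ρ) {κ : ℝ}
    (hκ : ∀ K ∈ 𝒯.cells,
      diam (K : Set Plane) ^ 2 ≤ κ * volume.real (convexHull ℝ (K : Set Plane))) :
    ∃ c : Finset Plane → F, ∀ K ∈ 𝒯.cells,
      ∫⁻ x in convexHull ℝ (K : Set Plane), ‖f x - c K‖ₑ ^ 2 ≤
        ENNReal.ofReal (4 * diam (K : Set Plane) ^ 2 * cellEnergy ρ K) ∧
      ∀ p ∈ K, ∀ q ∈ K, p ≠ q →
        edgeMass (fun x => f x - c K) p q ≤ ENNReal.ofReal (40 * κ * cellEnergy ρ K) := by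
  choose! c hc using fun K (hK : K ∈ 𝒯.cells) => h.cell_poincare hK
  refine ⟨c, fun K hK => ⟨hc K hK, fun p hp q hq hpq => ?_⟩⟩
  have hE := cellEnergy_nonneg ρ K
  have hV := volume_real_pos hK
  refine (h.cell_edge hK (hκ K hK) hp hq hpq (c K) (by positivity) (hc K hK)).trans ?_
  apply ENNReal.ofReal_le_ofReal
  -- With the Poincaré bound for the `L²` term, `8 · 4 κ` from that term and `8 κ` from the energy
  -- term add up to `40 κ`.
  have : 8 / volume.real (convexHull ℝ (K : Set Plane)) *
      (4 * diam (K : Set Plane) ^ 2 * cellEnergy ρ K) =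
      32 * (diam (K : Set Plane) ^ 2 / volume.real (convexHull ℝ (K : Set Plane))) *
        cellEnergy ρ K := by ring
  have h2 : diam (K : Set Plane) ^ 2 / volume.real (convexHull ℝ (K : Set Plane)) ≤ κ := by
    rw [div_le_iff₀ hV]; exact hκ K hK
  rw [this]
  nlinarith

/-- The trace inequality on an edge of a cell. -/
theorem edgeMass_le (h : IsUpperGradPair Ω f ρ) (hK : K ∈ 𝒯.cells) {κ : ℝ}
    (hκ : diam (K : Set Plane) ^ 2 ≤ κ * volume.real (convexHull ℝ (K : Set Plane)))
    {p q : Plane} (hp : p ∈ K) (hq : q ∈ K) (hpq : p ≠ q) :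
    edgeMass f p q ≤ ENNReal.ofReal
      (8 / volume.real (convexHull ℝ (K : Set Plane)) * cellMass f K +
        8 * κ * cellEnergy ρ K) := by
  have := h.cell_edge hK hκ hp hq hpq 0 (I := cellMass f K) ENNReal.toReal_nonneg
    (by simp only [sub_zero]; exact (h.lintegral_eq_cellMass hK).le)
  simpa only [sub_zero] using this

/-- Two constants that are both close to `f` in `L²` of one edge are close to each other; the
parameter interval has length one, so no edge length appears. -/
theorem norm_sub_sq_le_of_edgeMass (c c' : F) (p q : Plane) {A B : ℝ} (hA0 : 0 ≤ A) (hB0 : 0 ≤ B)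
    (hf : AEMeasurable (fun s : ℝ => ‖f (AffineMap.lineMap p q s) - c‖ₑ ^ 2)
      (volume.restrict (Icc 0 1)))
    (hA : edgeMass (fun x => f x - c) p q ≤ ENNReal.ofReal A)
    (hB : edgeMass (fun x => f x - c') p q ≤ ENNReal.ofReal B) :
    ‖c - c'‖ ^ 2 ≤ 2 * A + 2 * B := by
  have h1 : ‖c - c'‖ₑ ^ 2 ≤ ENNReal.ofReal (2 * A + 2 * B) := by
    calc ‖c - c'‖ₑ ^ 2 = ∫⁻ s in Icc (0 : ℝ) 1, ‖c - c'‖ₑ ^ 2 := by simp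
      _ ≤ ∫⁻ s in Icc (0 : ℝ) 1, (2 * ‖f (AffineMap.lineMap p q s) - c‖ₑ ^ 2 +
          2 * ‖f (AffineMap.lineMap p q s) - c'‖ₑ ^ 2) := by
        refine lintegral_mono fun s => ?_
        have := enorm_sub_sq_le c c' (f (AffineMap.lineMap p q s))
        rwa [← enorm_neg (c - f _), neg_sub] at this
      _ = 2 * edgeMass (fun x => f x - c) p q + 2 * edgeMass (fun x => f x - c') p q := by
        rw [lintegral_add_left' (hf.const_mul 2), lintegral_const_mul' _ _ (by norm_num),
          lintegral_const_mul' _ _ (by norm_num)]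
        rfl
      _ ≤ 2 * ENNReal.ofReal A + 2 * ENNReal.ofReal B := by gcongr
      _ = _ := by
        rw [ENNReal.ofReal_add (by positivity) (by positivity), ENNReal.ofReal_mul (by norm_num),
          ENNReal.ofReal_mul (by norm_num)]
        simp
  rw [← ofReal_norm, ← ENNReal.ofReal_pow (norm_nonneg _)] at h1
  exact (ENNReal.ofReal_le_ofReal_iff (by positivity)).1 h1

theorem continuousOn_edge (h : IsUpperGradPair Ω f ρ) (hK : K ∈ 𝒯.cells) {p q : Plane}
    (hp : p ∈ K) (hq : q ∈ K) :
    ContinuousOn (fun s : ℝ => f (AffineMap.lineMap p q s)) (Icc 0 1) := by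
  refine h.cont.comp AffineMap.lineMap_continuous.continuousOn fun s hs => ?_
  refine 𝒯.convexHull_subset_closure hK ((convex_convexHull ℝ _).segment_subset
    (subset_convexHull ℝ _ hp) (subset_convexHull ℝ _ hq) (lineMap_mem_segment ℝ p q hs))

theorem adjacent_le (h : IsUpperGradPair Ω f ρ) {κ : ℝ} (hκ0 : 0 ≤ κ) {c : Finset Plane → F}
    (hc : ∀ K ∈ 𝒯.cells, ∀ p ∈ K, ∀ q ∈ K, p ≠ q →
        edgeMass (fun x => f x - c K) p q ≤ ENNReal.ofReal (40 * κ * cellEnergy ρ K))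
    (hK : K ∈ 𝒯.cells) (hL : L ∈ 𝒯.cells) {p q : Plane} (hpK : p ∈ K) (hpL : p ∈ L)
    (hqK : q ∈ K) (hqL : q ∈ L) (hpq : p ≠ q) :
    ‖c K - c L‖ ^ 2 ≤ 80 * κ * (cellEnergy ρ K + cellEnergy ρ L) := by
  have hE := cellEnergy_nonneg ρ K
  have hE' := cellEnergy_nonneg ρ L
  have := norm_sub_sq_le_of_edgeMass (f := f) (c K) (c L) p q (by positivity) (by positivity)
    (((((h.continuousOn_edge hK hpK hqK).sub continuousOn_const).enorm).aemeasurable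
      measurableSet_Icc).pow_const 2)
    (hc K hK p hpK q hqK hpq) (hc L hL p hpL q hqL hpq)
  linarith

/-- Cell constants vary little over a set of cells that is connected through edges. -/
theorem chain_le (h : IsUpperGradPair Ω f ρ) {κ : ℝ} (hκ0 : 0 ≤ κ) {c : Finset Plane → F}
    (hc : ∀ K ∈ 𝒯.cells, ∀ p ∈ K, ∀ q ∈ K, p ≠ q →
        edgeMass (fun x => f x - c K) p q ≤ ENNReal.ofReal (40 * κ * cellEnergy ρ K))
    (s : Finset (Finset Plane)) (hs : s ⊆ 𝒯.cells)
    (hconn : ∀ P : Finset Plane → Prop, ∀ K ∈ s, ∀ L ∈ s, P K → ¬ P L →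
      ∃ K' ∈ s, ∃ L' ∈ s, P K' ∧ ¬ P L' ∧ ∃ p ∈ K', p ∈ L' ∧ ∃ q ∈ K', q ∈ L' ∧ p ≠ q)
    (hK : K ∈ s) (hL : L ∈ s) :
    ‖c K - c L‖ ^ 2 ≤ s.card ^ 2 * (80 * κ * ∑ L ∈ s, cellEnergy ρ L) := by
  have hS : 0 ≤ 80 * κ * ∑ L ∈ s, cellEnergy ρ L := by
    have := Finset.sum_nonneg fun L (_ : L ∈ s) => cellEnergy_nonneg ρ L
    positivity
  have := norm_sub_le_card_mul s c (Real.sqrt_nonneg (80 * κ * ∑ L ∈ s, cellEnergy ρ L))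
    (fun K L => ∃ p ∈ K, p ∈ L ∧ ∃ q ∈ K, q ∈ L ∧ p ≠ q) (fun K hK L hL hadj => ?_) hconn hK hL
  · calc ‖c K - c L‖ ^ 2 ≤ (s.card * √(80 * κ * ∑ L ∈ s, cellEnergy ρ L)) ^ 2 := by gcongr
      _ = _ := by rw [mul_pow, Real.sq_sqrt hS]
  · obtain ⟨p, hpK, hpL, q, hqK, hqL, hpq⟩ := hadj
    -- For equal cells the sum of the two energies would count one cell twice, but then there is
    -- nothing to prove.
    rcases eq_or_ne K L with rfl | hne
    · simp
    apply Real.le_sqrt_of_sq_le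
    refine (h.adjacent_le hκ0 hc (hs hK) (hs hL) hpK hpL hqK hqL hpq).trans ?_
    gcongr
    classical
    calc _ = ∑ M ∈ {K, L}, cellEnergy ρ M := (Finset.sum_pair hne).symm
      _ ≤ _ := Finset.sum_le_sum_of_subset_of_nonneg (by
          intro M hM
          rcases Finset.mem_insert.1 hM with rfl | hM
          · exact hK
          · rwa [Finset.mem_singleton.1 hM]) fun _ _ _ => cellEnergy_nonneg _ _

end IsUpperGradPair

/-! ### Arc length on segments -/

theorem two_mul_ofReal (x : ℝ) : 2 * ENNReal.ofReal x = ENNReal.ofReal (2 * x) := by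
  rw [ENNReal.ofReal_mul (by norm_num)]
  norm_num

/-- The link between the arc length in the definition of traces and the edge parameter in the
estimates. -/
theorem restrict_segment_eq (p q : Plane) : (μH[1] : Measure Plane).restrict (segment ℝ p q) =
    ‖q - p‖ₑ • ((volume : Measure ℝ).restrict (Icc 0 1)).map (AffineMap.lineMap p q) := by
  have hm : Measurable (AffineMap.lineMap p q : ℝ → Plane) :=
    AffineMap.lineMap_continuous.measurable
  ext s hs
  rw [Measure.restrict_apply hs, Measure.smul_apply, Measure.map_apply hm hs,
    Measure.restrict_apply (hm hs), segment_eq_image_lineMap, inter_comm, inter_comm _ (Icc _ _),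
    ← image_inter_preimage, hausdorffMeasure_lineMap_image, hausdorffMeasure_real,
    nndist_comm, nndist_eq_nnnorm]
  rfl

theorem lintegral_segment (p q : Plane) (G : Plane → ℝ≥0∞) :
    ∫⁻ x in segment ℝ p q, G x ∂(μH[1] : Measure Plane) =
      ‖q - p‖ₑ * ∫⁻ s in Icc (0 : ℝ) 1, G (AffineMap.lineMap p q s) := by
  rw [restrict_segment_eq, lintegral_smul_measure]
  rcases eq_or_ne p q with rfl | hpq
  · simp
  have hemb : MeasurableEmbedding (AffineMap.lineMap p q : ℝ → Plane) :=
    AffineMap.lineMap_continuous.measurableEmbedding (AffineMap.lineMap_injective ℝ hpq)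
  rw [hemb.lintegral_map, smul_eq_mul]

theorem lintegral_enorm_sq_segment {F : Type*} [NormedAddCommGroup F] (p q : Plane)
    (f : Plane → F) :
    ∫⁻ x in segment ℝ p q, ‖f x‖ₑ ^ 2 ∂(μH[1] : Measure Plane) = ‖q - p‖ₑ * edgeMass f p q :=
  lintegral_segment p q _

theorem lintegral_biUnion_finset_le {α β : Type*} [MeasurableSpace α] (μ : Measure α)
    (s : Finset β) (t : β → Set α) (g : α → ℝ≥0∞) :
    ∫⁻ a in ⋃ b ∈ s, t b, g a ∂μ ≤ ∑ b ∈ s, ∫⁻ a in t b, g a ∂μ := by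
  classical
  induction s using Finset.induction_on with
  | empty => simp
  | insert b s hb ih =>
    rw [Finset.set_biUnion_insert, Finset.sum_insert hb]
    exact (lintegral_union_le _ _ _).trans (by gcongr)

namespace Triangulation

variable {Ω : Set Plane} (𝒯 : Triangulation Ω)

theorem sum_lintegral_hull (g : Plane → ℝ≥0∞) :
    ∑ K ∈ 𝒯.cells, ∫⁻ x in convexHull ℝ (K : Set Plane), g x = ∫⁻ x in closure Ω, g x := by
  rw [← 𝒯.cover, lintegral_biUnion_finset₀]
  · intro K hK L hL hKL
    exact volume_hull_inter hK hL hKL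
  · exact fun K _ => (measurableSet_hull K).nullMeasurableSet

/-- For a single triangulation finiteness suffices; regularity is needed only for bounds that are
uniform over a family. -/
theorem exists_shape_constant : ∃ κ : ℝ, ∀ K ∈ 𝒯.cells,
    diam (K : Set Plane) ^ 2 ≤ κ * volume.real (convexHull ℝ (K : Set Plane)) := by
  refine ⟨∑ K ∈ 𝒯.cells, diam (K : Set Plane) ^ 2 / volume.real (convexHull ℝ (K : Set Plane)),
    fun K hK => ?_⟩
  rw [← div_le_iff₀ (IsUpperGradPair.volume_real_pos hK)]
  exact Finset.single_le_sum (f := fun K : Finset Plane =>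
    diam (K : Set Plane) ^ 2 / volume.real (convexHull ℝ (K : Set Plane)))
    (fun K _ => by positivity) hK

end Triangulation

/-! ### Global trace and Poincaré inequalities from one fixed triangulation -/

namespace IsPolygonalDomain

variable {Ω : Set Plane}

theorem restrict_closure (hΩ : IsPolygonalDomain Ω) :
    volume.restrict (closure Ω) = volume.restrict Ω := by
  obtain ⟨𝒯⟩ := hΩ.polygonal
  exact Measure.restrict_congr_set
    (closure_ae_eq_of_null_frontier (𝒯.volume_frontier hΩ.lipschitz hΩ.isOpen))

theorem lintegral_frontier_le (hΩ : IsPolygonalDomain Ω) (𝒯 : Triangulation Ω) (G : Plane → ℝ≥0∞) :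
    ∫⁻ x in frontier Ω, G x ∂(μH[1] : Measure Plane) ≤ ∑ K ∈ 𝒯.cells, ∑ z ∈ K.offDiag,
      ‖z.2 - z.1‖ₑ * ∫⁻ s in Icc (0 : ℝ) 1, G (AffineMap.lineMap z.1 z.2 s) := by
  refine (lintegral_mono_set (𝒯.frontier_subset_edges hΩ.lipschitz hΩ.isOpen)).trans ?_
  refine (lintegral_biUnion_finset_le _ _ _ _).trans (Finset.sum_le_sum fun K _ => ?_)
  refine (lintegral_biUnion_finset_le _ _ _ _).trans (Finset.sum_le_sum fun z _ => ?_)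
  rw [lintegral_segment]

theorem hausdorffMeasure_frontier_ne_top (hΩ : IsPolygonalDomain Ω) :
    (μH[1] : Measure Plane) (frontier Ω) ≠ ⊤ := by
  obtain ⟨𝒯⟩ := hΩ.polygonal
  have h := hΩ.lintegral_frontier_le 𝒯 fun _ => 1
  rw [setLIntegral_one] at h
  refine ne_top_of_le_ne_top ?_ h
  refine ENNReal.sum_ne_top.2 fun K _ => ENNReal.sum_ne_top.2 fun z _ => ?_
  simp

theorem lintegral_hull_le (hΩ : IsPolygonalDomain Ω) {𝒯 : Triangulation Ω} {K : Finset Plane}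
    (hK : K ∈ 𝒯.cells) (g : Plane → ℝ≥0∞) :
    ∫⁻ x in convexHull ℝ (K : Set Plane), g x ≤ ∫⁻ x in Ω, g x := by
  rw [← hΩ.restrict_closure]
  exact lintegral_mono_set (𝒯.convexHull_subset_closure hK)

/-- The trace inequality. -/
theorem exists_trace_constant (hΩ : IsPolygonalDomain Ω) (F : Type*) [NormedAddCommGroup F] :
    ∃ T : ℝ, 0 < T ∧ ∀ (f : Plane → F) (ρ : Plane → ℝ≥0∞), IsUpperGradPair Ω f ρ →
      ∫⁻ x in frontier Ω, ‖f x‖ₑ ^ 2 ∂(μH[1] : Measure Plane) ≤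
        ENNReal.ofReal T * ((∫⁻ x in Ω, ‖f x‖ₑ ^ 2) + ∫⁻ x in Ω, ρ x ^ 2) := by
  obtain ⟨𝒯⟩ := id hΩ.polygonal
  obtain ⟨κ, hκ⟩ := 𝒯.exists_shape_constant
  let t : Finset Plane → Plane × Plane → ℝ := fun K z =>
    ‖z.2 - z.1‖ * (8 / volume.real (convexHull ℝ (K : Set Plane)) + 8 * κ)
  have ht : ∀ K ∈ 𝒯.cells, ∀ z ∈ K.offDiag, 0 ≤ t K z := fun K hK z _ => by
    have := IsUpperGradPair.shape_nonneg hK (hκ K hK)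
    positivity
  have hS := Finset.sum_nonneg fun K hK => Finset.sum_nonneg fun z hz => ht K hK z hz
  refine ⟨1 + ∑ K ∈ 𝒯.cells, ∑ z ∈ K.offDiag, t K z, by linarith, fun f ρ h => ?_⟩
  set X := (∫⁻ x in Ω, ‖f x‖ₑ ^ 2) + ∫⁻ x in Ω, ρ x ^ 2 with hX
  calc _ ≤ _ := hΩ.lintegral_frontier_le 𝒯 _
    _ ≤ ∑ K ∈ 𝒯.cells, ∑ z ∈ K.offDiag, ENNReal.ofReal (t K z) * X := by
      refine Finset.sum_le_sum fun K hK => Finset.sum_le_sum fun z hz => ?_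
      have hz' := Finset.mem_offDiag.1 hz
      have hκ0 := IsUpperGradPair.shape_nonneg hK (hκ K hK)
      have hE := cellEnergy_nonneg ρ K
      have hM : 0 ≤ cellMass f K := ENNReal.toReal_nonneg
      calc _ ≤ ‖z.2 - z.1‖ₑ * ENNReal.ofReal
              (8 / volume.real (convexHull ℝ (K : Set Plane)) * cellMass f K +
                8 * κ * cellEnergy ρ K) := by
            gcongr
            exact h.edgeMass_le hK (hκ K hK) hz'.1 hz'.2.1 hz'.2.2
        _ ≤ ENNReal.ofReal (‖z.2 - z.1‖) * ENNReal.ofReal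
              ((8 / volume.real (convexHull ℝ (K : Set Plane)) + 8 * κ) *
                (cellMass f K + cellEnergy ρ K)) := by
            rw [ofReal_norm]
            gcongr
            have : 0 ≤ 8 / volume.real (convexHull ℝ (K : Set Plane)) := by positivity
            nlinarith [mul_nonneg this hE, mul_nonneg hκ0 hM]
        _ = ENNReal.ofReal (t K z) * ((∫⁻ x in convexHull ℝ (K : Set Plane), ‖f x‖ₑ ^ 2) +
              ∫⁻ x in convexHull ℝ (K : Set Plane), ρ x ^ 2) := by
            rw [h.lintegral_eq_cellMass hK, h.lintegral_eq_cellEnergy hK,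
              ← ENNReal.ofReal_add hM hE, ← ENNReal.ofReal_mul (norm_nonneg _),
              ← ENNReal.ofReal_mul (ht K hK z hz), mul_assoc]
        _ ≤ _ := by
            gcongr
            exact add_le_add (hΩ.lintegral_hull_le hK _) (hΩ.lintegral_hull_le hK _)
    _ = ENNReal.ofReal (∑ K ∈ 𝒯.cells, ∑ z ∈ K.offDiag, t K z) * X := by
      rw [ENNReal.ofReal_sum_of_nonneg fun K hK => Finset.sum_nonneg (ht K hK), Finset.sum_mul]
      refine Finset.sum_congr rfl fun K hK => ?_
      rw [ENNReal.ofReal_sum_of_nonneg (ht K hK), Finset.sum_mul]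
    _ ≤ _ := by
      gcongr
      linarith

/-- Finitely many edges cover the boundary, so they cannot all meet `Γ` in length zero. The set `Γ`
need not be a union of edges. -/
theorem exists_edge_of_pos (hΩ : IsPolygonalDomain Ω) (𝒯 : Triangulation Ω) {Γ : Set Plane}
    (hΓ : Γ ⊆ frontier Ω) (hpos : 0 < (μH[1] : Measure Plane) Γ) :
    ∃ K ∈ 𝒯.cells, ∃ p ∈ K, ∃ q ∈ K, p ≠ q ∧
      (μH[1] : Measure Plane) (Γ ∩ segment ℝ p q) ≠ 0 := by
  by_contra! hno
  refine hpos.ne' (measure_mono_null (t := ⋃ K ∈ 𝒯.cells, ⋃ z ∈ K.offDiag,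
    (Γ ∩ segment ℝ z.1 z.2)) (fun x hx => ?_) ?_)
  · have := 𝒯.frontier_subset_edges hΩ.lipschitz hΩ.isOpen (hΓ hx)
    simp only [mem_iUnion, exists_prop] at this ⊢
    obtain ⟨K, hK, z, hz, hxz⟩ := this
    exact ⟨K, hK, z, hz, hx, hxz⟩
  · refine (measure_biUnion_null_iff (Finset.countable_toSet _)).2 fun K hK => ?_
    refine (measure_biUnion_null_iff (Finset.countable_toSet _)).2 fun z hz => ?_
    have hz' := Finset.mem_offDiag.1 hz
    obtain ⟨h1, h2, h3⟩ := hz'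
    exact hno K hK _ h1 _ h2 h3

/-- The Poincaré inequality, with a boundary term on a part of the boundary of positive length. -/
theorem exists_poincare_constant (hΩ : IsPolygonalDomain Ω) {Γ : Set Plane}
    (hΓ : Γ ⊆ frontier Ω) (hpos : 0 < (μH[1] : Measure Plane) Γ) (F : Type*)
    [NormedAddCommGroup F] :
    ∃ C : ℝ, 0 < C ∧ ∀ (f : Plane → F) (ρ : Plane → ℝ≥0∞), IsUpperGradPair Ω f ρ →
      ∫⁻ x in Ω, ‖f x‖ₑ ^ 2 ≤ ENNReal.ofReal C * ((∫⁻ x in Ω, ρ x ^ 2) +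
        ∫⁻ x in Γ, ‖f x‖ₑ ^ 2 ∂(μH[1] : Measure Plane)) := by
  obtain ⟨𝒯⟩ := id hΩ.polygonal
  obtain ⟨κ, hκ⟩ := 𝒯.exists_shape_constant
  obtain ⟨K₀, hK₀, p, hp, q, hq, hpq, hm0⟩ := hΩ.exists_edge_of_pos 𝒯 hΓ hpos
  have hκ0 := IsUpperGradPair.shape_nonneg hK₀ (hκ K₀ hK₀)
  have hmtop : (μH[1] : Measure Plane) (Γ ∩ segment ℝ p q) ≠ ⊤ :=
    ne_top_of_le_ne_top hΩ.hausdorffMeasure_frontier_ne_top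
      (measure_mono (inter_subset_left.trans hΓ))
  set m : ℝ := ((μH[1] : Measure Plane) (Γ ∩ segment ℝ p q)).toReal with hm
  have hmpos : 0 < m := ENNReal.toReal_pos hm0 hmtop
  set l : ℝ := ‖q - p‖ with hl
  set n : ℝ := (𝒯.cells.card : ℝ) with hn
  -- The inner bracket bounds `‖c K‖²` relative to energy plus boundary term: its first part is the
  -- bound at `K₀`, its second the cost of a chain from `K` to `K₀`. The term `8 diam²` is twice the
  -- Poincaré constant of the cell.
  let a : Finset Plane → ℝ := fun K => 2 * volume.real (convexHull ℝ (K : Set Plane)) *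
    (2 * (2 / m + 80 * l * κ / m) + 2 * (n ^ 2 * (80 * κ))) + 8 * diam (K : Set Plane) ^ 2
  have ha : ∀ K ∈ 𝒯.cells, 0 ≤ a K := fun K _ => by positivity
  have hS := Finset.sum_nonneg ha
  refine ⟨1 + ∑ K ∈ 𝒯.cells, a K, by linarith, fun f ρ h => ?_⟩
  -- With an infinite boundary term the inequality is trivial, as the constant is positive.
  by_cases hG : ∫⁻ x in Γ, ‖f x‖ₑ ^ 2 ∂(μH[1] : Measure Plane) = ⊤
  · rw [hG, add_top, ENNReal.mul_top (by simpa using by linarith)]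
    exact le_top
  have hEfin : ∫⁻ x in Ω, ρ x ^ 2 ≠ ⊤ := by rw [← hΩ.restrict_closure]; exact h.fin
  set G : ℝ := (∫⁻ x in Γ, ‖f x‖ₑ ^ 2 ∂(μH[1] : Measure Plane)).toReal with hGdef
  set E : ℝ := (∫⁻ x in Ω, ρ x ^ 2).toReal with hEdef
  have hG0 : 0 ≤ G := ENNReal.toReal_nonneg
  have hE0 : 0 ≤ E := ENNReal.toReal_nonneg
  have hGe : ∫⁻ x in Γ, ‖f x‖ₑ ^ 2 ∂(μH[1] : Measure Plane) = ENNReal.ofReal G :=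
    (ENNReal.ofReal_toReal hG).symm
  have hEe : ∫⁻ x in Ω, ρ x ^ 2 = ENNReal.ofReal E := (ENNReal.ofReal_toReal hEfin).symm
  have hEsum : ∑ K ∈ 𝒯.cells, cellEnergy ρ K = E := by
    have h1 := 𝒯.sum_lintegral_hull fun x => ρ x ^ 2
    rw [hΩ.restrict_closure, hEe, Finset.sum_congr rfl fun K hK => h.lintegral_eq_cellEnergy hK,
      ← ENNReal.ofReal_sum_of_nonneg fun K _ => cellEnergy_nonneg ρ K] at h1
    exact (ENNReal.ofReal_eq_ofReal_iff (Finset.sum_nonneg fun K _ => cellEnergy_nonneg ρ K)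
      hE0).1 h1
  have hEle : ∀ K ∈ 𝒯.cells, cellEnergy ρ K ≤ E := fun K hK => by
    rw [← hEsum]
    exact Finset.single_le_sum (fun K _ => cellEnergy_nonneg ρ K) hK
  obtain ⟨c, hc⟩ := h.exists_cell_constants hκ
  -- The boundary term anchors one cell constant: on the piece of `Γ` of length `m` in an edge of
  -- `K₀`, `c K₀` is compared with `f`, whose boundary mass is `G`.
  have hc0 : ‖c K₀‖ ^ 2 ≤ (2 * G + 80 * l * κ * E) / m := by
    have h1 : ‖c K₀‖ₑ ^ 2 * ENNReal.ofReal m ≤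
        2 * ENNReal.ofReal G + 2 * (ENNReal.ofReal l * ENNReal.ofReal (40 * κ * E)) := by
      have hmeas : AEMeasurable (fun x => 2 * ‖f x‖ₑ ^ 2)
          ((μH[1] : Measure Plane).restrict (Γ ∩ segment ℝ p q)) := by
        refine ((AEMeasurable.pow_const ?_ 2).const_mul 2)
        have : AEMeasurable (fun x => ‖f x‖ₑ) ((μH[1] : Measure Plane).restrict (closure Ω)) :=
          h.cont.enorm.aemeasurable isClosed_closure.measurableSet
        exact this.mono_set (inter_subset_left.trans (hΓ.trans frontier_subset_closure))
      calc ‖c K₀‖ₑ ^ 2 * ENNReal.ofReal m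
          = ∫⁻ x in Γ ∩ segment ℝ p q, ‖c K₀‖ₑ ^ 2 ∂(μH[1] : Measure Plane) := by
            rw [setLIntegral_const, hm, ENNReal.ofReal_toReal hmtop]
        _ ≤ ∫⁻ x in Γ ∩ segment ℝ p q, (2 * ‖f x‖ₑ ^ 2 + 2 * ‖f x - c K₀‖ₑ ^ 2)
              ∂(μH[1] : Measure Plane) := by
            refine lintegral_mono fun x => ?_
            have := enorm_sub_sq_le 0 (c K₀) (f x)
            rwa [zero_sub, zero_sub, enorm_neg, enorm_neg] at this
        _ = 2 * (∫⁻ x in Γ ∩ segment ℝ p q, ‖f x‖ₑ ^ 2 ∂(μH[1] : Measure Plane)) +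
              2 * ∫⁻ x in Γ ∩ segment ℝ p q, ‖f x - c K₀‖ₑ ^ 2 ∂(μH[1] : Measure Plane) := by
            rw [lintegral_add_left' hmeas, lintegral_const_mul' _ _ (by norm_num),
              lintegral_const_mul' _ _ (by norm_num)]
        _ ≤ 2 * (∫⁻ x in Γ, ‖f x‖ₑ ^ 2 ∂(μH[1] : Measure Plane)) +
              2 * ∫⁻ x in segment ℝ p q, ‖f x - c K₀‖ₑ ^ 2 ∂(μH[1] : Measure Plane) := by
            gcongr
            · exact inter_subset_left
            · exact inter_subset_right
        _ ≤ _ := by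
            rw [hGe, lintegral_enorm_sq_segment p q (fun x => f x - c K₀), hl, ofReal_norm]
            gcongr
            refine ((hc K₀ hK₀).2 p hp q hq hpq).trans (ENNReal.ofReal_le_ofReal ?_)
            gcongr
            exact hEle K₀ hK₀
    rw [le_div_iff₀ hmpos]
    rw [← ofReal_norm, ← ENNReal.ofReal_pow (norm_nonneg _), ← ENNReal.ofReal_mul (by positivity),
      ← ENNReal.ofReal_mul (by positivity), two_mul_ofReal, two_mul_ofReal,
      ← ENNReal.ofReal_add (by positivity) (by positivity)] at h1
    have := (ENNReal.ofReal_le_ofReal_iff (by positivity)).1 h1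
    linarith
  -- The anchor is carried to all other cells along chains of common edges.
  have hcK : ∀ K ∈ 𝒯.cells, ‖c K‖ ^ 2 ≤
      (2 * (2 / m + 80 * l * κ / m) + 2 * (n ^ 2 * (80 * κ))) * (E + G) := by
    intro K hK
    have h1 := h.chain_le hκ0 (fun K hK => (hc K hK).2) 𝒯.cells Finset.Subset.rfl
      (fun P K hK L hL hPK hPL =>
        𝒯.exists_adjacent hΩ.lipschitz hΩ.isOpen hΩ.isConnected.isPreconnected hK hL hPK hPL)
      hK hK₀
    rw [hEsum] at h1
    have h2 : ‖c K‖ ≤ ‖c K - c K₀‖ + ‖c K₀‖ := norm_le_norm_sub_add _ _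
    have h3 : ‖c K‖ ^ 2 ≤ 2 * ‖c K - c K₀‖ ^ 2 + 2 * ‖c K₀‖ ^ 2 := by
      nlinarith [sq_nonneg (‖c K - c K₀‖ - ‖c K₀‖), norm_nonneg (c K)]
    have h4 : (2 * G + 80 * l * κ * E) / m = 2 / m * G + 80 * l * κ / m * E := by
      field_simp
    rw [h4] at hc0
    have e1 : 0 ≤ 2 / m * E := mul_nonneg (div_nonneg zero_le_two hmpos.le) hE0
    have hl0 : 0 ≤ l := norm_nonneg _
    have e2 : 0 ≤ 80 * l * κ / m * G :=
      mul_nonneg (div_nonneg (mul_nonneg (mul_nonneg (by norm_num) hl0) hκ0) hmpos.le) hG0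
    have e3 : 0 ≤ n ^ 2 * (80 * κ) * G :=
      mul_nonneg (mul_nonneg (sq_nonneg n) (mul_nonneg (by norm_num) hκ0)) hG0
    nlinarith
  have hcell : ∀ K ∈ 𝒯.cells, ∫⁻ x in convexHull ℝ (K : Set Plane), ‖f x‖ₑ ^ 2 ≤
      ENNReal.ofReal (a K * (E + G)) := by
    intro K hK
    have hVe := IsUpperGradPair.volume_hull_eq K
    calc ∫⁻ x in convexHull ℝ (K : Set Plane), ‖f x‖ₑ ^ 2
        ≤ ∫⁻ x in convexHull ℝ (K : Set Plane), (2 * ‖c K‖ₑ ^ 2 + 2 * ‖f x - c K‖ₑ ^ 2) := by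
          refine lintegral_mono fun x => ?_
          have := enorm_sub_sq_le (f x) 0 (c K)
          rw [sub_zero, sub_zero, add_comm] at this
          exact this
      _ = 2 * ‖c K‖ₑ ^ 2 * volume (convexHull ℝ (K : Set Plane)) +
            2 * ∫⁻ x in convexHull ℝ (K : Set Plane), ‖f x - c K‖ₑ ^ 2 := by
          rw [lintegral_add_left measurable_const, setLIntegral_const,
            lintegral_const_mul' _ _ (by norm_num)]
      _ ≤ 2 * ‖c K‖ₑ ^ 2 * volume (convexHull ℝ (K : Set Plane)) +
            2 * ENNReal.ofReal (4 * diam (K : Set Plane) ^ 2 * cellEnergy ρ K) := by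
          gcongr
          exact (hc K hK).1
      _ = ENNReal.ofReal (2 * ‖c K‖ ^ 2 * volume.real (convexHull ℝ (K : Set Plane)) +
            2 * (4 * diam (K : Set Plane) ^ 2 * cellEnergy ρ K)) := by
          have hE' := cellEnergy_nonneg ρ K
          rw [hVe, ← ofReal_norm, ← ENNReal.ofReal_pow (norm_nonneg _),
            two_mul_ofReal, two_mul_ofReal, ← ENNReal.ofReal_mul (by positivity),
            ← ENNReal.ofReal_add (by positivity) (by positivity)]
      _ ≤ _ := by
          apply ENNReal.ofReal_le_ofReal
          have h1 := mul_le_mul_of_nonneg_left (hcK K hK)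
            (show 0 ≤ 2 * volume.real (convexHull ℝ (K : Set Plane)) by positivity)
          have h2 := mul_le_mul_of_nonneg_left ((hEle K hK).trans (le_add_of_nonneg_right hG0))
            (show 0 ≤ 8 * diam (K : Set Plane) ^ 2 by positivity)
          simp only [a]
          linarith
  calc ∫⁻ x in Ω, ‖f x‖ₑ ^ 2
      = ∑ K ∈ 𝒯.cells, ∫⁻ x in convexHull ℝ (K : Set Plane), ‖f x‖ₑ ^ 2 := by
        rw [𝒯.sum_lintegral_hull, hΩ.restrict_closure]
    _ ≤ ∑ K ∈ 𝒯.cells, ENNReal.ofReal (a K * (E + G)) := Finset.sum_le_sum hcell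
    _ = ENNReal.ofReal ((∑ K ∈ 𝒯.cells, a K) * (E + G)) := by
        rw [Finset.sum_mul, ENNReal.ofReal_sum_of_nonneg]
        exact fun K hK => mul_nonneg (ha K hK) (add_nonneg hE0 hG0)
    _ ≤ ENNReal.ofReal ((1 + ∑ K ∈ 𝒯.cells, a K) * (E + G)) := by
        apply ENNReal.ofReal_le_ofReal
        gcongr
        linarith
    _ = _ := by
        rw [ENNReal.ofReal_mul (by linarith), ENNReal.ofReal_add hE0 hG0, hEe, hGe]

end IsPolygonalDomain

/-! ### Upper gradients of smooth functions -/

/-- The `i`-th unit vector of the plane. -/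
abbrev unitVec (i : Fin 2) : Plane := EuclideanSpace.single i 1

theorem eq_sum_unitVec (v : Plane) : v = v 0 • unitVec 0 + v 1 • unitVec 1 := by
  ext i; fin_cases i <;> simp

theorem norm_unitVec (i : Fin 2) : ‖unitVec i‖ = 1 := by simp

theorem norm_map_le_mul_sum {F : Type*} [NormedAddCommGroup F] [NormedSpace ℝ F]
    (A : Plane →ₗ[ℝ] F) (v : Plane) : ‖A v‖ ≤ ‖v‖ * (‖A (unitVec 0)‖ + ‖A (unitVec 1)‖) := by
  have h0 : ‖v 0‖ ≤ ‖v‖ := PiLp.norm_apply_le v 0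
  have h1 : ‖v 1‖ ≤ ‖v‖ := PiLp.norm_apply_le v 1
  calc ‖A v‖ = ‖v 0 • A (unitVec 0) + v 1 • A (unitVec 1)‖ := by
        conv_lhs => rw [eq_sum_unitVec v]
        simp only [map_add, map_smul]
    _ ≤ ‖v 0‖ * ‖A (unitVec 0)‖ + ‖v 1‖ * ‖A (unitVec 1)‖ := by
        refine (norm_add_le _ _).trans ?_
        rw [norm_smul, norm_smul]
    _ ≤ _ := by
        rw [mul_add]
        gcongr

/-- The sum of the norms of the two components of a gradient field. -/
def gradSum {F : Type*} [NormedAddCommGroup F] (D : Fin 2 → Plane → F) (x : Plane) : ℝ≥0∞ :=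
  ‖D 0 x‖ₑ + ‖D 1 x‖ₑ

theorem lintegral_gradSum_sq_le {F : Type*} [NormedAddCommGroup F] (D : Fin 2 → Plane → F)
    (μ : Measure Plane) (hD : AEStronglyMeasurable (D 0) μ) :
    ∫⁻ x, gradSum D x ^ 2 ∂μ ≤ 2 * ∑ i, ∫⁻ x, ‖D i x‖ₑ ^ 2 ∂μ := by
  calc ∫⁻ x, gradSum D x ^ 2 ∂μ ≤ ∫⁻ x, (2 * ‖D 0 x‖ₑ ^ 2 + 2 * ‖D 1 x‖ₑ ^ 2) ∂μ :=
        lintegral_mono fun x => add_sq_le_two_mul _ _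
    _ = _ := by
        rw [lintegral_add_left' ((hD.enorm.pow_const 2).const_mul 2),
          lintegral_const_mul' _ _ (by norm_num), lintegral_const_mul' _ _ (by norm_num),
          Fin.sum_univ_two, mul_add]

/-- The classical partial derivatives. -/
def classicalPartial {F : Type*} [NormedAddCommGroup F] [NormedSpace ℝ F] (f : Plane → F)
    (i : Fin 2) (x : Plane) : F :=
  fderiv ℝ f x (unitVec i)

section

variable {F : Type*} [NormedAddCommGroup F] [NormedSpace ℝ F] {f : Plane → F}

theorem continuous_classicalPartial (hf : ContDiff ℝ ∞ f) (i : Fin 2) :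
    Continuous (classicalPartial f i) :=
  (hf.continuous_fderiv (by simp)).clm_apply continuous_const

/-- The fundamental theorem of calculus along the segment. -/
theorem isUpperGradPair_of_contDiff [CompleteSpace F] {Ω : Set Plane}
    (hΩ : Bornology.IsBounded Ω) (hf : ContDiff ℝ ∞ f) :
    IsUpperGradPair Ω f (gradSum (classicalPartial f)) where
  cont := hf.continuous.continuousOn
  upper := by
    intro x y _ t ht
    have hder : ∀ s : ℝ, HasDerivAt (fun s : ℝ => f (AffineMap.lineMap x y s))
        (fderiv ℝ f (AffineMap.lineMap x y s) (y - x)) s := fun s => by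
      have h1 : HasFDerivAt f (fderiv ℝ f (AffineMap.lineMap x y s)) (AffineMap.lineMap x y s) :=
        (hf.differentiable (by simp) _).hasFDerivAt
      exact h1.comp_hasDerivAt s AffineMap.hasDerivAt_lineMap
    have hcont : Continuous fun s : ℝ => fderiv ℝ f (AffineMap.lineMap x y s) (y - x) :=
      ((hf.continuous_fderiv (by simp)).comp AffineMap.lineMap_continuous).clm_apply
        continuous_const
    have hint := intervalIntegral.integral_eq_sub_of_hasDerivAt (a := 0) (b := t)
      (fun s _ => hder s) (hcont.intervalIntegrable _ _)
    rw [AffineMap.lineMap_apply_zero] at hint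
    rw [← hint, intervalIntegral.integral_of_le ht.1]
    calc _ ≤ ∫⁻ s in Ioc 0 t, ‖fderiv ℝ f (AffineMap.lineMap x y s) (y - x)‖ₑ :=
          enorm_integral_le_lintegral_enorm _
      _ ≤ ∫⁻ s in Icc (0 : ℝ) 1, ‖fderiv ℝ f (AffineMap.lineMap x y s) (y - x)‖ₑ :=
          lintegral_mono_set fun s hs => ⟨hs.1.le, hs.2.trans ht.2⟩
      _ ≤ ∫⁻ s in Icc (0 : ℝ) 1,
            ‖y - x‖ₑ * gradSum (classicalPartial f) (AffineMap.lineMap x y s) := by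
          refine lintegral_mono fun s => ?_
          have := norm_map_le_mul_sum (fderiv ℝ f (AffineMap.lineMap x y s)).toLinearMap (y - x)
          simp only [gradSum, classicalPartial, ← ofReal_norm]
          rw [← ENNReal.ofReal_add (norm_nonneg _) (norm_nonneg _),
            ← ENNReal.ofReal_mul (norm_nonneg _)]
          exact ENNReal.ofReal_le_ofReal this
      _ = _ := lintegral_const_mul' _ _ (by simp)
  meas := (continuous_classicalPartial hf 0).enorm.measurable.add
    (continuous_classicalPartial hf 1).enorm.measurable
  fin := by
    refine ne_top_of_le_ne_top ?_ (lintegral_gradSum_sq_le _ _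
      (continuous_classicalPartial hf 0).aestronglyMeasurable)
    refine ENNReal.mul_ne_top (by norm_num) (ENNReal.sum_ne_top.2 fun i _ => ?_)
    exact (continuous_classicalPartial hf i).continuousOn.lintegral_enorm_sq_ne_top
      (hΩ.isCompact_closure)

end

/-! ### Upper gradients of piecewise affine functions -/

namespace Triangulation

variable {Ω : Set Plane} (𝒯 : Triangulation Ω) {𝕜 : Type*} [RCLike 𝕜]

open Classical in
/-- The affine function that agrees with a piecewise affine function on a cell. -/
def affinePart (u : Plane → 𝕜) (K : Finset Plane) : Plane →ᵃ[ℝ] 𝕜 :=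
  if h : ∃ A : Plane →ᵃ[ℝ] 𝕜, Set.EqOn u A (convexHull ℝ (K : Set Plane)) then h.choose
  else AffineMap.const ℝ Plane 0

/-- The partial derivatives of a piecewise affine function on a cell. -/
def cellPartial (u : Plane → 𝕜) (K : Finset Plane) (i : Fin 2) : 𝕜 :=
  (affinePart u K).linear (unitVec i)

/-- The sum of the norms of the partial derivatives on a cell. -/
def cellSlope (u : Plane → 𝕜) (K : Finset Plane) : ℝ :=
  ‖cellPartial u K 0‖ + ‖cellPartial u K 1‖

/-- The upper gradient of a piecewise affine function. -/
def slope (u : Plane → 𝕜) (x : Plane) : ℝ :=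
  ∑ K ∈ 𝒯.cells, (convexHull ℝ (K : Set Plane)).indicator (fun _ => cellSlope u K) x

variable {𝒯} {u : Plane → 𝕜} {K : Finset Plane}

theorem cellSlope_nonneg (u : Plane → 𝕜) (K : Finset Plane) : 0 ≤ cellSlope u K := by
  unfold cellSlope; positivity

theorem slope_nonneg (u : Plane → 𝕜) (x : Plane) : 0 ≤ 𝒯.slope u x :=
  Finset.sum_nonneg fun K _ => indicator_nonneg (fun _ _ => cellSlope_nonneg u K) x

theorem slope_le (u : Plane → 𝕜) (x : Plane) : 𝒯.slope u x ≤ ∑ K ∈ 𝒯.cells, cellSlope u K :=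
  Finset.sum_le_sum fun K _ => indicator_le_self' (fun _ _ => cellSlope_nonneg u K) x

theorem cellSlope_le_slope (u : Plane → 𝕜) (hK : K ∈ 𝒯.cells) {x : Plane}
    (hx : x ∈ convexHull ℝ (K : Set Plane)) : cellSlope u K ≤ 𝒯.slope u x := by
  have := Finset.single_le_sum (f := fun K : Finset Plane =>
    (convexHull ℝ (K : Set Plane)).indicator (fun _ => cellSlope u K) x)
    (fun K _ => indicator_nonneg (fun _ _ => cellSlope_nonneg u K) x) hK
  simp only [indicator_of_mem hx] at this
  exact this

theorem measurable_slope (u : Plane → 𝕜) : Measurable (𝒯.slope u) :=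
  Finset.measurable_sum _ fun K _ => measurable_const.indicator (measurableSet_hull K)

theorem eqOn_affinePart (hu : u ∈ 𝒯.P1 𝕜) (hK : K ∈ 𝒯.cells) :
    EqOn u (affinePart u K) (convexHull ℝ (K : Set Plane)) := by
  rw [affinePart, dif_pos (hu.2.1 K hK)]
  exact (hu.2.1 K hK).choose_spec

theorem sub_eq_linear (hu : u ∈ 𝒯.P1 𝕜) (hK : K ∈ 𝒯.cells) {x y : Plane}
    (hx : x ∈ convexHull ℝ (K : Set Plane)) (hy : y ∈ convexHull ℝ (K : Set Plane)) :
    u y - u x = (affinePart u K).linear (y - x) := by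
  rw [eqOn_affinePart hu hK hx, eqOn_affinePart hu hK hy, ← vsub_eq_sub, ← vsub_eq_sub,
    AffineMap.linearMap_vsub]

theorem norm_sub_le_cellSlope (hu : u ∈ 𝒯.P1 𝕜) (hK : K ∈ 𝒯.cells) {x y : Plane}
    (hx : x ∈ convexHull ℝ (K : Set Plane)) (hy : y ∈ convexHull ℝ (K : Set Plane)) :
    ‖u y - u x‖ ≤ ‖y - x‖ * cellSlope u K := by
  rw [sub_eq_linear hu hK hx hy]
  exact norm_map_le_mul_sum _ _

theorem intervalIntegrable_slope (u : Plane → 𝕜) (x y : Plane) (a b : ℝ) :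
    IntervalIntegrable (fun τ : ℝ => 𝒯.slope u (AffineMap.lineMap x y τ)) volume a b := by
  refine (intervalIntegrable_const (c := ∑ K ∈ 𝒯.cells, cellSlope u K)).mono_fun' ?_ ?_
  · exact ((measurable_slope u).comp (measurable_lineMap_const x y)).aestronglyMeasurable
  · refine ae_of_all _ fun τ => ?_
    simp only
    rw [Real.norm_of_nonneg (slope_nonneg u _)]
    exact slope_le u _

/-- A continuity argument in `t` avoids listing the cells that the segment crosses. On cell
boundaries `slope` adds the contributions of all adjacent cells, so it dominates the slope of
whichever cell is used. -/
theorem norm_sub_le_integral_slope (hu : u ∈ 𝒯.P1 𝕜) {x y : Plane}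
    (hxy : segment ℝ x y ⊆ closure Ω) {t : ℝ} (ht : t ∈ Icc (0 : ℝ) 1) :
    ‖u (AffineMap.lineMap x y t) - u x‖ ≤
      ‖y - x‖ * ∫ τ in (0 : ℝ)..t, 𝒯.slope u (AffineMap.lineMap x y τ) := by
  let γ : ℝ → Plane := fun s => AffineMap.lineMap x y s
  have hγc : Continuous γ := AffineMap.lineMap_continuous
  have hγ : ∀ s ∈ Icc (0 : ℝ) 1, γ s ∈ closure Ω := fun s hs =>
    hxy (lineMap_mem_segment ℝ x y hs)
  have hγsub : ∀ s s', γ s' - γ s = (s' - s) • (y - x) := fun s s' => by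
    simp only [γ, AffineMap.lineMap_apply_module]; module
  have hint := fun a b => intervalIntegrable_slope (𝒯 := 𝒯) u x y a b
  have hlhs : ContinuousOn (fun s => ‖u (γ s) - u x‖) (Icc 0 1) :=
    ((hu.1.comp hγc.continuousOn hγ).sub continuousOn_const).norm
  have hrhs : Continuous fun s => ‖y - x‖ * ∫ τ in (0 : ℝ)..s, 𝒯.slope u (γ τ) :=
    continuous_const.mul (intervalIntegral.continuous_primitive hint 0)
  have hclosed : IsClosed ({s | ‖u (γ s) - u x‖ ≤
      ‖y - x‖ * ∫ τ in (0 : ℝ)..s, 𝒯.slope u (γ τ)} ∩ Icc 0 1) := by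
    have := isClosed_Icc.isClosed_le hlhs hrhs.continuousOn
    convert this using 1
    ext s; simp [and_comm]
  refine hclosed.Icc_subset_of_forall_exists_gt ?_ ?_ ht
  · simp [γ]
  · rintro s ⟨hs, hs0, hs1⟩ b hb
    have hev : ∀ᶠ r in 𝓝[>] s, r ∈ Ioc s b ∧ r ≤ 1 := by
      have h1 : Ioc s (min b 1) ∈ 𝓝[>] s := Ioc_mem_nhdsGT (lt_min hb hs1)
      filter_upwards [h1] with r hr
      exact ⟨⟨hr.1, hr.2.trans (min_le_left _ _)⟩, hr.2.trans (min_le_right _ _)⟩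
    -- Of the finitely many cells, one contains points of the segment arbitrarily shortly after `s`.
    -- Being closed it contains the point at `s`, and being convex the whole piece up to such a
    -- later point.
    obtain ⟨K, hK, hfreq⟩ : ∃ K ∈ 𝒯.cells,
        ∃ᶠ r in 𝓝[>] s, γ r ∈ convexHull ℝ (K : Set Plane) := by
      by_contra! hno
      have hno' : ∀ K ∈ 𝒯.cells, ∀ᶠ r in 𝓝[>] s, γ r ∉ convexHull ℝ (K : Set Plane) :=
        fun K hK => hno K hK
      have hall := (eventually_all_finset 𝒯.cells).2 hno'
      obtain ⟨r, hr1, hr2⟩ := (hall.and hev).exists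
      have hmem := hγ r ⟨hs0.trans hr2.1.1.le, hr2.2⟩
      rw [← 𝒯.cover, mem_iUnion₂] at hmem
      obtain ⟨K, hK, hx⟩ := hmem
      exact hr1 K hK hx
    have hsK : γ s ∈ convexHull ℝ (K : Set Plane) :=
      (isCompact_hull K).isClosed.mem_of_frequently_of_tendsto hfreq
        (hγc.continuousAt.mono_left nhdsWithin_le_nhds)
    obtain ⟨r, hrK, hr⟩ := (hfreq.and_eventually hev).exists
    refine ⟨r, ?_, hr.1⟩
    have hsr : s ≤ r := hr.1.1.le
    have h1 : cellSlope u K * (r - s) ≤ ∫ τ in s..r, 𝒯.slope u (γ τ) := by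
      have h2 : ∫ _ in s..r, cellSlope u K = cellSlope u K * (r - s) := by
        rw [intervalIntegral.integral_const, smul_eq_mul, mul_comm]
      rw [← h2]
      refine intervalIntegral.integral_mono_on hsr intervalIntegrable_const (hint s r)
        fun τ hτ => cellSlope_le_slope u hK ?_
      have hconv : Convex ℝ (γ ⁻¹' convexHull ℝ (K : Set Plane)) :=
        (convex_convexHull ℝ _).affine_preimage (AffineMap.lineMap x y)
      exact hconv.ordConnected.out hsK hrK hτ
    have h3 : ‖u (γ r) - u (γ s)‖ ≤ ‖y - x‖ * ∫ τ in s..r, 𝒯.slope u (γ τ) := by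
      refine (norm_sub_le_cellSlope hu hK hsK hrK).trans ?_
      rw [hγsub, norm_smul, Real.norm_of_nonneg (by linarith)]
      calc (r - s) * ‖y - x‖ * cellSlope u K = ‖y - x‖ * (cellSlope u K * (r - s)) := by ring
        _ ≤ _ := by gcongr
    change ‖u (γ r) - u x‖ ≤ ‖y - x‖ * ∫ τ in (0 : ℝ)..r, 𝒯.slope u (γ τ)
    rw [← intervalIntegral.integral_add_adjacent_intervals (hint 0 s) (hint s r), mul_add]
    calc ‖u (γ r) - u x‖ = ‖(u (γ s) - u x) + (u (γ r) - u (γ s))‖ := by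
          congr 1; abel
      _ ≤ ‖u (γ s) - u x‖ + ‖u (γ r) - u (γ s)‖ := norm_add_le _ _
      _ ≤ _ := add_le_add hs h3

theorem norm_sub_le_of_segment (hu : u ∈ 𝒯.P1 𝕜) {x y : Plane}
    (hxy : segment ℝ x y ⊆ closure Ω) :
    ‖u y - u x‖ ≤ ‖y - x‖ * ∑ K ∈ 𝒯.cells, cellSlope u K := by
  have h := norm_sub_le_integral_slope hu hxy (t := 1) (by simp)
  rw [AffineMap.lineMap_apply_one] at h
  refine h.trans ?_
  gcongr
  calc _ ≤ ∫ _ in (0 : ℝ)..1, ∑ K ∈ 𝒯.cells, cellSlope u K :=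
        intervalIntegral.integral_mono_on zero_le_one (intervalIntegrable_slope u x y 0 1)
          intervalIntegrable_const fun τ _ => slope_le u _
    _ = _ := by simp

theorem isUpperGradPair_slope (hΩ : Bornology.IsBounded Ω) (hu : u ∈ 𝒯.P1 𝕜) :
    IsUpperGradPair Ω u fun x => ENNReal.ofReal (𝒯.slope u x) where
  cont := hu.1
  upper := by
    intro x y hxy t ht
    have h := norm_sub_le_integral_slope hu hxy ht
    have hi := intervalIntegrable_slope (𝒯 := 𝒯) u x y 0 t
    have h2 : ∫⁻ τ in Ioc 0 t, ENNReal.ofReal (𝒯.slope u (AffineMap.lineMap x y τ)) =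
        ENNReal.ofReal (∫ τ in (0 : ℝ)..t, 𝒯.slope u (AffineMap.lineMap x y τ)) := by
      rw [intervalIntegral.integral_of_le ht.1, ofReal_integral_eq_lintegral_ofReal
        ((intervalIntegrable_iff_integrableOn_Ioc_of_le ht.1).1 hi)
        (ae_of_all _ fun τ => slope_nonneg u _)]
    calc ‖u (AffineMap.lineMap x y t) - u x‖ₑ
        ≤ ENNReal.ofReal (‖y - x‖ * ∫ τ in (0 : ℝ)..t, 𝒯.slope u (AffineMap.lineMap x y τ)) := by
          rw [← ofReal_norm]
          exact ENNReal.ofReal_le_ofReal h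
      _ = ‖y - x‖ₑ * ∫⁻ τ in Ioc 0 t, ENNReal.ofReal (𝒯.slope u (AffineMap.lineMap x y τ)) := by
          rw [h2, ENNReal.ofReal_mul (norm_nonneg _), ofReal_norm]
      _ ≤ _ := by
          gcongr
          exact fun s hs => ⟨hs.1.le, hs.2.trans ht.2⟩
  meas := (measurable_slope u).ennreal_ofReal
  fin := by
    refine ne_top_of_le_ne_top (b := ∫⁻ x in closure Ω,
      ENNReal.ofReal (∑ K ∈ 𝒯.cells, cellSlope u K) ^ 2) ?_ ?_
    · rw [setLIntegral_const]
      exact ENNReal.mul_ne_top (by simp) hΩ.isCompact_closure.measure_lt_top.ne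
    · refine lintegral_mono fun x => ?_
      gcongr
      exact slope_le u x

end Triangulation

/-! ### Weak partial derivatives -/

section WeakPartial

variable {𝕜 𝕜' : Type*} [RCLike 𝕜] [RCLike 𝕜'] {Ω : Set Plane} {i : Fin 2} {u v g g' : Plane → 𝕜}

theorem memLp_two_of_test (Ω : Set Plane) {φ : Plane → ℝ} (hφ : ContDiff ℝ ∞ φ)
    (hc : HasCompactSupport φ) : MemLp φ 2 (volume.restrict Ω) :=
  (hφ.continuous.memLp_of_hasCompactSupport hc).restrict Ω

theorem memLp_two_of_test_deriv (Ω : Set Plane) {φ : Plane → ℝ} (hφ : ContDiff ℝ ∞ φ)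
    (hc : HasCompactSupport φ) (w : Plane) :
    MemLp (fun x => fderiv ℝ φ x w) 2 (volume.restrict Ω) := by
  refine (Continuous.memLp_of_hasCompactSupport ?_ ?_).restrict Ω
  · exact (hφ.continuous_fderiv (by simp)).clm_apply continuous_const
  · exact hc.fderiv_apply ℝ w

theorem integrable_smul_of_memLp {μ : Measure Plane} {φ : Plane → ℝ} (hφ : MemLp φ 2 μ)
    (hu : MemLp u 2 μ) : Integrable (fun x => φ x • u x) μ :=
  memLp_one_iff_integrable.1 (hu.smul hφ)

theorem HasWeakPartial.add (hu : HasWeakPartial Ω i u g) (hv : HasWeakPartial Ω i v g')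
    (hu2 : MemLp u 2 (volume.restrict Ω)) (hv2 : MemLp v 2 (volume.restrict Ω))
    (hg2 : MemLp g 2 (volume.restrict Ω)) (hg'2 : MemLp g' 2 (volume.restrict Ω)) :
    HasWeakPartial Ω i (u + v) (g + g') := by
  intro φ hφ hc hs
  have h1 := memLp_two_of_test Ω hφ hc
  have h2 := memLp_two_of_test_deriv Ω hφ hc (EuclideanSpace.single i 1)
  simp only [Pi.add_apply, smul_add]
  rw [integral_add (integrable_smul_of_memLp h2 hu2) (integrable_smul_of_memLp h2 hv2),
    integral_add (integrable_smul_of_memLp h1 hg2) (integrable_smul_of_memLp h1 hg'2),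
    hu φ hφ hc hs, hv φ hφ hc hs, neg_add]

theorem HasWeakPartial.comp_clm (A : 𝕜 →L[ℝ] 𝕜') (hu : HasWeakPartial Ω i u g)
    (hu2 : MemLp u 2 (volume.restrict Ω)) (hg2 : MemLp g 2 (volume.restrict Ω)) :
    HasWeakPartial Ω i (fun x => A (u x)) (fun x => A (g x)) := by
  intro φ hφ hc hs
  have h1 := memLp_two_of_test Ω hφ hc
  have h2 := memLp_two_of_test_deriv Ω hφ hc (EuclideanSpace.single i 1)
  simp only [← map_smul]
  rw [A.integral_comp_comm (integrable_smul_of_memLp h2 hu2),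
    A.integral_comp_comm (integrable_smul_of_memLp h1 hg2), hu φ hφ hc hs, map_neg]

/-- The fundamental lemma of the calculus of variations. It makes the choice in `weakPartial`
harmless: every explicit weak derivative in `L²` agrees with it. -/
theorem HasWeakPartial.ae_eq (hΩ : IsOpen Ω) (hg : HasWeakPartial Ω i u g)
    (hg' : HasWeakPartial Ω i u g') (hg2 : MemLp g 2 (volume.restrict Ω))
    (hg'2 : MemLp g' 2 (volume.restrict Ω)) : g =ᵐ[volume.restrict Ω] g' := by
  have hloc : LocallyIntegrableOn (g - g') Ω volume := by
    have h1 : LocallyIntegrable (g - g') (volume.restrict Ω) :=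
      (hg2.sub hg'2).locallyIntegrable (by norm_num)
    intro x hx
    obtain ⟨U, hU, hUi⟩ := h1 x
    refine ⟨U ∩ Ω, inter_mem (mem_nhdsWithin_of_mem_nhds hU) self_mem_nhdsWithin, ?_⟩
    rw [IntegrableOn, Measure.restrict_restrict' hΩ.measurableSet] at hUi
    exact hUi
  have h := hΩ.ae_eq_zero_of_integral_contDiff_smul_eq_zero hloc fun φ hφ hc hs => ?_
  · rw [Filter.EventuallyEq, ae_restrict_iff' hΩ.measurableSet]
    filter_upwards [h] with x hx hxΩ
    exact sub_eq_zero.1 (hx hxΩ)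
  · have h1 := memLp_two_of_test Ω hφ hc
    have h2 : ∫ x, φ x • (g - g') x = ∫ x in Ω, φ x • (g - g') x := by
      refine (setIntegral_eq_integral_of_forall_compl_eq_zero fun x hx => ?_).symm
      rw [image_eq_zero_of_notMem_tsupport fun h' => hx (hs h'), zero_smul]
    rw [h2]
    simp only [Pi.sub_apply, smul_sub]
    rw [integral_sub (integrable_smul_of_memLp h1 hg2) (integrable_smul_of_memLp h1 hg'2),
      sub_eq_zero]
    exact neg_injective ((hg φ hφ hc hs).symm.trans (hg' φ hφ hc hs))

theorem MemH1.memLp_weakPartial (hu : MemH1 Ω u) (i : Fin 2) :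
    MemLp (weakPartial Ω i u) 2 (volume.restrict Ω) := by
  rw [weakPartial, dif_pos (hu.2 i)]
  exact (hu.2 i).choose_spec.1

theorem MemH1.hasWeakPartial (hu : MemH1 Ω u) (i : Fin 2) :
    HasWeakPartial Ω i u (weakPartial Ω i u) := by
  rw [weakPartial, dif_pos (hu.2 i)]
  exact (hu.2 i).choose_spec.2

theorem MemH1.weakPartial_ae_eq (hΩ : IsOpen Ω) (hu : MemH1 Ω u) (hg : HasWeakPartial Ω i u g)
    (hg2 : MemLp g 2 (volume.restrict Ω)) : weakPartial Ω i u =ᵐ[volume.restrict Ω] g :=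
  (hu.hasWeakPartial i).ae_eq hΩ hg (hu.memLp_weakPartial i) hg2

theorem MemH1.add (hu : MemH1 Ω u) (hv : MemH1 Ω v) : MemH1 Ω (u + v) :=
  ⟨hu.1.add hv.1, fun i => ⟨_, (hu.memLp_weakPartial i).add (hv.memLp_weakPartial i),
    (hu.hasWeakPartial i).add (hv.hasWeakPartial i) hu.1 hv.1 (hu.memLp_weakPartial i)
      (hv.memLp_weakPartial i)⟩⟩

theorem MemH1.weakPartial_add (hΩ : IsOpen Ω) (hu : MemH1 Ω u) (hv : MemH1 Ω v) (i : Fin 2) :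
    weakPartial Ω i (u + v) =ᵐ[volume.restrict Ω] weakPartial Ω i u + weakPartial Ω i v :=
  (hu.add hv).weakPartial_ae_eq hΩ
    ((hu.hasWeakPartial i).add (hv.hasWeakPartial i) hu.1 hv.1 (hu.memLp_weakPartial i)
      (hv.memLp_weakPartial i)) ((hu.memLp_weakPartial i).add (hv.memLp_weakPartial i))

theorem MemH1.comp_clm (A : 𝕜 →L[ℝ] 𝕜') (hu : MemH1 Ω u) : MemH1 Ω fun x => A (u x) :=
  ⟨hu.1.continuousLinearMap_comp A, fun i =>
    ⟨_, (hu.memLp_weakPartial i).continuousLinearMap_comp A,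
    (hu.hasWeakPartial i).comp_clm A hu.1 (hu.memLp_weakPartial i)⟩⟩

theorem MemH1.weakPartial_comp_clm (hΩ : IsOpen Ω) (A : 𝕜 →L[ℝ] 𝕜') (hu : MemH1 Ω u) (i : Fin 2) :
    weakPartial Ω i (fun x => A (u x)) =ᵐ[volume.restrict Ω] fun x => A (weakPartial Ω i u x) :=
  (hu.comp_clm A).weakPartial_ae_eq hΩ
    ((hu.hasWeakPartial i).comp_clm A hu.1 (hu.memLp_weakPartial i))
    ((hu.memLp_weakPartial i).continuousLinearMap_comp A)

theorem hasWeakPartial_zero : HasWeakPartial Ω i (0 : Plane → 𝕜) 0 := by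
  intro φ _ _ _
  simp

theorem memH1_zero : MemH1 Ω (0 : Plane → 𝕜) :=
  ⟨MemLp.zero, fun _ => ⟨0, MemLp.zero, hasWeakPartial_zero⟩⟩

theorem weakPartial_zero (hΩ : IsOpen Ω) :
    weakPartial Ω i (0 : Plane → 𝕜) =ᵐ[volume.restrict Ω] 0 :=
  memH1_zero.weakPartial_ae_eq hΩ hasWeakPartial_zero MemLp.zero

end WeakPartial

/-! ### The weak gradient of a piecewise affine function -/

namespace Triangulation

variable {Ω : Set Plane} {𝒯 : Triangulation Ω} {𝕜 : Type*} [RCLike 𝕜] {u : Plane → 𝕜}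
  {K : Finset Plane}

variable (𝒯) in
/-- The piecewise constant partial derivatives of a piecewise affine function. -/
def piecewisePartial (u : Plane → 𝕜) (i : Fin 2) (x : Plane) : 𝕜 :=
  ∑ K ∈ 𝒯.cells, (convexHull ℝ (K : Set Plane)).indicator (fun _ => cellPartial u K i) x

theorem measurable_piecewisePartial (u : Plane → 𝕜) (i : Fin 2) :
    Measurable (𝒯.piecewisePartial u i) :=
  Finset.measurable_sum _ fun K _ => measurable_const.indicator (measurableSet_hull K)

theorem ae_mem_interior (hK : K ∈ 𝒯.cells) :
    ∀ᵐ x ∂volume.restrict (convexHull ℝ (K : Set Plane)),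
      x ∈ interior (convexHull ℝ (K : Set Plane)) ∧
        ∀ L ∈ 𝒯.cells, L ≠ K → x ∉ convexHull ℝ (L : Set Plane) := by
  rw [ae_restrict_iff' (measurableSet_hull K)]
  have h1 : ∀ᵐ x : Plane, x ∉ frontier (convexHull ℝ (K : Set Plane)) :=
    measure_eq_zero_iff_ae_notMem.1 ((convex_convexHull ℝ _).addHaar_frontier volume)
  have h2 : ∀ᵐ x : Plane, ∀ L ∈ 𝒯.cells, L ≠ K →
      x ∉ convexHull ℝ (L : Set Plane) ∩ convexHull ℝ (K : Set Plane) := by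
    refine (ae_ball_iff (Finset.countable_toSet 𝒯.cells)).2 fun L hL => ?_
    by_cases hne : L = K
    · exact ae_of_all _ fun x h => absurd hne h
    · filter_upwards [measure_eq_zero_iff_ae_notMem.1 (volume_hull_inter hL hK hne)] with x hx _
      exact hx
  filter_upwards [h1, h2] with x hx1 hx2 hxK
  refine ⟨?_, fun L hL hne hxL => hx2 L hL hne ⟨hxL, hxK⟩⟩
  by_contra hxi
  exact hx1 ⟨subset_closure hxK, hxi⟩

theorem piecewisePartial_eq {x : Plane} (hK : K ∈ 𝒯.cells)
    (hx : x ∈ convexHull ℝ (K : Set Plane))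
    (h : ∀ L ∈ 𝒯.cells, L ≠ K → x ∉ convexHull ℝ (L : Set Plane)) (i : Fin 2) :
    𝒯.piecewisePartial u i x = cellPartial u K i := by
  rw [piecewisePartial, Finset.sum_eq_single K]
  · rw [indicator_of_mem hx]
  · intro L hL hne
    rw [indicator_of_notMem (h L hL hne)]
  · exact fun h => absurd hK h

theorem slope_eq {x : Plane} (hK : K ∈ 𝒯.cells)
    (hx : x ∈ convexHull ℝ (K : Set Plane))
    (h : ∀ L ∈ 𝒯.cells, L ≠ K → x ∉ convexHull ℝ (L : Set Plane)) :
    𝒯.slope u x = cellSlope u K := by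
  rw [slope, Finset.sum_eq_single K]
  · rw [indicator_of_mem hx]
  · intro L hL hne
    rw [indicator_of_notMem (h L hL hne)]
  · exact fun h => absurd hK h

/-- Almost every point of the closure lies in the interior of exactly one cell. -/
theorem ae_exists_cell (𝒯 : Triangulation Ω) : ∀ᵐ x ∂volume.restrict (closure Ω),
    ∃ K ∈ 𝒯.cells, x ∈ interior (convexHull ℝ (K : Set Plane)) ∧
      ∀ L ∈ 𝒯.cells, L ≠ K → x ∉ convexHull ℝ (L : Set Plane) := by
  have h : ∀ᵐ x : Plane, ∀ K ∈ 𝒯.cells, x ∈ convexHull ℝ (K : Set Plane) →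
      x ∈ interior (convexHull ℝ (K : Set Plane)) ∧
        ∀ L ∈ 𝒯.cells, L ≠ K → x ∉ convexHull ℝ (L : Set Plane) :=
    (ae_ball_iff (Finset.countable_toSet 𝒯.cells)).2 fun K hK =>
      (ae_restrict_iff' (measurableSet_hull K)).1 (ae_mem_interior hK)
  rw [ae_restrict_iff' isClosed_closure.measurableSet]
  filter_upwards [h] with x hx hxc
  rw [← 𝒯.cover, mem_iUnion₂] at hxc
  obtain ⟨K, hK, hxK⟩ := hxc
  exact ⟨K, hK, hx K hK hxK⟩

theorem measurable_P1 (hu : u ∈ 𝒯.P1 𝕜) : Measurable u := by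
  classical
  have h : Measurable ((closure Ω).piecewise u (fun _ => 0)) :=
    ContinuousOn.measurable_piecewise hu.1 continuousOn_const isClosed_closure.measurableSet
  convert h using 1
  ext x
  by_cases hx : x ∈ closure Ω
  · simp [hx]
  · simp [hx, hu.2.2 x hx]

theorem exists_bound_P1 (hΩ : Bornology.IsBounded Ω) (hu : u ∈ 𝒯.P1 𝕜) :
    ∃ M : ℝ, ∀ x, ‖u x‖ ≤ M := by
  obtain ⟨M, hM⟩ := hΩ.isCompact_closure.exists_bound_of_continuousOn hu.1
  refine ⟨max M 0, fun x => ?_⟩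
  by_cases hx : x ∈ closure Ω
  · exact (hM x hx).trans (le_max_left _ _)
  · rw [hu.2.2 x hx, norm_zero]; exact le_max_right _ _

theorem integrable_P1 (hΩ : Bornology.IsBounded Ω) (hu : u ∈ 𝒯.P1 𝕜) : Integrable u := by
  obtain ⟨M, hM⟩ := exists_bound_P1 hΩ hu
  have h1 : IntegrableOn u (closure Ω) := by
    refine Measure.integrableOn_of_bounded (M := M) hΩ.isCompact_closure.measure_lt_top.ne
      (measurable_P1 hu).aestronglyMeasurable (ae_of_all _ hM)
  exact h1.integrable_of_forall_notMem_eq_zero fun x hx => hu.2.2 x hx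

theorem memLp_P1 (hΩ : Bornology.IsBounded Ω) (hu : u ∈ 𝒯.P1 𝕜) {μ : Measure Plane}
    [IsFiniteMeasure μ] : MemLp u 2 μ := by
  obtain ⟨M, hM⟩ := exists_bound_P1 hΩ hu
  exact MemLp.of_bound (measurable_P1 hu).aestronglyMeasurable M (ae_of_all _ hM)

theorem memLp_piecewisePartial (u : Plane → 𝕜) (i : Fin 2) {μ : Measure Plane}
    [IsFiniteMeasure μ] : MemLp (𝒯.piecewisePartial u i) 2 μ := by
  refine MemLp.of_bound (measurable_piecewisePartial u i).aestronglyMeasurable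
    (∑ K ∈ 𝒯.cells, ‖cellPartial u K i‖) (ae_of_all _ fun x => ?_)
  refine (norm_sum_le _ _).trans (Finset.sum_le_sum fun K _ => ?_)
  exact norm_indicator_le_norm_self _ _

/-- Dominated convergence, with the Lipschitz constant of the test function in the majorant. -/
theorem tendsto_integral_diffQuot {φ : Plane → ℝ} (hφ : ContDiff ℝ ∞ φ) (hc : HasCompactSupport φ)
    (hu : Integrable u) (e : Plane) :
    Tendsto (fun t : ℝ => ∫ x, (t⁻¹ * (φ (x + t • e) - φ x)) • u x) (𝓝[>] 0)
      (𝓝 (∫ x, (fderiv ℝ φ x e) • u x)) := by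
  obtain ⟨C, hC⟩ := hφ.lipschitzWith_of_hasCompactSupport hc (by simp)
  refine tendsto_integral_filter_of_dominated_convergence (fun x => (C * ‖e‖) * ‖u x‖) ?_ ?_ ?_ ?_
  · refine Eventually.of_forall fun t => ?_
    have : Continuous fun x => t⁻¹ * (φ (x + t • e) - φ x) := by
      have := hφ.continuous
      fun_prop
    exact this.aestronglyMeasurable.smul hu.1
  · filter_upwards [self_mem_nhdsWithin] with t ht
    refine ae_of_all _ fun x => ?_
    have ht' : (0 : ℝ) < t := ht
    rw [norm_smul]
    gcongr
    have h1 := hC.dist_le_mul (x + t • e) x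
    rw [dist_eq_norm, dist_eq_norm, add_sub_cancel_left, norm_smul, Real.norm_of_nonneg ht'.le]
      at h1
    rw [norm_mul, norm_inv, Real.norm_of_nonneg ht'.le, inv_mul_le_iff₀ ht']
    linarith
  · exact hu.norm.const_mul _
  · refine ae_of_all _ fun x => ?_
    refine Tendsto.smul_const ?_ _
    have h1 : HasLineDerivAt ℝ φ (fderiv ℝ φ x e) x e :=
      ((hφ.differentiable (by simp) x).hasFDerivAt).hasLineDerivAt e
    have h2 := h1.tendsto_slope_zero_right
    simpa only [smul_eq_mul] using h2

/-- Inside a cell the difference quotients of `u` are eventually constant, and almost every point is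
inside a cell. They are bounded because `u` is Lipschitz along segments in the closure of `Ω`. -/
theorem tendsto_integral_diffQuot_P1 (hΩo : IsOpen Ω) (hu : u ∈ 𝒯.P1 𝕜) {φ : Plane → ℝ}
    (hφ : ContDiff ℝ ∞ φ) (hc : HasCompactSupport φ) (hs : tsupport φ ⊆ Ω) (i : Fin 2) :
    Tendsto (fun t : ℝ => ∫ x, φ x • (t⁻¹ • (u (x - t • unitVec i) - u x))) (𝓝[>] 0)
      (𝓝 (-∫ x, φ x • 𝒯.piecewisePartial u i x)) := by
  -- For shifts shorter than `δ` the segment from a point of the support stays in `Ω`; elsewhere the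
  -- test function vanishes.
  obtain ⟨δ, hδ, hδΩ⟩ := hc.isCompact.exists_thickening_subset_open hΩo hs
  have hseg : ∀ x ∈ tsupport φ, ∀ t : ℝ, 0 < t → t < δ →
      segment ℝ x (x - t • unitVec i) ⊆ closure Ω := by
    intro x hx t ht htδ
    have hb : ball x δ ⊆ Ω := fun y hy => hδΩ (mem_thickening_iff.2 ⟨x, hx, hy⟩)
    refine ((convex_ball x δ).segment_subset (mem_ball_self hδ) ?_).trans (hb.trans subset_closure)
    rw [mem_ball, dist_eq_norm, sub_sub_cancel_left, norm_neg, norm_smul, norm_unitVec, mul_one,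
      Real.norm_of_nonneg ht.le]
    exact htδ
  rw [← integral_neg]
  refine tendsto_integral_filter_of_dominated_convergence
    (fun x => ‖φ x‖ * ∑ K ∈ 𝒯.cells, cellSlope u K) ?_ ?_ ?_ ?_
  · refine Eventually.of_forall fun t => ?_
    refine hφ.continuous.aestronglyMeasurable.smul ?_
    have hm := measurable_P1 hu
    have : Measurable fun x => t⁻¹ • (u (x - t • unitVec i) - u x) := by fun_prop
    exact this.aestronglyMeasurable
  · have hev : ∀ᶠ t : ℝ in 𝓝[>] 0, t ∈ Ioo 0 δ := Ioo_mem_nhdsGT hδ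
    filter_upwards [hev] with t ht
    refine ae_of_all _ fun x => ?_
    by_cases hx : x ∈ tsupport φ
    · rw [norm_smul]
      gcongr
      have h1 := norm_sub_le_of_segment hu (hseg x hx t ht.1 ht.2)
      rw [sub_sub_cancel_left, norm_neg, norm_smul, norm_unitVec, mul_one,
        Real.norm_of_nonneg ht.1.le] at h1
      rw [norm_smul, norm_inv, Real.norm_of_nonneg ht.1.le, inv_mul_le_iff₀ ht.1]
      exact h1
    · rw [image_eq_zero_of_notMem_tsupport hx]
      simp
  · exact (hφ.continuous.integrable_of_hasCompactSupport hc).norm.mul_const _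
  · have hae := (ae_restrict_iff' isClosed_closure.measurableSet).1 (𝒯.ae_exists_cell)
    filter_upwards [hae] with x hx
    by_cases hxs : x ∈ tsupport φ
    · obtain ⟨K, hK, hxK, hother⟩ := hx (subset_closure (hs hxs))
      rw [piecewisePartial_eq hK (interior_subset hxK) hother, ← smul_neg]
      refine Tendsto.const_smul ?_ _
      have hcont : Tendsto (fun t : ℝ => x - t • unitVec i) (𝓝[>] 0) (𝓝 x) := by
        have : Continuous fun t : ℝ => x - t • unitVec i := by fun_prop
        have h2 := this.tendsto 0
        rw [zero_smul, sub_zero] at h2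
        exact h2.mono_left nhdsWithin_le_nhds
      refine tendsto_const_nhds.congr' ?_
      filter_upwards [hcont.eventually (isOpen_interior.mem_nhds hxK), self_mem_nhdsWithin]
        with t ht ht0
      have ht0' : (0 : ℝ) < t := ht0
      rw [sub_eq_linear hu hK (interior_subset hxK) (interior_subset ht), sub_sub_cancel_left,
        map_neg, map_smul, smul_neg, smul_smul, inv_mul_cancel₀ ht0'.ne', one_smul]
      rfl
    · rw [image_eq_zero_of_notMem_tsupport hxs]
      simp

/-- Discrete integration by parts: translation invariance moves the difference quotient from the
test function to `u`, and the two preceding limits are equated. No boundary integrals over cells are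
needed. -/
theorem hasWeakPartial_P1 (hΩo : IsOpen Ω) (hΩ : Bornology.IsBounded Ω) (hu : u ∈ 𝒯.P1 𝕜)
    (i : Fin 2) : HasWeakPartial Ω i u (𝒯.piecewisePartial u i) := by
  intro φ hφ hc hs
  have hui := integrable_P1 hΩ hu
  have e1 : ∫ x in Ω, (fderiv ℝ φ x (EuclideanSpace.single i 1)) • u x =
      ∫ x, (fderiv ℝ φ x (unitVec i)) • u x := by
    refine setIntegral_eq_integral_of_forall_compl_eq_zero fun x hx => ?_
    rw [show fderiv ℝ φ x = 0 from image_eq_zero_of_notMem_tsupport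
      (f := fderiv ℝ φ) fun h' => hx (hs (tsupport_fderiv_subset ℝ h'))]
    simp
  have e2 : ∫ x in Ω, φ x • 𝒯.piecewisePartial u i x = ∫ x, φ x • 𝒯.piecewisePartial u i x := by
    refine setIntegral_eq_integral_of_forall_compl_eq_zero fun x hx => ?_
    rw [image_eq_zero_of_notMem_tsupport fun h' => hx (hs h'), zero_smul]
  rw [e1, e2]
  refine tendsto_nhds_unique (tendsto_integral_diffQuot hφ hc hui (unitVec i)) ?_
  refine (tendsto_integral_diffQuot_P1 hΩo hu hφ hc hs i).congr fun t => ?_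
  obtain ⟨Cφ, hCφ⟩ := hc.exists_bound_of_continuous hφ.continuous
  have hint : ∀ w : Plane, Integrable fun x => φ (x + w) • u x := fun w => by
    refine hui.bdd_smul Cφ ?_ (ae_of_all _ fun x => hCφ _)
    exact (hφ.continuous.comp (continuous_add_const w)).aestronglyMeasurable
  have hint0 : Integrable fun x => φ x • u x := by simpa using hint 0
  have hint' : Integrable fun x => φ x • u (x - t • unitVec i) := by
    have := (hint (t • unitVec i)).comp_sub_right (t • unitVec i)
    simpa using this
  have hshift : ∫ x, φ x • u (x - t • unitVec i) = ∫ x, φ (x + t • unitVec i) • u x := by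
    rw [← integral_sub_right_eq_self (fun x => φ (x + t • unitVec i) • u x) (t • unitVec i)]
    simp
  have l1 : ∀ x, φ x • (t⁻¹ • (u (x - t • unitVec i) - u x)) =
      t⁻¹ • (φ x • u (x - t • unitVec i) - φ x • u x) := fun x => by
    rw [← smul_sub, smul_comm]
  have l2 : ∀ x, (t⁻¹ * (φ (x + t • unitVec i) - φ x)) • u x =
      t⁻¹ • (φ (x + t • unitVec i) • u x - φ x • u x) := fun x => by
    rw [← sub_smul, smul_smul]
  simp only [l1, l2, integral_smul]
  rw [integral_sub hint' hint0, integral_sub (hint _) hint0, hshift]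

theorem memH1_P1 (hΩo : IsOpen Ω) (hΩ : Bornology.IsBounded Ω) (hu : u ∈ 𝒯.P1 𝕜) : MemH1 Ω u := by
  have : IsFiniteMeasure (volume.restrict Ω) := ⟨by
    rw [Measure.restrict_apply_univ]; exact hΩ.measure_lt_top⟩
  exact ⟨memLp_P1 hΩ hu, fun i =>
    ⟨_, memLp_piecewisePartial u i, hasWeakPartial_P1 hΩo hΩ hu i⟩⟩

theorem weakPartial_P1 (hΩo : IsOpen Ω) (hΩ : Bornology.IsBounded Ω) (hu : u ∈ 𝒯.P1 𝕜)
    (i : Fin 2) : weakPartial Ω i u =ᵐ[volume.restrict Ω] 𝒯.piecewisePartial u i := by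
  have : IsFiniteMeasure (volume.restrict Ω) := ⟨by
    rw [Measure.restrict_apply_univ]; exact hΩ.measure_lt_top⟩
  exact (memH1_P1 hΩo hΩ hu).weakPartial_ae_eq hΩo (hasWeakPartial_P1 hΩo hΩ hu i)
    (memLp_piecewisePartial u i)

end Triangulation

/-! ### Stability of the Scott-Zhang nodal values -/

section SzMean

variable {𝕜 : Type*} [RCLike 𝕜]

/-- The Scott-Zhang mean of a function along the segment `[p, q]`. -/
def szMean (f : Plane → 𝕜) (p q : Plane) : 𝕜 :=
  ∫ t in (0 : ℝ)..1, ((4 : ℝ) - 6 * t) • f (AffineMap.lineMap p q t)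

theorem intervalIntegrable_sz {f : Plane → 𝕜} {p q : Plane}
    (hf : AEStronglyMeasurable (fun t : ℝ => f (AffineMap.lineMap p q t))
      (volume.restrict (Icc 0 1))) (hfin : edgeMass f p q ≠ ⊤) :
    IntervalIntegrable (fun t : ℝ => ((4 : ℝ) - 6 * t) • f (AffineMap.lineMap p q t))
      volume 0 1 := by
  rw [intervalIntegrable_iff_integrableOn_Icc_of_le zero_le_one]
  have h2 : MemLp (fun t : ℝ => f (AffineMap.lineMap p q t)) 2 (volume.restrict (Icc 0 1)) := by
    refine ⟨hf, ?_⟩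
    rw [eLpNorm_lt_top_iff_lintegral_rpow_enorm_lt_top (by norm_num) (by norm_num)]
    have := lt_top_iff_ne_top.2 hfin
    rw [edgeMass] at this
    simpa using this
  have h1 : Integrable (fun t : ℝ => f (AffineMap.lineMap p q t)) (volume.restrict (Icc 0 1)) :=
    h2.integrable (by norm_num)
  have hc : Continuous fun t : ℝ => (4 : ℝ) - 6 * t := by fun_prop
  exact IntegrableOn.continuousOn_smul h1 hc.continuousOn isCompact_Icc

/-- The weight `4 - 6 t` runs from `4` to `-2`, so it is bounded by `4`; Cauchy–Schwarz gives `16 =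
4²`. -/
theorem enorm_szMean_sq_le (f : Plane → 𝕜) (p q : Plane)
    (hf : AEMeasurable (fun t : ℝ => ‖f (AffineMap.lineMap p q t)‖ₑ)
      (volume.restrict (Icc 0 1))) : ‖szMean f p q‖ₑ ^ 2 ≤ 16 * edgeMass f p q := by
  have h1 : ‖szMean f p q‖ₑ ≤ ∫⁻ t in Icc (0 : ℝ) 1, 4 * ‖f (AffineMap.lineMap p q t)‖ₑ := by
    rw [szMean, intervalIntegral.integral_of_le zero_le_one]
    refine (enorm_integral_le_lintegral_enorm _).trans ?_
    refine (lintegral_mono_set Ioc_subset_Icc_self).trans ?_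
    refine setLIntegral_mono' measurableSet_Icc fun t ht => ?_
    rw [enorm_smul]
    gcongr
    rw [← ofReal_norm, show (4 : ℝ≥0∞) = ENNReal.ofReal 4 by simp]
    apply ENNReal.ofReal_le_ofReal
    rw [Real.norm_eq_abs, abs_le]
    constructor <;> linarith [ht.1, ht.2]
  obtain ⟨g, hg, hfg⟩ := hf
  calc ‖szMean f p q‖ₑ ^ 2 ≤ (∫⁻ t in Icc (0 : ℝ) 1, 4 * ‖f (AffineMap.lineMap p q t)‖ₑ) ^ 2 := by
        gcongr
    _ = (4 * ∫⁻ t in Icc (0 : ℝ) 1, g t) ^ 2 := by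
        rw [lintegral_const_mul' _ _ (by norm_num), lintegral_congr_ae hfg]
    _ = 16 * (∫⁻ t in Icc (0 : ℝ) 1, g t) ^ 2 := by rw [mul_pow]; norm_num
    _ ≤ 16 * ∫⁻ t in Icc (0 : ℝ) 1, g t ^ 2 := by
        gcongr
        exact sq_lintegral_le_lintegral_sq _ hg
    _ = 16 * edgeMass f p q := by
        congr 1
        refine lintegral_congr_ae ?_
        filter_upwards [hfg] with t ht
        rw [ht]

theorem szMean_sub {f g : Plane → 𝕜} {p q : Plane}
    (hf : IntervalIntegrable (fun t : ℝ => ((4 : ℝ) - 6 * t) • f (AffineMap.lineMap p q t))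
      volume 0 1)
    (hg : IntervalIntegrable (fun t : ℝ => ((4 : ℝ) - 6 * t) • g (AffineMap.lineMap p q t))
      volume 0 1) : szMean (fun x => f x - g x) p q = szMean f p q - szMean g p q := by
  simp only [szMean, smul_sub]
  exact intervalIntegral.integral_sub hf hg

/-- The weight has integral one. Preservation of constants is the only property of the dual function
that stability needs. -/
theorem szMean_const (c : 𝕜) (p q : Plane) : szMean (fun _ => c) p q = c := by
  simp only [szMean]
  rw [intervalIntegral.integral_smul_const]
  have : ∫ t in (0 : ℝ)..1, ((4 : ℝ) - 6 * t) = 1 := by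
    rw [intervalIntegral.integral_sub (by simp) (by apply Continuous.intervalIntegrable; fun_prop)]
    rw [intervalIntegral.integral_const, intervalIntegral.integral_const_mul, integral_id]
    norm_num
  rw [this, one_smul]

theorem enorm_szMean_sub_sq_le {f : Plane → 𝕜} {p q : Plane}
    (hf : ContinuousOn (fun t : ℝ => f (AffineMap.lineMap p q t)) (Icc 0 1)) (c : 𝕜) :
    ‖szMean f p q - c‖ₑ ^ 2 ≤ 16 * edgeMass (fun x => f x - c) p q := by
  have hcont : Continuous fun t : ℝ => (4 : ℝ) - 6 * t := by fun_prop
  have h1 : IntervalIntegrable (fun t : ℝ => ((4 : ℝ) - 6 * t) • f (AffineMap.lineMap p q t))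
      volume 0 1 := by
    refine ContinuousOn.intervalIntegrable ?_
    rw [uIcc_of_le zero_le_one]
    exact hcont.continuousOn.smul hf
  have h2 : IntervalIntegrable (fun t : ℝ => ((4 : ℝ) - 6 * t) • c) volume 0 1 :=
    Continuous.intervalIntegrable (by fun_prop) _ _
  have h3 : szMean f p q - c = szMean (fun x => f x - c) p q := by
    rw [szMean_sub h1 h2, szMean_const]
  rw [h3]
  exact enorm_szMean_sq_le _ p q
    ((hf.sub continuousOn_const).enorm.aemeasurable measurableSet_Icc)

end SzMean

/-! ### Uniform bounds under shape regularity and quasi-uniformity -/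

namespace Triangulation

variable {Ω : Set Plane} {𝒯 : Triangulation Ω}

/-- The shape regularity and quasi-uniformity constants of one triangulation. -/
structure IsRegular (𝒯 : Triangulation Ω) (σ τ : ℝ) : Prop where
  σ_pos : 0 < σ
  τ_pos : 0 < τ
  shape : ∀ K ∈ 𝒯.cells, ∃ x : Plane,
    ball x (σ * diam (K : Set Plane)) ⊆ convexHull ℝ (K : Set Plane)
  quasi : ∀ K ∈ 𝒯.cells, ∀ L ∈ 𝒯.cells, τ * diam (L : Set Plane) ≤ diam (K : Set Plane)

/-- The area of the unit disc. -/
def discArea : ℝ := volume.real (ball (0 : Plane) 1)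

theorem discArea_pos : 0 < discArea :=
  ENNReal.toReal_pos (measure_ball_pos _ _ one_pos).ne' measure_ball_lt_top.ne

theorem volume_real_ball (x : Plane) {r : ℝ} (hr : 0 ≤ r) :
    volume.real (ball x r) = r ^ 2 * discArea := by
  rw [Measure.real, Measure.addHaar_ball volume x hr, ENNReal.toReal_mul,
    ENNReal.toReal_ofReal (by positivity)]
  simp [discArea, Measure.real]

theorem volume_real_closedBall (x : Plane) {r : ℝ} (hr : 0 ≤ r) :
    volume.real (closedBall x r) = r ^ 2 * discArea := by
  rw [Measure.real, Measure.addHaar_closedBall volume x hr, ENNReal.toReal_mul,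
    ENNReal.toReal_ofReal (by positivity)]
  simp [discArea, Measure.real]

theorem diam_pos {K : Finset Plane} (hK : K ∈ 𝒯.cells) : 0 < diam (K : Set Plane) := by
  obtain ⟨p, hp, q, hq, r, hr, hpq, -⟩ := exists_triple hK
  exact (dist_pos.2 hpq).trans_le (dist_le_diam_of_mem K.finite_toSet.isBounded hp hq)

theorem hull_subset_closedBall {K : Finset Plane} {a : Plane} (ha : a ∈ K) :
    convexHull ℝ (K : Set Plane) ⊆ closedBall a (diam (K : Set Plane)) :=
  convexHull_min (fun _ hb => dist_le_diam_of_mem K.finite_toSet.isBounded hb ha)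
    (convex_closedBall _ _)

namespace IsRegular

variable {σ τ : ℝ} {K L : Finset Plane}

theorem volume_ge (h : 𝒯.IsRegular σ τ) (hK : K ∈ 𝒯.cells) :
    σ ^ 2 * diam (K : Set Plane) ^ 2 * discArea ≤
      volume.real (convexHull ℝ (K : Set Plane)) := by
  obtain ⟨x, hx⟩ := h.shape K hK
  have h1 := measureReal_mono hx (volume_hull_ne_top K)
  rw [volume_real_ball x (mul_nonneg h.σ_pos.le diam_nonneg), mul_pow] at h1
  exact h1

theorem volume_le (hK : K ∈ 𝒯.cells) :
    volume.real (convexHull ℝ (K : Set Plane)) ≤ diam (K : Set Plane) ^ 2 * discArea := by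
  obtain ⟨a, ha, -⟩ := exists_triple hK
  rw [← volume_real_closedBall a diam_nonneg]
  exact measureReal_mono (hull_subset_closedBall ha) measure_closedBall_lt_top.ne

theorem shape_const (h : 𝒯.IsRegular σ τ) (hK : K ∈ 𝒯.cells) :
    diam (K : Set Plane) ^ 2 ≤
      (1 / (σ ^ 2 * discArea)) * volume.real (convexHull ℝ (K : Set Plane)) := by
  have h1 := h.volume_ge hK
  have h2 := h.σ_pos
  have h3 := discArea_pos
  rw [one_div, ← div_eq_inv_mul, le_div_iff₀ (by positivity)]
  linarith

/-- Shape regularity makes areas comparable to squared diameters, and quasi-uniformity makes the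
diameters comparable. -/
theorem volume_le_mul (h : 𝒯.IsRegular σ τ) (hK : K ∈ 𝒯.cells) (hL : L ∈ 𝒯.cells) :
    volume.real (convexHull ℝ (K : Set Plane)) ≤
      1 / (σ ^ 2 * τ ^ 2) * volume.real (convexHull ℝ (L : Set Plane)) := by
  have h1 := h.volume_ge hL
  have h2 := volume_le hK
  have hσ := h.σ_pos
  have hτ := h.τ_pos
  have hA := discArea_pos
  have h3 := h.quasi L hL K hK
  have h4 : τ ^ 2 * diam (K : Set Plane) ^ 2 ≤ diam (L : Set Plane) ^ 2 := by
    rw [← mul_pow]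
    exact pow_le_pow_left₀ (mul_nonneg hτ.le diam_nonneg) h3 2
  rw [one_div, ← div_eq_inv_mul, le_div_iff₀ (by positivity)]
  calc volume.real (convexHull ℝ (K : Set Plane)) * (σ ^ 2 * τ ^ 2)
      ≤ (diam (K : Set Plane) ^ 2 * discArea) * (σ ^ 2 * τ ^ 2) := by gcongr
    _ = σ ^ 2 * (τ ^ 2 * diam (K : Set Plane) ^ 2) * discArea := by ring
    _ ≤ σ ^ 2 * diam (L : Set Plane) ^ 2 * discArea := by gcongr
    _ ≤ _ := h1

open Classical in
/-- The number of triangles at a vertex is bounded. -/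
theorem card_star_le (h : 𝒯.IsRegular σ τ) (a : Plane) :
    ((𝒯.cells.filter (a ∈ ·)).card : ℝ) ≤ (1 / (σ ^ 2 * τ ^ 2)) ^ 2 := by
  have hσ := h.σ_pos
  have hτ := h.τ_pos
  have hA := discArea_pos
  rcases (𝒯.cells.filter (a ∈ ·)).eq_empty_or_nonempty with he | ⟨K, hK⟩
  · rw [he]; simp; positivity
  rw [Finset.mem_filter] at hK
  set R := 1 / (σ ^ 2 * τ ^ 2) with hR
  have hRpos : 0 < R := by positivity
  have hV := IsUpperGradPair.volume_real_pos hK.1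
  -- The essentially disjoint cells at `a` all fit into a disc of radius `diam K / τ`. One factor
  -- `R` of the final bound compares the cells with `K`, the other compares this disc with `K`.
  have hsum : ∑ L ∈ 𝒯.cells.filter (a ∈ ·), volume (convexHull ℝ (L : Set Plane)) ≤
      volume (closedBall a (diam (K : Set Plane) / τ)) := by
    have h1 : volume (⋃ L ∈ 𝒯.cells.filter (a ∈ ·), convexHull ℝ (L : Set Plane)) =
        ∑ L ∈ 𝒯.cells.filter (a ∈ ·), volume (convexHull ℝ (L : Set Plane)) := by
      refine measure_biUnion_finset₀ ?_ fun L _ => (measurableSet_hull L).nullMeasurableSet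
      intro L hL M hM hne
      exact volume_hull_inter (Finset.mem_filter.1 hL).1 (Finset.mem_filter.1 hM).1 hne
    rw [← h1]
    refine measure_mono (iUnion₂_subset fun L hL => ?_)
    rw [Finset.mem_filter] at hL
    refine (hull_subset_closedBall hL.2).trans (closedBall_subset_closedBall ?_)
    rw [le_div_iff₀ hτ, mul_comm]
    exact h.quasi K hK.1 L hL.1
  have hsum' : ∑ L ∈ 𝒯.cells.filter (a ∈ ·), volume.real (convexHull ℝ (L : Set Plane)) ≤
      (diam (K : Set Plane) / τ) ^ 2 * discArea := by
    rw [← volume_real_closedBall a (div_nonneg diam_nonneg hτ.le)]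
    have := ENNReal.toReal_mono measure_closedBall_lt_top.ne hsum
    rwa [ENNReal.toReal_sum fun L _ => volume_hull_ne_top L] at this
  have hlow : ((𝒯.cells.filter (a ∈ ·)).card : ℝ) * volume.real (convexHull ℝ (K : Set Plane)) ≤
      R * ∑ L ∈ 𝒯.cells.filter (a ∈ ·), volume.real (convexHull ℝ (L : Set Plane)) := by
    rw [Finset.mul_sum, ← nsmul_eq_mul]
    exact Finset.card_nsmul_le_sum _ _ _ fun L hL =>
      h.volume_le_mul hK.1 (Finset.mem_filter.1 hL).1
  have hup : (diam (K : Set Plane) / τ) ^ 2 * discArea ≤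
      R * volume.real (convexHull ℝ (K : Set Plane)) := by
    have h1 := h.volume_ge hK.1
    calc (diam (K : Set Plane) / τ) ^ 2 * discArea
        = R * (σ ^ 2 * diam (K : Set Plane) ^ 2 * discArea) := by
          rw [hR]; field_simp
      _ ≤ _ := by gcongr
  have : ((𝒯.cells.filter (a ∈ ·)).card : ℝ) * volume.real (convexHull ℝ (K : Set Plane)) ≤
      R ^ 2 * volume.real (convexHull ℝ (K : Set Plane)) := by
    calc _ ≤ _ := hlow
      _ ≤ R * (R * volume.real (convexHull ℝ (K : Set Plane))) := by
        gcongr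
        exact hsum'.trans hup
      _ = _ := by ring
  exact le_of_mul_le_mul_right this hV

end IsRegular

open Classical in
/-- Double counting of the triangles at the vertices of triangles. -/
theorem sum_star_le (𝒯 : Triangulation Ω) {N : ℝ}
    (hN : ∀ a, ((𝒯.cells.filter (a ∈ ·)).card : ℝ) ≤ N) {X : Finset Plane → ℝ}
    (hX : ∀ K, 0 ≤ X K) :
    ∑ K ∈ 𝒯.cells, ∑ a ∈ K, ∑ L ∈ 𝒯.cells.filter (a ∈ ·), X L ≤
      3 * N * ∑ L ∈ 𝒯.cells, X L := by
  have hswap : ∀ g : Plane → Finset Plane → ℝ, ∑ K ∈ 𝒯.cells, ∑ a ∈ K, g a K =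
      ∑ a ∈ 𝒯.cells.biUnion id, ∑ K ∈ 𝒯.cells.filter (a ∈ ·), g a K := fun g =>
    Finset.sum_comm' fun K a => by
      simp only [Finset.mem_biUnion, Finset.mem_filter, id]
      constructor
      · rintro ⟨hK, ha⟩; exact ⟨⟨hK, ha⟩, K, hK, ha⟩
      · rintro ⟨h, -⟩; exact h
  calc _ = ∑ a ∈ 𝒯.cells.biUnion id, ∑ K ∈ 𝒯.cells.filter (a ∈ ·),
          ∑ L ∈ 𝒯.cells.filter (a ∈ ·), X L := hswap fun a _ => _
    _ ≤ ∑ a ∈ 𝒯.cells.biUnion id, N * ∑ L ∈ 𝒯.cells.filter (a ∈ ·), X L := by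
        refine Finset.sum_le_sum fun a _ => ?_
        rw [Finset.sum_const, nsmul_eq_mul]
        exact mul_le_mul_of_nonneg_right (hN a) (Finset.sum_nonneg fun L _ => hX L)
    _ = N * ∑ L ∈ 𝒯.cells, ∑ a ∈ L, X L := by
        rw [← Finset.mul_sum, hswap fun _ L => X L]
    _ = _ := by
        rw [mul_comm 3 N, mul_assoc, Finset.mul_sum (a := (3 : ℝ))]
        congr 1
        refine Finset.sum_congr rfl fun L hL => ?_
        rw [Finset.sum_const, 𝒯.card_eq L hL]
        simp

/-- The discrete energy of nodal values: it dominates the squared `H¹` norm. -/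
def nodalEnergy {𝕜 : Type*} [RCLike 𝕜] (𝒯 : Triangulation Ω) (γ : ℝ) (c : Plane → 𝕜) : ℝ :=
  ∑ K ∈ 𝒯.cells, (volume.real (convexHull ℝ (K : Set Plane)) * (∑ a ∈ K, ‖c a‖ ^ 2) +
    γ * ∑ a ∈ K, ∑ b ∈ K, ‖c a - c b‖ ^ 2)

section

variable {𝕜 : Type*} [RCLike 𝕜] {σ τ : ℝ} {f : Plane → 𝕜} {ρ : Plane → ℝ≥0∞}

theorem norm_szMean_sub_sq_le (h : IsUpperGradPair Ω f ρ) {K : Finset Plane} (hK : K ∈ 𝒯.cells)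
    {p q : Plane} (hp : p ∈ K) (hq : q ∈ K) (c : 𝕜) {A : ℝ} (hA0 : 0 ≤ A)
    (hA : edgeMass (fun x => f x - c) p q ≤ ENNReal.ofReal A) :
    ‖szMean f p q - c‖ ^ 2 ≤ 16 * A := by
  have h1 := (enorm_szMean_sub_sq_le (h.continuousOn_edge hK hp hq) c).trans
    (mul_le_mul_right hA 16)
  rw [← ofReal_norm, ← ENNReal.ofReal_pow (norm_nonneg _),
    show (16 : ℝ≥0∞) = ENNReal.ofReal 16 by simp, ← ENNReal.ofReal_mul (by norm_num)] at h1
  exact (ENNReal.ofReal_le_ofReal_iff (by positivity)).1 h1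

open Classical in
/-- The Scott-Zhang nodal values of a function with an upper gradient are stable. -/
theorem nodalEnergy_szMean_le (hreg : 𝒯.IsRegular σ τ) (hΩ : IsPolygonalDomain Ω)
    (s : 𝒯.EdgeChoice) (h : IsUpperGradPair Ω f ρ) {γ R κ W : ℝ} (hγ : 0 ≤ γ)
    (hR : R = 1 / (σ ^ 2 * τ ^ 2)) (hκ : κ = 1 / (σ ^ 2 * discArea))
    (hW : W = volume.real (closure Ω)) :
    𝒯.nodalEnergy γ (fun a => szMean f a (s.nbr a)) ≤
      3 * R ^ 2 * (128 * R + 128 * κ * W + 24 * γ * κ * (640 + 80 * (R ^ 2) ^ 2)) *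
        ((∑ K ∈ 𝒯.cells, cellMass f K) + ∑ K ∈ 𝒯.cells, cellEnergy ρ K) := by
  have hσ := hreg.σ_pos
  have hτ := hreg.τ_pos
  have hA := discArea_pos
  have hR0 : 0 < R := by rw [hR]; positivity
  have hκ0 : 0 < κ := by rw [hκ]; positivity
  have hW0 : 0 ≤ W := by rw [hW]; exact measureReal_nonneg
  have hshape : ∀ K ∈ 𝒯.cells,
      diam (K : Set Plane) ^ 2 ≤ κ * volume.real (convexHull ℝ (K : Set Plane)) := fun K hK => by
    rw [hκ]; exact hreg.shape_const hK
  have hN : ∀ a, ((𝒯.cells.filter (a ∈ ·)).card : ℝ) ≤ R ^ 2 := fun a => by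
    rw [hR]; exact hreg.card_star_le a
  have hE := cellEnergy_nonneg ρ
  have hM : ∀ K, 0 ≤ cellMass f K := fun K => ENNReal.toReal_nonneg
  obtain ⟨m, hm⟩ := h.exists_cell_constants hshape
  let c : Plane → 𝕜 := fun a => szMean f a (s.nbr a)
  let star : Plane → Finset (Finset Plane) := fun a => 𝒯.cells.filter (a ∈ ·)
  let S : Plane → ℝ := fun a => ∑ L ∈ star a, cellEnergy ρ L
  let Y : Finset Plane → ℝ := fun L => 128 * R * cellMass f L + 128 * κ * W * cellEnergy ρ L
  have hY0 : ∀ L, 0 ≤ Y L := fun L => by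
    have := hE L
    have := hM L
    positivity
  have hS0 : ∀ a, 0 ≤ S a := fun a => Finset.sum_nonneg fun L _ => hE L
  have hnode : ∀ K ∈ 𝒯.cells, ∀ a ∈ K, ∃ L ∈ star a, a ∈ L ∧ s.nbr a ∈ L := fun K hK a ha => by
    obtain ⟨L, hL, haL, hnL⟩ := s.edge a ⟨K, hK, ha⟩
    exact ⟨L, Finset.mem_filter.2 ⟨hL, haL⟩, haL, hnL⟩
  -- The nodal value is controlled on a cell `L` that carries the edge assigned to `a`; `L` may
  -- differ from `K`, but has comparable area. The factor is `128 = 16 · 8`, from the mean and from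
  -- the edge inequality.
  have hmass : ∀ K ∈ 𝒯.cells, ∀ a ∈ K,
      volume.real (convexHull ℝ (K : Set Plane)) * ‖c a‖ ^ 2 ≤ ∑ L ∈ star a, Y L := by
    intro K hK a ha
    obtain ⟨L, hL, haL, hnL⟩ := hnode K hK a ha
    have hLc := (Finset.mem_filter.1 hL).1
    have hVL := IsUpperGradPair.volume_real_pos hLc
    -- The trace inequality leaves an energy term times the area of `K`; the total area `W` bounds
    -- that factor uniformly in the mesh.
    have hVK : volume.real (convexHull ℝ (K : Set Plane)) ≤ W := by
      rw [hW]
      exact measureReal_mono (𝒯.convexHull_subset_closure hK)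
        hΩ.isBounded.isCompact_closure.measure_lt_top.ne
    have hVKL : volume.real (convexHull ℝ (K : Set Plane)) ≤
        R * volume.real (convexHull ℝ (L : Set Plane)) := by
      rw [hR]; exact hreg.volume_le_mul hK hLc
    have hne : a ≠ s.nbr a := (s.ne a ⟨K, hK, ha⟩).symm
    have hML := hM L
    have hEL := hE L
    have h0 := h.edgeMass_le hLc (hshape L hLc) haL hnL hne
    have h1 := norm_szMean_sub_sq_le h hLc haL hnL 0 (A := 8 / volume.real
      (convexHull ℝ (L : Set Plane)) * cellMass f L + 8 * κ * cellEnergy ρ L)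
      (by positivity) (by simpa only [sub_zero] using h0)
    rw [sub_zero] at h1
    refine le_trans ?_ (Finset.single_le_sum (fun L _ => hY0 L) hL)
    calc volume.real (convexHull ℝ (K : Set Plane)) * ‖c a‖ ^ 2
        ≤ volume.real (convexHull ℝ (K : Set Plane)) * (16 * (8 / volume.real
            (convexHull ℝ (L : Set Plane)) * cellMass f L + 8 * κ * cellEnergy ρ L)) := by
          gcongr
      _ = 128 * (volume.real (convexHull ℝ (K : Set Plane)) / volume.real
            (convexHull ℝ (L : Set Plane))) * cellMass f L +
            128 * κ * volume.real (convexHull ℝ (K : Set Plane)) * cellEnergy ρ L := by ring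
      _ ≤ 128 * R * cellMass f L + 128 * κ * W * cellEnergy ρ L := by
          gcongr
          rwa [div_le_iff₀ hVL]
  have hstar : ∀ a, ∀ K ∈ star a, ∀ L ∈ star a,
      ‖m K - m L‖ ^ 2 ≤ (R ^ 2) ^ 2 * (80 * κ * S a) := by
    intro a K hK L hL
    refine (h.chain_le hκ0.le (fun K hK => (hm K hK).2) (star a) (Finset.filter_subset _ _)
      ?_ hK hL).trans ?_
    · intro P K hK L hL hPK hPL
      rw [Finset.mem_filter] at hK hL
      obtain ⟨K', hK', L', hL', haK', haL', h1, h2, h3⟩ :=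
        𝒯.exists_adjacent_star hΩ.lipschitz hΩ.isOpen hK.1 hL.1 hK.2 hL.2 hPK hPL
      exact ⟨K', Finset.mem_filter.2 ⟨hK', haK'⟩, L', Finset.mem_filter.2 ⟨hL', haL'⟩, h1, h2, h3⟩
    · have := hS0 a
      gcongr
      exact hN a
  -- The mean at `a` is close to the constant of the cell `L` that carries its edge (`640 = 16 ·
  -- 40`), and a chain in the star of `a` leads from `L` to `K`.
  have hcell : ∀ K ∈ 𝒯.cells, ∀ a ∈ K,
      ‖c a - m K‖ ^ 2 ≤ 2 * (640 + 80 * (R ^ 2) ^ 2) * κ * S a := by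
    intro K hK a ha
    obtain ⟨L, hL, haL, hnL⟩ := hnode K hK a ha
    have hLc := (Finset.mem_filter.1 hL).1
    have hne : a ≠ s.nbr a := (s.ne a ⟨K, hK, ha⟩).symm
    have hEL := hE L
    have h1 := norm_szMean_sub_sq_le h hLc haL hnL (m L) (A := 40 * κ * cellEnergy ρ L)
      (by positivity) ((hm L hLc).2 a haL _ hnL hne)
    have h2 := hstar a L hL K (Finset.mem_filter.2 ⟨hK, ha⟩)
    have h3 : cellEnergy ρ L ≤ S a := Finset.single_le_sum (fun L _ => hE L) hL
    have h4 : ‖c a - m K‖ ≤ ‖c a - m L‖ + ‖m L - m K‖ := norm_sub_le_norm_sub_add_norm_sub _ _ _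
    have h5 : ‖c a - m K‖ ^ 2 ≤ 2 * ‖c a - m L‖ ^ 2 + 2 * ‖m L - m K‖ ^ 2 := by
      nlinarith [sq_nonneg (‖c a - m L‖ - ‖m L - m K‖), norm_nonneg (c a - m K)]
    have h6 : 16 * (40 * κ * cellEnergy ρ L) ≤ 640 * κ * S a := by
      have := mul_le_mul_of_nonneg_left h3 hκ0.le
      linarith
    calc _ ≤ _ := h5
      _ ≤ 2 * (640 * κ * S a) + 2 * ((R ^ 2) ^ 2 * (80 * κ * S a)) := by
        gcongr
        exact h1.trans h6
      _ = _ := by ring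
  set B := 2 * (640 + 80 * (R ^ 2) ^ 2) * κ with hB
  have hB0 : 0 ≤ B := by positivity
  -- Both nodal values are compared with the same cell constant `m K`; each of the two symmetric
  -- sums contributes `2 · 3` by the three vertices.
  have hdiff : ∀ K ∈ 𝒯.cells, ∑ a ∈ K, ∑ b ∈ K, ‖c a - c b‖ ^ 2 ≤ 12 * B * ∑ a ∈ K, S a := by
    intro K hK
    calc ∑ a ∈ K, ∑ b ∈ K, ‖c a - c b‖ ^ 2
        ≤ ∑ a ∈ K, ∑ b ∈ K, (2 * (B * S a) + 2 * (B * S b)) := by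
          refine Finset.sum_le_sum fun a ha => Finset.sum_le_sum fun b hb => ?_
          have h1 := hcell K hK a ha
          have h2 := hcell K hK b hb
          have h3 : ‖c a - c b‖ ≤ ‖c a - m K‖ + ‖c b - m K‖ := by
            rw [← norm_neg (c b - m K), neg_sub]
            exact norm_sub_le_norm_sub_add_norm_sub _ _ _
          nlinarith [sq_nonneg (‖c a - m K‖ - ‖c b - m K‖), norm_nonneg (c a - c b)]
      _ = 12 * B * ∑ a ∈ K, S a := by
          simp only [Finset.sum_add_distrib, Finset.sum_const, 𝒯.card_eq K hK, nsmul_eq_mul,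
            ← Finset.mul_sum]
          push_cast
          ring
  have hY := 𝒯.sum_star_le hN hY0
  have hES := 𝒯.sum_star_le hN hE
  have hsumE := Finset.sum_nonneg fun K (_ : K ∈ 𝒯.cells) => hE K
  have hsumM := Finset.sum_nonneg fun K (_ : K ∈ 𝒯.cells) => hM K
  calc 𝒯.nodalEnergy γ c
      ≤ ∑ K ∈ 𝒯.cells, ((∑ a ∈ K, ∑ L ∈ star a, Y L) + γ * (12 * B * ∑ a ∈ K, S a)) := by
        refine Finset.sum_le_sum fun K hK => ?_
        gcongr
        · rw [Finset.mul_sum]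
          exact Finset.sum_le_sum fun a ha => hmass K hK a ha
        · exact hdiff K hK
    _ = (∑ K ∈ 𝒯.cells, ∑ a ∈ K, ∑ L ∈ star a, Y L) +
          12 * γ * B * ∑ K ∈ 𝒯.cells, ∑ a ∈ K, S a := by
        rw [Finset.sum_add_distrib, Finset.mul_sum]
        congr 1
        exact Finset.sum_congr rfl fun K _ => by ring
    _ ≤ 3 * R ^ 2 * (∑ L ∈ 𝒯.cells, Y L) +
          12 * γ * B * (3 * R ^ 2 * ∑ L ∈ 𝒯.cells, cellEnergy ρ L) := by
        gcongr
    _ = 3 * R ^ 2 * (128 * R * (∑ K ∈ 𝒯.cells, cellMass f K) +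
          (128 * κ * W + 24 * γ * κ * (640 + 80 * (R ^ 2) ^ 2)) *
            ∑ L ∈ 𝒯.cells, cellEnergy ρ L) := by
        simp only [Y, Finset.sum_add_distrib, ← Finset.mul_sum]
        rw [hB]
        ring
    _ ≤ _ := by
        rw [mul_assoc (3 * R ^ 2)]
        refine mul_le_mul_of_nonneg_left ?_ (by positivity)
        have e1 : 0 ≤ (128 * κ * W + 24 * γ * κ * (640 + 80 * (R ^ 2) ^ 2)) *
            ∑ K ∈ 𝒯.cells, cellMass f K := by positivity
        have e2 : 0 ≤ 128 * R * ∑ K ∈ 𝒯.cells, cellEnergy ρ K := by positivity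
        linarith

end

end Triangulation

/-! ### Norms -/

section Norms

variable {𝕜 : Type*} [RCLike 𝕜] {Ω S : Set Plane} {u v w : Plane → 𝕜} {μ : Measure Plane}

theorem eLpNorm_two_sq (u : Plane → 𝕜) (μ : Measure Plane) :
    eLpNorm u 2 μ ^ 2 = ∫⁻ x, ‖u x‖ₑ ^ 2 ∂μ := by
  rw [eLpNorm_eq_lintegral_rpow_enorm_toReal (by norm_num) (by norm_num), ← ENNReal.rpow_natCast,
    ← ENNReal.rpow_mul]
  norm_num

theorem lintegral_sq_eq_l2Norm (hu : MemLp u 2 μ) :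
    ∫⁻ x, ‖u x‖ₑ ^ 2 ∂μ = ENNReal.ofReal (l2Norm μ u ^ 2) := by
  rw [← eLpNorm_two_sq, l2Norm, ENNReal.ofReal_pow ENNReal.toReal_nonneg,
    ENNReal.ofReal_toReal hu.2.ne]

theorem l2Norm_nonneg (μ : Measure Plane) (u : Plane → 𝕜) : 0 ≤ l2Norm μ u :=
  ENNReal.toReal_nonneg

theorem gradNorm_nonneg (Ω : Set Plane) (u : Plane → 𝕜) : 0 ≤ gradNorm Ω u := Real.sqrt_nonneg _

theorem h1Norm_nonneg (Ω : Set Plane) (u : Plane → 𝕜) : 0 ≤ h1Norm Ω u := Real.sqrt_nonneg _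

theorem gradNorm_sq (Ω : Set Plane) (u : Plane → 𝕜) :
    gradNorm Ω u ^ 2 = ∑ i, l2Norm (volume.restrict Ω) (weakPartial Ω i u) ^ 2 :=
  Real.sq_sqrt (Finset.sum_nonneg fun _ _ => sq_nonneg _)

theorem h1Norm_sq (Ω : Set Plane) (u : Plane → 𝕜) :
    h1Norm Ω u ^ 2 = l2Norm (volume.restrict Ω) u ^ 2 + gradNorm Ω u ^ 2 :=
  Real.sq_sqrt (by positivity)

theorem l2Norm_le_h1Norm (Ω : Set Plane) (u : Plane → 𝕜) :
    l2Norm (volume.restrict Ω) u ≤ h1Norm Ω u :=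
  Real.le_sqrt_of_sq_le (le_add_of_nonneg_right (sq_nonneg _))

theorem gradNorm_le_h1Norm (Ω : Set Plane) (u : Plane → 𝕜) : gradNorm Ω u ≤ h1Norm Ω u :=
  Real.le_sqrt_of_sq_le (le_add_of_nonneg_left (sq_nonneg _))

theorem l2Norm_weakPartial_le_gradNorm (Ω : Set Plane) (u : Plane → 𝕜) (i : Fin 2) :
    l2Norm (volume.restrict Ω) (weakPartial Ω i u) ≤ gradNorm Ω u :=
  Real.le_sqrt_of_sq_le (Finset.single_le_sum
    (f := fun i => l2Norm (volume.restrict Ω) (weakPartial Ω i u) ^ 2)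
    (fun _ _ => sq_nonneg _) (Finset.mem_univ i))

theorem MemH1.sum_lintegral_weakPartial (hu : MemH1 Ω u) :
    ∑ i, ∫⁻ x in Ω, ‖weakPartial Ω i u x‖ₑ ^ 2 = ENNReal.ofReal (gradNorm Ω u ^ 2) := by
  rw [gradNorm_sq, ENNReal.ofReal_sum_of_nonneg fun _ _ => sq_nonneg _]
  exact Finset.sum_congr rfl fun i _ => lintegral_sq_eq_l2Norm (hu.memLp_weakPartial i)

theorem MemH1.lintegral_add_sum (hu : MemH1 Ω u) :
    (∫⁻ x in Ω, ‖u x‖ₑ ^ 2) + ∑ i, ∫⁻ x in Ω, ‖weakPartial Ω i u x‖ₑ ^ 2 =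
      ENNReal.ofReal (h1Norm Ω u ^ 2) := by
  rw [hu.sum_lintegral_weakPartial, lintegral_sq_eq_l2Norm hu.1, h1Norm_sq,
    ENNReal.ofReal_add (sq_nonneg _) (sq_nonneg _)]

theorem l2Norm_add_le (hu : MemLp u 2 μ) (hv : MemLp v 2 μ) :
    l2Norm μ (u + v) ≤ l2Norm μ u + l2Norm μ v := by
  rw [l2Norm, l2Norm, l2Norm, ← ENNReal.toReal_add hu.2.ne hv.2.ne]
  exact ENNReal.toReal_mono (ENNReal.add_ne_top.2 ⟨hu.2.ne, hv.2.ne⟩)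
    (eLpNorm_add_le hu.1 hv.1 (by norm_num))

theorem l2Norm_congr_ae (h : u =ᵐ[μ] v) : l2Norm μ u = l2Norm μ v := by
  rw [l2Norm, l2Norm, eLpNorm_congr_ae h]

/-- The factor `2` is not sharp, but it spares Minkowski's inequality for the combined norm and is
absorbed in the interpolation constant at the end. -/
theorem MemH1.h1Norm_add_le (hΩ : IsOpen Ω) (hu : MemH1 Ω u) (hv : MemH1 Ω v) :
    h1Norm Ω (u + v) ≤ 2 * (h1Norm Ω u + h1Norm Ω v) := by
  have key : ∀ a b c : ℝ, 0 ≤ a → a ≤ b + c → a ^ 2 ≤ 2 * b ^ 2 + 2 * c ^ 2 := fun a b c ha h => by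
    nlinarith [sq_nonneg (b - c)]
  have h0 := key _ _ _ (l2Norm_nonneg _ _) (l2Norm_add_le hu.1 hv.1)
  have h1 : ∀ i, l2Norm (volume.restrict Ω) (weakPartial Ω i (u + v)) ^ 2 ≤
      2 * l2Norm (volume.restrict Ω) (weakPartial Ω i u) ^ 2 +
        2 * l2Norm (volume.restrict Ω) (weakPartial Ω i v) ^ 2 := fun i => by
    refine key _ _ _ (l2Norm_nonneg _ _) ?_
    rw [l2Norm_congr_ae (hu.weakPartial_add hΩ hv i)]
    exact l2Norm_add_le (hu.memLp_weakPartial i) (hv.memLp_weakPartial i)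
  have h2 := h1Norm_sq Ω (u + v)
  have h3 := h1Norm_sq Ω u
  have h4 := h1Norm_sq Ω v
  rw [gradNorm_sq, Fin.sum_univ_two] at h2 h3 h4
  have := h1Norm_nonneg Ω u
  have := h1Norm_nonneg Ω v
  refine abs_le_of_sq_le_sq' ?_ (by positivity) |>.2
  nlinarith [h1 0, h1 1, mul_nonneg (h1Norm_nonneg Ω u) (h1Norm_nonneg Ω v)]

end Norms

/-! ### Traces -/

section Traces

variable {𝕜 : Type*} [RCLike 𝕜] {Ω S : Set Plane} {u v w w' : Plane → 𝕜}
  {φ φ' : ℕ → Plane → 𝕜}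

/-- Convergence of smooth functions in `H¹(Ω)`. -/
structure IsSmoothApprox (Ω : Set Plane) (v : Plane → 𝕜) (φ : ℕ → Plane → 𝕜) : Prop where
  smooth : ∀ n, ContDiff ℝ ∞ (φ n)
  tendsto : Tendsto (fun n => eLpNorm (φ n - v) 2 (volume.restrict Ω)) atTop (𝓝 0)
  tendsto_partial : ∀ i, Tendsto (fun n =>
    eLpNorm (classicalPartial (φ n) i - weakPartial Ω i v) 2 (volume.restrict Ω)) atTop (𝓝 0)

/-- A norm of `H¹(Ω)` for smooth functions. -/
def smoothNorm (Ω : Set Plane) (g : Plane → 𝕜) : ℝ≥0∞ :=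
  eLpNorm g 2 (volume.restrict Ω) +
    ∑ i, eLpNorm (classicalPartial g i) 2 (volume.restrict Ω)

/-- A trace inequality for smooth functions on the set `S`. -/
def TraceBound (𝕜 : Type*) [RCLike 𝕜] (Ω S : Set Plane) : Prop :=
  ∃ T : ℝ≥0∞, T ≠ ⊤ ∧ ∀ g : Plane → 𝕜, ContDiff ℝ ∞ g →
    eLpNorm g 2 ((μH[1] : Measure Plane).restrict S) ≤ T * smoothNorm Ω g

theorem HasTraceOn.exists_approx (h : HasTraceOn Ω S v w) : ∃ φ, IsSmoothApprox Ω v φ ∧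
    Tendsto (fun n => eLpNorm (φ n - w) 2 ((μH[1] : Measure Plane).restrict S)) atTop (𝓝 0) := by
  obtain ⟨-, -, φ, h1, h2, h3, h4⟩ := h
  exact ⟨φ, ⟨h1, h2, h3⟩, h4⟩

theorem IsSmoothApprox.hasTraceOn (hφ : IsSmoothApprox Ω v φ) (hv : MemH1 Ω v)
    (hw : MemLp w 2 ((μH[1] : Measure Plane).restrict S))
    (h : Tendsto (fun n => eLpNorm (φ n - w) 2 ((μH[1] : Measure Plane).restrict S)) atTop
      (𝓝 0)) : HasTraceOn Ω S v w :=
  ⟨hv, hw, φ, hφ.smooth, hφ.tendsto, hφ.tendsto_partial, h⟩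

theorem classicalPartial_sub {f g : Plane → 𝕜} (hf : ContDiff ℝ ∞ f) (hg : ContDiff ℝ ∞ g)
    (i : Fin 2) : classicalPartial (f - g) i = classicalPartial f i - classicalPartial g i := by
  ext x
  simp only [classicalPartial, Pi.sub_apply]
  rw [fderiv_sub (hf.differentiable (by simp) x) (hg.differentiable (by simp) x)]
  rfl

theorem smoothNorm_sq_ge {g : Plane → 𝕜} (hg : ContDiff ℝ ∞ g) :
    (∫⁻ x in Ω, ‖g x‖ₑ ^ 2) + ∫⁻ x in Ω, gradSum (classicalPartial g) x ^ 2 ≤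
      2 * smoothNorm Ω g ^ 2 := by
  have h1 := lintegral_gradSum_sq_le (classicalPartial g) (volume.restrict Ω)
    (continuous_classicalPartial hg 0).aestronglyMeasurable
  simp only [Fin.sum_univ_two, ← eLpNorm_two_sq] at h1 ⊢
  rw [smoothNorm, Fin.sum_univ_two]
  set a := eLpNorm g 2 (volume.restrict Ω)
  set b := eLpNorm (classicalPartial g 0) 2 (volume.restrict Ω)
  set c := eLpNorm (classicalPartial g 1) 2 (volume.restrict Ω)
  calc _ ≤ a ^ 2 + 2 * (b ^ 2 + c ^ 2) := by gcongr
    _ ≤ 2 * (a ^ 2 + b ^ 2 + c ^ 2) := by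
      have e : 2 * (a ^ 2 + b ^ 2 + c ^ 2) = 2 * a ^ 2 + 2 * (b ^ 2 + c ^ 2) := by ring
      rw [e]
      exact add_le_add (le_mul_of_one_le_left zero_le (by norm_num)) le_rfl
    _ ≤ 2 * (a + (b + c)) ^ 2 := by
      gcongr
      have : (a + (b + c)) ^ 2 = a ^ 2 + b ^ 2 + c ^ 2 + (2 * a * b + 2 * a * c + 2 * b * c) := by
        ring
      rw [this]
      exact le_self_add

theorem traceBound_of_lintegral {T : ℝ≥0∞} (hT : T ≠ ⊤)
    (h : ∀ g : Plane → 𝕜, ContDiff ℝ ∞ g → ∫⁻ x in S, ‖g x‖ₑ ^ 2 ∂(μH[1] : Measure Plane) ≤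
      T * ((∫⁻ x in Ω, ‖g x‖ₑ ^ 2) + ∫⁻ x in Ω, gradSum (classicalPartial g) x ^ 2)) :
    TraceBound 𝕜 Ω S := by
  -- Any bound for `√(2T)` will do; `1 + 2T` avoids the square root.
  refine ⟨1 + T * 2, by finiteness, fun g hg => ?_⟩
  have h1 : eLpNorm g 2 ((μH[1] : Measure Plane).restrict S) ^ 2 ≤
      ((1 + T * 2) * smoothNorm Ω g) ^ 2 := by
    calc _ ≤ T * (2 * smoothNorm Ω g ^ 2) := by
          rw [eLpNorm_two_sq]
          exact (h g hg).trans (by gcongr; exact smoothNorm_sq_ge hg)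
      _ = (T * 2) * smoothNorm Ω g ^ 2 := by ring
      _ ≤ (1 + T * 2) ^ 2 * smoothNorm Ω g ^ 2 := by
          gcongr
          calc T * 2 ≤ 1 + T * 2 := le_add_self
            _ ≤ (1 + T * 2) ^ 2 := le_self_pow (by simp) (by norm_num)
      _ = _ := by ring
  exact (ENNReal.pow_le_pow_left_iff (by norm_num)).1 h1

theorem traceBound_frontier (hΩ : IsPolygonalDomain Ω) (hS : S ⊆ frontier Ω) :
    TraceBound 𝕜 Ω S := by
  obtain ⟨T, -, hT⟩ := hΩ.exists_trace_constant 𝕜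
  refine traceBound_of_lintegral (T := ENNReal.ofReal T) (by simp) fun g hg => ?_
  exact (lintegral_mono_set hS).trans
    (hT g _ (isUpperGradPair_of_contDiff hΩ.isBounded hg))

/-- Edges may run through the interior of `Ω`, so the boundary trace inequality does not apply. The
constant depends on the cell, which is harmless: it serves only existence, uniqueness and
convergence of traces. -/
theorem traceBound_edge (hΩ : IsPolygonalDomain Ω) {𝒯 : Triangulation Ω} {K : Finset Plane}
    (hK : K ∈ 𝒯.cells) {p q : Plane} (hp : p ∈ K) (hq : q ∈ K) (hpq : p ≠ q) :
    TraceBound 𝕜 Ω (segment ℝ p q) := by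
  obtain ⟨κ, hκ⟩ := 𝒯.exists_shape_constant
  have hκ0 := IsUpperGradPair.shape_nonneg hK (hκ K hK)
  set V := volume.real (convexHull ℝ (K : Set Plane)) with hV
  have hVpos : 0 < V := IsUpperGradPair.volume_real_pos hK
  refine traceBound_of_lintegral (T := ‖q - p‖ₑ * ENNReal.ofReal (8 / V + 8 * κ))
    (by finiteness) fun g hg => ?_
  have h := isUpperGradPair_of_contDiff hΩ.isBounded hg
  have hM : 0 ≤ cellMass g K := ENNReal.toReal_nonneg
  have hE := cellEnergy_nonneg (gradSum (classicalPartial g)) K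
  rw [lintegral_enorm_sq_segment, mul_assoc]
  gcongr
  calc _ ≤ _ := h.edgeMass_le hK (hκ K hK) hp hq hpq
    _ ≤ ENNReal.ofReal ((8 / V + 8 * κ) *
          (cellMass g K + cellEnergy (gradSum (classicalPartial g)) K)) := by
        apply ENNReal.ofReal_le_ofReal
        have e1 : 0 ≤ 8 / V * cellEnergy (gradSum (classicalPartial g)) K := by positivity
        have e2 : 0 ≤ 8 * κ * cellMass g K := by positivity
        linarith
    _ = ENNReal.ofReal (8 / V + 8 * κ) * ((∫⁻ x in convexHull ℝ (K : Set Plane), ‖g x‖ₑ ^ 2) +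
          ∫⁻ x in convexHull ℝ (K : Set Plane), gradSum (classicalPartial g) x ^ 2) := by
        rw [h.lintegral_eq_cellMass hK, h.lintegral_eq_cellEnergy hK, ← ENNReal.ofReal_add hM hE,
          ENNReal.ofReal_mul (by positivity)]
    _ ≤ _ := by
        exact mul_le_mul' le_rfl
          (add_le_add (hΩ.lintegral_hull_le hK _) (hΩ.lintegral_hull_le hK _))

theorem smoothNorm_ne_top (hΩ : IsPolygonalDomain Ω) {g : Plane → 𝕜} (hg : ContDiff ℝ ∞ g) :
    smoothNorm Ω g ≠ ⊤ := by
  have key : ∀ f : Plane → 𝕜, Continuous f → eLpNorm f 2 (volume.restrict Ω) ≠ ⊤ := fun f hf => by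
    have h1 : ∫⁻ x in Ω, ‖f x‖ₑ ^ 2 ≠ ⊤ := by
      rw [← hΩ.restrict_closure]
      exact hf.continuousOn.lintegral_enorm_sq_ne_top hΩ.isBounded.isCompact_closure
    rw [← eLpNorm_two_sq] at h1
    exact fun h => h1 (by rw [h]; simp)
  exact ENNReal.add_ne_top.2 ⟨key g hg.continuous, ENNReal.sum_ne_top.2 fun i _ =>
    key _ (continuous_classicalPartial hg i)⟩

/-- The distance in `H¹(Ω)` of a smooth function to a function of `H¹(Ω)`. -/
def approxError (Ω : Set Plane) (v g : Plane → 𝕜) : ℝ≥0∞ :=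
  eLpNorm (g - v) 2 (volume.restrict Ω) +
    ∑ i, eLpNorm (classicalPartial g i - weakPartial Ω i v) 2 (volume.restrict Ω)

theorem IsSmoothApprox.tendsto_approxError (hφ : IsSmoothApprox Ω v φ) :
    Tendsto (fun n => approxError Ω v (φ n)) atTop (𝓝 0) := by
  have := hφ.tendsto.add (tendsto_finsetSum Finset.univ fun i _ => hφ.tendsto_partial i)
  simpa [approxError] using this

theorem smoothNorm_sub_le (hv : MemH1 Ω v) {f g : Plane → 𝕜} (hf : ContDiff ℝ ∞ f)
    (hg : ContDiff ℝ ∞ g) :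
    smoothNorm Ω (f - g) ≤ approxError Ω v f + approxError Ω v g := by
  have key : ∀ a b c : Plane → 𝕜, AEStronglyMeasurable a (volume.restrict Ω) →
      AEStronglyMeasurable b (volume.restrict Ω) → AEStronglyMeasurable c (volume.restrict Ω) →
      eLpNorm (a - b) 2 (volume.restrict Ω) ≤
        eLpNorm (a - c) 2 (volume.restrict Ω) + eLpNorm (b - c) 2 (volume.restrict Ω) := by
    intro a b c ha hb hc
    rw [← sub_sub_sub_cancel_right a b c]
    exact eLpNorm_sub_le (ha.sub hc) (hb.sub hc) (by norm_num)
  rw [smoothNorm, approxError, approxError, add_add_add_comm, ← Finset.sum_add_distrib]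
  gcongr with i
  · exact key _ _ _ hf.continuous.aestronglyMeasurable hg.continuous.aestronglyMeasurable hv.1.1
  · rw [classicalPartial_sub hf hg]
    exact key _ _ _ (continuous_classicalPartial hf i).aestronglyMeasurable
      (continuous_classicalPartial hg i).aestronglyMeasurable (hv.memLp_weakPartial i).1

/-- The trace is the limit of the restrictions of every approximating sequence. -/
theorem HasTraceOn.tendsto (h : HasTraceOn Ω S v w) (hS : TraceBound 𝕜 Ω S)
    (hφ : IsSmoothApprox Ω v φ) :
    Tendsto (fun n => eLpNorm (φ n - w) 2 ((μH[1] : Measure Plane).restrict S)) atTop (𝓝 0) := by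
  obtain ⟨φ', hφ', hw⟩ := h.exists_approx
  obtain ⟨T, hT, hTb⟩ := hS
  have hlim : Tendsto (fun n => T * (approxError Ω v (φ n) + approxError Ω v (φ' n)) +
      eLpNorm (φ' n - w) 2 ((μH[1] : Measure Plane).restrict S)) atTop (𝓝 0) := by
    have h1 := (ENNReal.Tendsto.const_mul
      (hφ.tendsto_approxError.add hφ'.tendsto_approxError) (Or.inr hT)).add hw
    simpa using h1
  refine tendsto_of_tendsto_of_tendsto_of_le_of_le tendsto_const_nhds hlim
    (fun _ => zero_le) fun n => ?_
  calc eLpNorm (φ n - w) 2 ((μH[1] : Measure Plane).restrict S)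
      ≤ eLpNorm (φ n - φ' n) 2 ((μH[1] : Measure Plane).restrict S) +
          eLpNorm (φ' n - w) 2 ((μH[1] : Measure Plane).restrict S) := by
        rw [← sub_add_sub_cancel (φ n) (φ' n) w]
        exact eLpNorm_add_le ((hφ.smooth n).continuous.aestronglyMeasurable.sub
          (hφ'.smooth n).continuous.aestronglyMeasurable)
          ((hφ'.smooth n).continuous.aestronglyMeasurable.sub h.2.1.1) (by norm_num)
    _ ≤ _ := by
        gcongr
        refine (hTb _ ((hφ.smooth n).sub (hφ'.smooth n))).trans ?_
        gcongr
        exact smoothNorm_sub_le h.1 (hφ.smooth n) (hφ'.smooth n)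

/-- By the trace inequality the smooth approximations that converge to `w` on `S` converge to `w'`
as well. -/
theorem HasTraceOn.ae_eq (h : HasTraceOn Ω S v w) (h' : HasTraceOn Ω S v w')
    (hS : TraceBound 𝕜 Ω S) : w =ᵐ[(μH[1] : Measure Plane).restrict S] w' := by
  obtain ⟨φ, hφ, hw⟩ := h.exists_approx
  have hw' := h'.tendsto hS hφ
  have h0 : eLpNorm (w - w') 2 ((μH[1] : Measure Plane).restrict S) = 0 := by
    have hlim := hw'.add hw
    rw [add_zero] at hlim
    refine le_antisymm (ge_of_tendsto' hlim fun n => ?_) zero_le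
    have := eLpNorm_sub_le (p := 2)
      ((hφ.smooth n).continuous.aestronglyMeasurable.sub h'.2.1.1)
      ((hφ.smooth n).continuous.aestronglyMeasurable.sub h.2.1.1) (by norm_num)
    rwa [sub_sub_sub_cancel_left] at this
  rw [eLpNorm_eq_zero_iff (h.2.1.1.sub h'.2.1.1) (by norm_num)] at h0
  filter_upwards [h0] with x hx
  exact sub_eq_zero.1 hx

theorem HasTraceOn.mono {S' : Set Plane} (h : HasTraceOn Ω S v w) (hS : S' ⊆ S) :
    HasTraceOn Ω S' v w := by
  obtain ⟨φ, hφ, hw⟩ := h.exists_approx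
  have hle := Measure.restrict_mono hS (le_refl (μH[1] : Measure Plane))
  exact hφ.hasTraceOn h.1 (h.2.1.mono_measure hle)
    (tendsto_of_tendsto_of_tendsto_of_le_of_le tendsto_const_nhds hw (fun _ => zero_le)
      fun n => eLpNorm_mono_measure _ hle)

/-- Traces exist wherever there is a trace inequality. -/
theorem IsSmoothApprox.exists_trace (hΩ : IsPolygonalDomain Ω) (hφ : IsSmoothApprox Ω v φ)
    (hv : MemH1 Ω v) (hS : TraceBound 𝕜 Ω S) : ∃ w, HasTraceOn Ω S v w := by
  obtain ⟨T, hT, hTb⟩ := hS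
  have hmem : ∀ n, MemLp (φ n) 2 ((μH[1] : Measure Plane).restrict S) := fun n =>
    ⟨(hφ.smooth n).continuous.aestronglyMeasurable, (hTb _ (hφ.smooth n)).trans_lt
      (ENNReal.mul_lt_top hT.lt_top (smoothNorm_ne_top hΩ (hφ.smooth n)).lt_top)⟩
  have hlim : Tendsto (fun n => T * approxError Ω v (φ n)) atTop (𝓝 0) := by
    have := ENNReal.Tendsto.const_mul (a := T) hφ.tendsto_approxError (Or.inr hT)
    simpa using this
  -- The trace inequality applied to differences carries the Cauchy property from `H¹(Ω)` to
  -- `L²(S)`; the trace is the limit there.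
  have hcau : CauchySeq fun n => (hmem n).toLp (φ n) := by
    rw [EMetric.cauchySeq_iff]
    intro ε hε
    have hev := (tendsto_order.1 hlim).2 (ε / 2) (ENNReal.half_pos hε.ne')
    obtain ⟨N, hN⟩ := eventually_atTop.1 hev
    refine ⟨N, fun m hm n hn => ?_⟩
    rw [Lp.edist_toLp_toLp]
    calc _ ≤ T * smoothNorm Ω (φ m - φ n) := hTb _ ((hφ.smooth m).sub (hφ.smooth n))
      _ ≤ T * (approxError Ω v (φ m) + approxError Ω v (φ n)) := by
        gcongr
        exact smoothNorm_sub_le hv (hφ.smooth m) (hφ.smooth n)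
      _ = T * approxError Ω v (φ m) + T * approxError Ω v (φ n) := mul_add _ _ _
      _ < ε / 2 + ε / 2 := ENNReal.add_lt_add (hN m hm) (hN n hn)
      _ = ε := ENNReal.add_halves ε
  obtain ⟨w, hw⟩ := cauchySeq_tendsto_of_complete hcau
  refine ⟨w, hφ.hasTraceOn hv (Lp.memLp w) ?_⟩
  have h1 := (Lp.tendsto_Lp_iff_tendsto_eLpNorm' _ _).1 hw
  refine h1.congr fun n => eLpNorm_congr_ae ?_
  exact (hmem n).coeFn_toLp.sub (EventuallyEq.refl _ _)

theorem hasTraceOn_traceOn (h : ∃ w, HasTraceOn Ω S v w) : HasTraceOn Ω S v (traceOn Ω S v) := by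
  rw [traceOn, dif_pos h]
  exact h.choose_spec

theorem ae_edge_of_ae {P : Plane → Prop} {p q : Plane} (hpq : p ≠ q)
    (h : ∀ᵐ x ∂(μH[1] : Measure Plane).restrict (segment ℝ p q), P x) :
    ∀ᵐ t ∂(volume : Measure ℝ).restrict (Icc 0 1), P (AffineMap.lineMap p q t) := by
  have hc : ‖q - p‖ₑ ≠ 0 := by simpa [sub_eq_zero] using hpq.symm
  rw [restrict_segment_eq, Measure.ae_ennreal_smul_measure_iff hc] at h
  exact ae_of_ae_map AffineMap.lineMap_continuous.measurable.aemeasurable h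

theorem aestronglyMeasurable_edge {p q : Plane} (hpq : p ≠ q)
    (hw : AEStronglyMeasurable w ((μH[1] : Measure Plane).restrict (segment ℝ p q))) :
    AEStronglyMeasurable (fun t : ℝ => w (AffineMap.lineMap p q t))
      (volume.restrict (Icc 0 1)) :=
  ⟨fun t => hw.mk w (AffineMap.lineMap p q t),
    hw.stronglyMeasurable_mk.comp_measurable AffineMap.lineMap_continuous.measurable,
    ae_edge_of_ae hpq hw.ae_eq_mk⟩

theorem edgeMass_eq {p q : Plane} (hpq : p ≠ q) (f : Plane → 𝕜) : edgeMass f p q =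
    ‖q - p‖ₑ⁻¹ * eLpNorm f 2 ((μH[1] : Measure Plane).restrict (segment ℝ p q)) ^ 2 := by
  have hc : ‖q - p‖ₑ ≠ 0 := by simpa [sub_eq_zero] using hpq.symm
  rw [eLpNorm_two_sq, lintegral_enorm_sq_segment, ← mul_assoc,
    ENNReal.inv_mul_cancel hc (by simp), one_mul]

theorem tendsto_szMean {p q : Plane} (hpq : p ≠ q) (hφ : ∀ n, Continuous (φ n))
    (hw : MemLp w 2 ((μH[1] : Measure Plane).restrict (segment ℝ p q)))
    (h : Tendsto (fun n => eLpNorm (φ n - w) 2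
      ((μH[1] : Measure Plane).restrict (segment ℝ p q))) atTop (𝓝 0)) :
    Tendsto (fun n => szMean (φ n) p q) atTop (𝓝 (szMean w p q)) := by
  have hc : ‖q - p‖ₑ ≠ 0 := by simpa [sub_eq_zero] using hpq.symm
  have hwm := aestronglyMeasurable_edge hpq hw.1
  have hwi := intervalIntegrable_sz hwm (by
    rw [edgeMass_eq hpq]
    exact ENNReal.mul_ne_top (by simpa using hc) (by simpa using hw.2.ne))
  have hφi : ∀ n, IntervalIntegrable (fun t : ℝ => ((4 : ℝ) - 6 * t) •
      φ n (AffineMap.lineMap p q t)) volume 0 1 := fun n => by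
    apply Continuous.intervalIntegrable
    have := (hφ n).comp
      (AffineMap.lineMap_continuous : Continuous (AffineMap.lineMap p q : ℝ → Plane))
    have h2 : Continuous fun t : ℝ => (4 : ℝ) - 6 * t := by fun_prop
    exact h2.smul this
  rw [tendsto_iff_edist_tendsto_0]
  have hlim : Tendsto (fun n => 16 * (‖q - p‖ₑ⁻¹ * eLpNorm (φ n - w) 2
      ((μH[1] : Measure Plane).restrict (segment ℝ p q)) ^ 2)) atTop (𝓝 0) := by
    have h1 := ENNReal.Tendsto.const_mul (a := 16) (ENNReal.Tendsto.const_mul (a := ‖q - p‖ₑ⁻¹)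
      (ENNReal.Tendsto.pow (n := 2) h) (Or.inr (by simpa using hc))) (Or.inr (by norm_num))
    simpa using h1
  have hsq : Tendsto (fun n => edist (szMean (φ n) p q) (szMean w p q) ^ 2) atTop (𝓝 0) := by
    refine tendsto_of_tendsto_of_tendsto_of_le_of_le tendsto_const_nhds hlim
      (fun _ => zero_le) fun n => ?_
    simp only
    rw [edist_eq_enorm_sub, ← szMean_sub (hφi n) hwi, ← edgeMass_eq hpq]
    refine enorm_szMean_sq_le _ p q (AEStronglyMeasurable.enorm ?_)
    exact ((hφ n).comp (AffineMap.lineMap_continuous :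
      Continuous (AffineMap.lineMap p q : ℝ → Plane))).aestronglyMeasurable.sub hwm
  have hrt := hsq.ennrpow_const (1 / 2)
  rw [ENNReal.zero_rpow_of_pos (by norm_num)] at hrt
  refine hrt.congr fun n => ?_
  rw [← ENNReal.rpow_natCast, ← ENNReal.rpow_mul]
  norm_num

end Traces

/-! ### Stability of the Scott-Zhang operator -/

namespace Triangulation

variable {Ω : Set Plane} {𝒯 : Triangulation Ω} {𝕜 : Type*} [RCLike 𝕜] {u : Plane → 𝕜}
  {K : Finset Plane} {σ τ : ℝ}

theorem nodalInterp_mem (𝒯 : Triangulation Ω) (c : Plane → 𝕜) : 𝒯.nodalInterp c ∈ 𝒯.P1 𝕜 :=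
  (𝒯.exists_nodal c).choose_spec.1

theorem nodalInterp_apply (c : Plane → 𝕜) {a : Plane} (ha : a ∈ 𝒯.vertices) :
    𝒯.nodalInterp c a = c a :=
  (𝒯.exists_nodal c).choose_spec.2 a ha

theorem nodalEnergy_congr {c c' : Plane → 𝕜} (γ : ℝ) (h : ∀ a ∈ 𝒯.vertices, c a = c' a) :
    𝒯.nodalEnergy γ c = 𝒯.nodalEnergy γ c' := by
  have h' : ∀ K ∈ 𝒯.cells, ∀ a ∈ K, c a = c' a := fun K hK a ha => h a ⟨K, hK, ha⟩
  refine Finset.sum_congr rfl fun K hK => ?_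
  congr 2
  · exact Finset.sum_congr rfl fun a ha => by rw [h' K hK a ha]
  · exact Finset.sum_congr rfl fun a ha => Finset.sum_congr rfl fun b hb => by
      rw [h' K hK a ha, h' K hK b hb]

/-- Values of a piecewise affine function on a cell are convex combinations of nodal values. -/
theorem norm_sub_le_of_nodal (hu : u ∈ 𝒯.P1 𝕜) (hK : K ∈ 𝒯.cells) {c : 𝕜} {r : ℝ}
    (h : ∀ a ∈ K, ‖u a - c‖ ≤ r) {x : Plane} (hx : x ∈ convexHull ℝ (K : Set Plane)) :
    ‖u x - c‖ ≤ r := by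
  have hA := eqOn_affinePart hu hK
  have hconv : Convex ℝ (affinePart u K ⁻¹' closedBall c r) :=
    (convex_closedBall c r).affine_preimage _
  have hsub : (K : Set Plane) ⊆ affinePart u K ⁻¹' closedBall c r := fun a ha => by
    rw [mem_preimage, mem_closedBall_iff_norm, ← hA (subset_convexHull ℝ _ ha)]
    exact h a ha
  have := convexHull_min hsub hconv hx
  rwa [mem_preimage, mem_closedBall_iff_norm, ← hA hx] at this

theorem norm_sq_le_nodal (hu : u ∈ 𝒯.P1 𝕜) (hK : K ∈ 𝒯.cells) {x : Plane}
    (hx : x ∈ convexHull ℝ (K : Set Plane)) : ‖u x‖ ^ 2 ≤ ∑ a ∈ K, ‖u a‖ ^ 2 := by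
  have h0 : 0 ≤ ∑ a ∈ K, ‖u a‖ ^ 2 := Finset.sum_nonneg fun _ _ => sq_nonneg _
  have h := norm_sub_le_of_nodal hu hK (c := 0) (r := √(∑ a ∈ K, ‖u a‖ ^ 2)) (fun a ha => by
    rw [sub_zero]
    exact Real.le_sqrt_of_sq_le (Finset.single_le_sum (f := fun a => ‖u a‖ ^ 2)
      (fun _ _ => sq_nonneg _) ha)) hx
  rw [sub_zero] at h
  exact (Real.le_sqrt (norm_nonneg _) h0).1 h

/-- A step of length `r/2` from the centre of the inscribed disc stays in the cell and changes `u`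
by `r/2` times the derivative, while the oscillation is at most twice the largest nodal difference.
-/
theorem norm_cellPartial_sq_le (hu : u ∈ 𝒯.P1 𝕜) (hK : K ∈ 𝒯.cells) {r : ℝ} (hr : 0 < r)
    {x : Plane} (hx : ball x r ⊆ convexHull ℝ (K : Set Plane)) (i : Fin 2) :
    r ^ 2 * ‖cellPartial u K i‖ ^ 2 ≤ 16 * ∑ a ∈ K, ∑ b ∈ K, ‖u a - u b‖ ^ 2 := by
  set Q := ∑ a ∈ K, ∑ b ∈ K, ‖u a - u b‖ ^ 2 with hQ
  have hQ0 : 0 ≤ Q := Finset.sum_nonneg fun _ _ => Finset.sum_nonneg fun _ _ => sq_nonneg _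
  have hab : ∀ b ∈ K, ∀ a ∈ K, ‖u a - u b‖ ≤ √Q := fun b hb a ha =>
    Real.le_sqrt_of_sq_le ((Finset.single_le_sum (f := fun b => ‖u a - u b‖ ^ 2)
      (fun _ _ => sq_nonneg _) hb).trans (Finset.single_le_sum
        (f := fun a => ∑ b ∈ K, ‖u a - u b‖ ^ 2)
        (fun _ _ => Finset.sum_nonneg fun _ _ => sq_nonneg _) ha))
  obtain ⟨b, hb, -⟩ := exists_triple hK
  have hosc : ∀ y ∈ convexHull ℝ (K : Set Plane), ‖u y - u b‖ ≤ √Q := fun y hy =>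
    norm_sub_le_of_nodal hu hK (hab b hb) hy
  have hx0 : x ∈ convexHull ℝ (K : Set Plane) := hx (mem_ball_self hr)
  have hy0 : x + (r / 2) • unitVec i ∈ convexHull ℝ (K : Set Plane) := by
    apply hx
    rw [mem_ball_iff_norm, add_sub_cancel_left, norm_smul, norm_unitVec, mul_one,
      Real.norm_of_nonneg (by positivity)]
    linarith
  have h1 := sub_eq_linear hu hK hx0 hy0
  rw [add_sub_cancel_left, map_smul] at h1
  have h2 : r / 2 * ‖cellPartial u K i‖ ≤ 2 * √Q := by
    calc r / 2 * ‖cellPartial u K i‖ = ‖u (x + (r / 2) • unitVec i) - u x‖ := by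
          rw [h1, norm_smul, Real.norm_of_nonneg (by positivity)]
          rfl
      _ ≤ ‖u (x + (r / 2) • unitVec i) - u b‖ + ‖u b - u x‖ :=
          norm_sub_le_norm_sub_add_norm_sub _ _ _
      _ ≤ √Q + √Q := by
          gcongr
          · exact hosc _ hy0
          · rw [norm_sub_rev]
            exact hosc _ hx0
      _ = 2 * √Q := by ring
  have h3 := pow_le_pow_left₀ (by positivity) h2 2
  rw [mul_pow 2, Real.sq_sqrt hQ0] at h3
  nlinarith

/-- In two dimensions the area and the squared inverse radius of the inscribed disc cancel, so the
gradient term has a weight without `h`; `32` is `16` for each of the two derivatives. -/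
theorem h1Norm_sq_le_nodalEnergy (hΩ : IsPolygonalDomain Ω) (h : 𝒯.IsRegular σ τ)
    (hu : u ∈ 𝒯.P1 𝕜) : h1Norm Ω u ^ 2 ≤ 𝒯.nodalEnergy (32 * discArea / σ ^ 2) u := by
  have hσ := h.σ_pos
  have hA := discArea_pos
  have hnn : ∀ K : Finset Plane,
      0 ≤ volume.real (convexHull ℝ (K : Set Plane)) * (∑ a ∈ K, ‖u a‖ ^ 2) +
      32 * discArea / σ ^ 2 * ∑ a ∈ K, ∑ b ∈ K, ‖u a - u b‖ ^ 2 := fun K => by positivity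
  rw [nodalEnergy, ← ENNReal.ofReal_le_ofReal_iff (Finset.sum_nonneg fun K _ => hnn K),
    ← (memH1_P1 hΩ.isOpen hΩ.isBounded hu).lintegral_add_sum,
    ENNReal.ofReal_sum_of_nonneg fun K _ => hnn K, Fin.sum_univ_two]
  have hw : ∀ i, ∫⁻ x in Ω, ‖weakPartial Ω i u x‖ₑ ^ 2 =
      ∑ K ∈ 𝒯.cells, ∫⁻ x in convexHull ℝ (K : Set Plane), ‖𝒯.piecewisePartial u i x‖ₑ ^ 2 := by
    intro i
    rw [sum_lintegral_hull, hΩ.restrict_closure]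
    refine lintegral_congr_ae ?_
    filter_upwards [weakPartial_P1 hΩ.isOpen hΩ.isBounded hu i] with x hx
    rw [hx]
  rw [hw, hw, ← hΩ.restrict_closure, ← sum_lintegral_hull, ← Finset.sum_add_distrib,
    ← Finset.sum_add_distrib]
  refine Finset.sum_le_sum fun K hK => ?_
  have hV := IsUpperGradPair.volume_real_pos hK
  have hpart : ∀ i, ∫⁻ x in convexHull ℝ (K : Set Plane), ‖𝒯.piecewisePartial u i x‖ₑ ^ 2 ≤
      ENNReal.ofReal (16 * discArea / σ ^ 2 * ∑ a ∈ K, ∑ b ∈ K, ‖u a - u b‖ ^ 2) := by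
    intro i
    obtain ⟨x, hx⟩ := h.shape K hK
    have hd := diam_pos hK
    have h1 := norm_cellPartial_sq_le hu hK (by positivity) hx i
    have h2 : ∫⁻ x in convexHull ℝ (K : Set Plane), ‖𝒯.piecewisePartial u i x‖ₑ ^ 2 =
        ∫⁻ _ in convexHull ℝ (K : Set Plane), ‖cellPartial u K i‖ₑ ^ 2 := by
      refine lintegral_congr_ae ?_
      filter_upwards [ae_mem_interior hK] with y hy
      rw [piecewisePartial_eq hK (interior_subset hy.1) hy.2]
    rw [h2, setLIntegral_const, IsUpperGradPair.volume_hull_eq, ← ofReal_norm,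
      ← ENNReal.ofReal_pow (norm_nonneg _), ← ENNReal.ofReal_mul (sq_nonneg _)]
    apply ENNReal.ofReal_le_ofReal
    calc ‖cellPartial u K i‖ ^ 2 * volume.real (convexHull ℝ (K : Set Plane))
        ≤ ‖cellPartial u K i‖ ^ 2 * (diam (K : Set Plane) ^ 2 * discArea) := by
          gcongr
          exact IsRegular.volume_le hK
      _ = discArea / σ ^ 2 * ((σ * diam (K : Set Plane)) ^ 2 * ‖cellPartial u K i‖ ^ 2) := by
          field_simp
      _ ≤ discArea / σ ^ 2 * (16 * ∑ a ∈ K, ∑ b ∈ K, ‖u a - u b‖ ^ 2) := by gcongr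
      _ = _ := by ring
  have hmass : ∫⁻ x in convexHull ℝ (K : Set Plane), ‖u x‖ₑ ^ 2 ≤
      ENNReal.ofReal (volume.real (convexHull ℝ (K : Set Plane)) * ∑ a ∈ K, ‖u a‖ ^ 2) := by
    calc _ ≤ ∫⁻ _ in convexHull ℝ (K : Set Plane), ENNReal.ofReal (∑ a ∈ K, ‖u a‖ ^ 2) := by
          refine setLIntegral_mono' (measurableSet_hull K) fun x hx => ?_
          rw [← ofReal_norm, ← ENNReal.ofReal_pow (norm_nonneg _)]
          exact ENNReal.ofReal_le_ofReal (norm_sq_le_nodal hu hK hx)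
      _ = _ := by
          rw [setLIntegral_const, IsUpperGradPair.volume_hull_eq, mul_comm,
            ← ENNReal.ofReal_mul hV.le]
  calc _ ≤ _ := add_le_add hmass (add_le_add (hpart 0) (hpart 1))
    _ = _ := by
      rw [← ENNReal.ofReal_add (by positivity) (by positivity),
        ← ENNReal.ofReal_add (by positivity) (by positivity)]
      congr 1
      ring

theorem tendsto_nodalEnergy {c : ℕ → Plane → 𝕜} {c' : Plane → 𝕜} (γ : ℝ)
    (h : ∀ a ∈ 𝒯.vertices, Tendsto (fun n => c n a) atTop (𝓝 (c' a))) :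
    Tendsto (fun n => 𝒯.nodalEnergy γ (c n)) atTop (𝓝 (𝒯.nodalEnergy γ c')) := by
  have h' : ∀ K ∈ 𝒯.cells, ∀ a ∈ K, Tendsto (fun n => c n a) atTop (𝓝 (c' a)) :=
    fun K hK a ha => h a ⟨K, hK, ha⟩
  refine tendsto_finsetSum _ fun K hK => Tendsto.add ?_ ?_
  · exact (tendsto_finsetSum _ fun a ha => (h' K hK a ha).norm.pow 2).const_mul _
  · exact (tendsto_finsetSum _ fun a ha => tendsto_finsetSum _ fun b hb =>
      ((h' K hK a ha).sub (h' K hK b hb)).norm.pow 2).const_mul _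

theorem nodalEnergy_zero (γ : ℝ) : 𝒯.nodalEnergy γ (fun _ => (0 : 𝕜)) = 0 := by
  simp [nodalEnergy]

end Triangulation

theorem smoothNorm_le {𝕜 : Type*} [RCLike 𝕜] {Ω : Set Plane} {v g : Plane → 𝕜} (hv : MemH1 Ω v)
    (hg : ContDiff ℝ ∞ g) :
    smoothNorm Ω g ≤ approxError Ω v g + ENNReal.ofReal (3 * h1Norm Ω v) := by
  have key : ∀ a b : Plane → 𝕜, Continuous a → MemLp b 2 (volume.restrict Ω) →
      eLpNorm a 2 (volume.restrict Ω) ≤ eLpNorm (a - b) 2 (volume.restrict Ω) +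
        ENNReal.ofReal (l2Norm (volume.restrict Ω) b) := by
    intro a b ha hb
    rw [l2Norm, ENNReal.ofReal_toReal hb.2.ne]
    nth_rewrite 1 [← sub_add_cancel a b]
    exact eLpNorm_add_le (ha.aestronglyMeasurable.sub hb.1) hb.1 (by norm_num)
  have h0 := key g v hg.continuous hv.1
  have h1 := fun i => key _ _ (continuous_classicalPartial hg i) (hv.memLp_weakPartial i)
  have hn := h1Norm_nonneg Ω v
  have e0 := l2Norm_le_h1Norm Ω v
  have e1 := fun i => (l2Norm_weakPartial_le_gradNorm Ω v i).trans (gradNorm_le_h1Norm Ω v)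
  have e3 : 3 * h1Norm Ω v = h1Norm Ω v + (h1Norm Ω v + h1Norm Ω v) := by ring
  rw [smoothNorm, approxError, Fin.sum_univ_two, Fin.sum_univ_two, e3,
    ENNReal.ofReal_add hn (by positivity), ENNReal.ofReal_add hn hn]
  calc _ ≤ _ := add_le_add h0 (add_le_add (h1 0) (h1 1))
    _ ≤ _ := add_le_add (add_le_add le_rfl (ENNReal.ofReal_le_ofReal e0))
      (add_le_add (add_le_add le_rfl (ENNReal.ofReal_le_ofReal (e1 0)))
        (add_le_add le_rfl (ENNReal.ofReal_le_ofReal (e1 1))))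
    _ = _ := by ring

namespace Triangulation

variable {Ω : Set Plane} {σ τ : ℝ} {𝕜 : Type*} [RCLike 𝕜]

theorem tendsto_szMean_scottZhangValue {𝒯 : Triangulation Ω} (hΩ : IsPolygonalDomain Ω)
    (s : 𝒯.EdgeChoice) {v : Plane → 𝕜} (hv : MemH1 Ω v) {φ : ℕ → Plane → 𝕜}
    (hφ : IsSmoothApprox Ω v φ) {a : Plane} (ha : a ∈ 𝒯.vertices) :
    Tendsto (fun n => szMean (φ n) a (s.nbr a)) atTop (𝓝 (scottZhangValue s v a)) := by
  obtain ⟨K, hK, haK, hbK⟩ := s.edge a ha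
  have hne := (s.ne a ha).symm
  have hT : TraceBound 𝕜 Ω (segment ℝ a (s.nbr a)) := traceBound_edge hΩ hK haK hbK hne
  have htr := hasTraceOn_traceOn (hφ.exists_trace hΩ hv hT)
  exact tendsto_szMean hne (fun n => (hφ.smooth n).continuous) htr.2.1 (htr.tendsto hT hφ)

/-- For smooth functions the nodal values are stable by `nodalEnergy_szMean_le`. For `v` in `H¹`
they are limits of those of a smooth approximation, and the nodal energy is continuous in finitely
many nodal values. -/
theorem exists_scottZhang_constant (hΩ : IsPolygonalDomain Ω) (hσ : 0 < σ) (hτ : 0 < τ) :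
    ∃ C : ℝ, 0 < C ∧ ∀ 𝒯 : Triangulation Ω, 𝒯.IsRegular σ τ → ∀ (s : 𝒯.EdgeChoice)
      (v : Plane → 𝕜), MemH1 Ω v → h1Norm Ω (scottZhang s v) ≤ C * h1Norm Ω v := by
  have hA := discArea_pos
  set γ := 32 * discArea / σ ^ 2 with hγ
  set R := 1 / (σ ^ 2 * τ ^ 2) with hR
  set κ := 1 / (σ ^ 2 * discArea) with hκ
  set W := volume.real (closure Ω) with hW
  have hW0 : 0 ≤ W := measureReal_nonneg
  set Q := 3 * R ^ 2 * (128 * R + 128 * κ * W + 24 * γ * κ * (640 + 80 * (R ^ 2) ^ 2)) with hQ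
  have hQ0 : 0 < Q := by positivity
  -- Here `18 = 2 · 3²`: `2` from `smoothNorm_sq_ge`, and `3` because `smoothNorm` adds three norms,
  -- each at most the `H¹` norm.
  refine ⟨√(18 * Q), Real.sqrt_pos.2 (by positivity), fun 𝒯 hreg s v hv => ?_⟩
  have hn := h1Norm_nonneg Ω v
  have hval : 𝒯.nodalEnergy γ (scottZhangValue s v) ≤ 18 * Q * h1Norm Ω v ^ 2 := by
    by_cases happ : ∃ φ, IsSmoothApprox Ω v φ
    · obtain ⟨φ, hφ⟩ := happ
      have hlim := tendsto_nodalEnergy (𝒯 := 𝒯) γ fun a ha =>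
        tendsto_szMean_scottZhangValue hΩ s hv hφ ha
      have hb : ∀ n, ENNReal.ofReal (𝒯.nodalEnergy γ fun a => szMean (φ n) a (s.nbr a)) ≤
          ENNReal.ofReal Q *
            (2 * (approxError Ω v (φ n) + ENNReal.ofReal (3 * h1Norm Ω v)) ^ 2) := by
        intro n
        have hp := isUpperGradPair_of_contDiff hΩ.isBounded (hφ.smooth n)
        have h1 := nodalEnergy_szMean_le hreg hΩ s hp (γ := γ) (by positivity) hR hκ hW
        have h2 : ENNReal.ofReal ((∑ K ∈ 𝒯.cells, cellMass (φ n) K) +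
            ∑ K ∈ 𝒯.cells, cellEnergy (gradSum (classicalPartial (φ n))) K) =
            (∫⁻ x in Ω, ‖φ n x‖ₑ ^ 2) + ∫⁻ x in Ω, gradSum (classicalPartial (φ n)) x ^ 2 := by
          have hM : ∀ K ∈ 𝒯.cells, 0 ≤ cellMass (φ n) K := fun K _ => ENNReal.toReal_nonneg
          have hE : ∀ K ∈ 𝒯.cells, 0 ≤ cellEnergy (gradSum (classicalPartial (φ n))) K :=
            fun K _ => cellEnergy_nonneg _ K
          rw [ENNReal.ofReal_add (Finset.sum_nonneg hM) (Finset.sum_nonneg hE),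
            ENNReal.ofReal_sum_of_nonneg hM, ENNReal.ofReal_sum_of_nonneg hE,
            ← hΩ.restrict_closure, ← 𝒯.sum_lintegral_hull, ← 𝒯.sum_lintegral_hull]
          congr 1
          · exact Finset.sum_congr rfl fun K hK => (hp.lintegral_eq_cellMass hK).symm
          · exact Finset.sum_congr rfl fun K hK => (hp.lintegral_eq_cellEnergy hK).symm
        calc _ ≤ _ := ENNReal.ofReal_le_ofReal h1
          _ = ENNReal.ofReal Q * ((∫⁻ x in Ω, ‖φ n x‖ₑ ^ 2) +
                ∫⁻ x in Ω, gradSum (classicalPartial (φ n)) x ^ 2) := by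
              rw [ENNReal.ofReal_mul hQ0.le, h2]
          _ ≤ ENNReal.ofReal Q * (2 * smoothNorm Ω (φ n) ^ 2) := by
              gcongr
              exact smoothNorm_sq_ge (hφ.smooth n)
          _ ≤ _ := by
              gcongr
              exact smoothNorm_le hv (hφ.smooth n)
      have hlim2 : Tendsto (fun n => ENNReal.ofReal Q *
          (2 * (approxError Ω v (φ n) + ENNReal.ofReal (3 * h1Norm Ω v)) ^ 2)) atTop
          (𝓝 (ENNReal.ofReal Q * (2 * (0 + ENNReal.ofReal (3 * h1Norm Ω v)) ^ 2))) :=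
        ENNReal.Tendsto.const_mul (ENNReal.Tendsto.const_mul (ENNReal.Tendsto.pow
          (hφ.tendsto_approxError.add tendsto_const_nhds)) (Or.inr (by norm_num)))
          (Or.inr (by simp))
      have h3 := le_of_tendsto_of_tendsto' (ENNReal.tendsto_ofReal hlim) hlim2 hb
      rw [zero_add, ← ENNReal.ofReal_pow (by positivity), two_mul_ofReal,
        ← ENNReal.ofReal_mul hQ0.le, ENNReal.ofReal_le_ofReal_iff (by positivity)] at h3
      linarith
    -- Without a smooth approximation `v` has no trace on any edge, `traceOn` takes its default
    -- value `0`, and the interpolant has zero nodal values. Hence the bound holds without a density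
    -- theorem.
    · have h0 : scottZhangValue s v = fun _ => 0 := by
        funext a
        have : ¬ ∃ w, HasTraceOn Ω (segment ℝ a (s.nbr a)) v w := by
          rintro ⟨w, hw⟩
          obtain ⟨φ, hφ, -⟩ := hw.exists_approx
          exact happ ⟨φ, hφ⟩
        simp [scottZhangValue, traceOn, dif_neg this]
      rw [h0, nodalEnergy_zero]
      positivity
  have h1 := h1Norm_sq_le_nodalEnergy hΩ hreg (𝒯.nodalInterp_mem (scottZhangValue s v))
  rw [nodalEnergy_congr _ fun a ha => nodalInterp_apply (scottZhangValue s v) ha] at h1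
  have h2 : h1Norm Ω (scottZhang s v) ≤ √(18 * Q * h1Norm Ω v ^ 2) :=
    Real.le_sqrt_of_sq_le (h1.trans hval)
  rwa [Real.sqrt_mul (by positivity), Real.sqrt_sq hn] at h2

end Triangulation

/-! ### Lifts -/

section Lifts

variable {𝕜 : Type*} [RCLike 𝕜] {Ω ΓD S : Set Plane}

theorem HasTraceOn.exists_eLpNorm_le (hS : TraceBound 𝕜 Ω S) : ∃ T : ℝ≥0∞, T ≠ ⊤ ∧
    ∀ v w : Plane → 𝕜, HasTraceOn Ω S v w →
      eLpNorm w 2 ((μH[1] : Measure Plane).restrict S) ≤ T * ENNReal.ofReal (3 * h1Norm Ω v) := by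
  obtain ⟨T, hT, hTb⟩ := hS
  refine ⟨T, hT, fun v w h => ?_⟩
  obtain ⟨φ, hφ, hw⟩ := h.exists_approx
  have hlim : Tendsto (fun n => eLpNorm (φ n - w) 2 ((μH[1] : Measure Plane).restrict S) +
      T * (approxError Ω v (φ n) + ENNReal.ofReal (3 * h1Norm Ω v))) atTop
      (𝓝 (0 + T * (0 + ENNReal.ofReal (3 * h1Norm Ω v)))) :=
    hw.add (ENNReal.Tendsto.const_mul (hφ.tendsto_approxError.add tendsto_const_nhds) (Or.inr hT))
  rw [zero_add, zero_add] at hlim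
  refine ge_of_tendsto' hlim fun n => ?_
  have hm := (hφ.smooth n).continuous.aestronglyMeasurable
    (μ := (μH[1] : Measure Plane).restrict S)
  calc eLpNorm w 2 ((μH[1] : Measure Plane).restrict S)
      = eLpNorm (φ n - (φ n - w)) 2 ((μH[1] : Measure Plane).restrict S) := by
        rw [sub_sub_cancel]
    _ ≤ eLpNorm (φ n) 2 ((μH[1] : Measure Plane).restrict S) +
          eLpNorm (φ n - w) 2 ((μH[1] : Measure Plane).restrict S) :=
        eLpNorm_sub_le hm (hm.sub h.2.1.1) (by norm_num)
    _ ≤ T * (approxError Ω v (φ n) + ENNReal.ofReal (3 * h1Norm Ω v)) +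
          eLpNorm (φ n - w) 2 ((μH[1] : Measure Plane).restrict S) := by
        gcongr
        refine (hTb _ (hφ.smooth n)).trans ?_
        gcongr
        exact smoothNorm_le h.1 (hφ.smooth n)
    _ = _ := add_comm _ _

theorem h1Norm_zero (hΩ : IsOpen Ω) : h1Norm Ω (0 : Plane → 𝕜) = 0 := by
  have h0 : ∀ i, l2Norm (volume.restrict Ω) (weakPartial Ω i (0 : Plane → 𝕜)) = 0 := fun i => by
    rw [l2Norm_congr_ae (weakPartial_zero hΩ)]
    simp [l2Norm]
  have h1 : l2Norm (volume.restrict Ω) (0 : Plane → 𝕜) = 0 := by simp [l2Norm]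
  simp [h1Norm, gradNorm, h0, h1]

theorem hHalfNorm_nonneg (Ω ΓD : Set Plane) (ξD : Plane → ℝ) : 0 ≤ hHalfNorm Ω ΓD ξD := by
  refine Real.sInf_nonneg ?_
  rintro _ ⟨v, -, rfl⟩
  exact h1Norm_nonneg Ω v

/-- If the quotient norm is positive, some lift is within a factor `2` of the infimum. If it is
zero, the trace inequality forces `ξD = 0` almost everywhere on `ΓD`, and the zero function is a
lift. -/
theorem exists_lift (hΩ : IsPolygonalDomain Ω) (hΓD : ΓD ⊆ frontier Ω) {ξD : Plane → ℝ}
    (hξ : MemHHalf Ω ΓD ξD) : ∃ ζD ∈ lifts Ω ΓD ξD, h1Norm Ω ζD ≤ 2 * hHalfNorm Ω ΓD ξD := by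
  have hne : (h1Norm Ω '' lifts Ω ΓD ξD).Nonempty := hξ.image _
  rcases (hHalfNorm_nonneg Ω ΓD ξD).lt_or_eq with hpos | hzero
  · obtain ⟨_, ⟨v, hv, rfl⟩, hlt⟩ := exists_lt_of_csInf_lt hne
      (show sInf (h1Norm Ω '' lifts Ω ΓD ξD) < 2 * hHalfNorm Ω ΓD ξD by
        change hHalfNorm Ω ΓD ξD < _
        linarith)
    exact ⟨v, hv, hlt.le⟩
  · obtain ⟨T, hT, hTb⟩ := HasTraceOn.exists_eLpNorm_le (traceBound_frontier (𝕜 := ℝ) hΩ hΓD)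
    have h0 : eLpNorm ξD 2 ((μH[1] : Measure Plane).restrict ΓD) = 0 := by
      have hlim : Tendsto (fun ε : ℝ => T * ENNReal.ofReal (3 * ε)) (𝓝[>] 0)
          (𝓝 (T * ENNReal.ofReal (3 * 0))) :=
        ENNReal.Tendsto.const_mul (ENNReal.tendsto_ofReal
          ((tendsto_id.mono_left nhdsWithin_le_nhds).const_mul 3)) (Or.inr hT)
      rw [mul_zero, ENNReal.ofReal_zero, mul_zero] at hlim
      refine le_antisymm (ge_of_tendsto hlim ?_) zero_le
      filter_upwards [self_mem_nhdsWithin] with ε hε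
      obtain ⟨_, ⟨v, hv, rfl⟩, hlt⟩ := exists_lt_of_csInf_lt hne
        (show sInf (h1Norm Ω '' lifts Ω ΓD ξD) < ε by
          change hHalfNorm Ω ΓD ξD < _
          rw [← hzero]
          exact hε)
      refine (hTb v ξD hv).trans ?_
      gcongr
    obtain ⟨v, hv⟩ := hξ
    refine ⟨0, ⟨memH1_zero, hv.2.1, fun _ => 0, fun _ => contDiff_const, ?_, fun i => ?_, ?_⟩, ?_⟩
    · simp
    · refine tendsto_const_nhds.congr fun n => ?_
      rw [eLpNorm_congr_ae (g := 0), eLpNorm_zero]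
      filter_upwards [weakPartial_zero (𝕜 := ℝ) (i := i) hΩ.isOpen] with x hx
      rw [hx]
      simp
    · refine tendsto_const_nhds.congr fun n => ?_
      rw [zero_sub, eLpNorm_neg, h0]
    · rw [h1Norm_zero hΩ.isOpen, ← hzero, mul_zero]

theorem szMean_congr_ae {f g : Plane → 𝕜} {p q : Plane} (hpq : p ≠ q)
    (h : f =ᵐ[(μH[1] : Measure Plane).restrict (segment ℝ p q)] g) :
    szMean f p q = szMean g p q := by
  rw [szMean, szMean, intervalIntegral.integral_of_le zero_le_one,
    intervalIntegral.integral_of_le zero_le_one]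
  refine integral_congr_ae ?_
  filter_upwards [ae_restrict_of_ae_restrict_of_subset Ioc_subset_Icc_self (ae_edge_of_ae hpq h)]
    with t ht
  rw [ht]

namespace Triangulation

variable {𝒯 : Triangulation Ω}

/-- For an adapted edge choice the interpolant on `ΓD` depends only on the trace on `ΓD`. -/
theorem EdgeChoice.AdaptedTo.scottZhang_eq (hΩ : IsPolygonalDomain Ω) {s : 𝒯.EdgeChoice}
    (hs : s.AdaptedTo ΓD) {ξD ζ ζ' : Plane → ℝ} (hζ : ζ ∈ lifts Ω ΓD ξD)
    (hζ' : ζ' ∈ lifts Ω ΓD ξD) {x : Plane} (hx : x ∈ ΓD) :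
    scottZhang s ζ x = scottZhang s ζ' x := by
  have hval : ∀ a ∈ 𝒯.vertices, a ∈ ΓD → scottZhangValue s ζ a = scottZhangValue s ζ' a := by
    intro a ha haD
    obtain ⟨K, hK, haK, hbK⟩ := s.edge a ha
    have hne := (s.ne a ha).symm
    have hT : TraceBound ℝ Ω (segment ℝ a (s.nbr a)) := traceBound_edge hΩ hK haK hbK hne
    have key : ∀ z ∈ lifts Ω ΓD ξD, traceOn Ω (segment ℝ a (s.nbr a)) z
        =ᵐ[(μH[1] : Measure Plane).restrict (segment ℝ a (s.nbr a))] ξD := fun z hz => by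
      have hz' := HasTraceOn.mono hz (hs.2 a ha haD)
      exact (hasTraceOn_traceOn ⟨_, hz'⟩).ae_eq hz' hT
    exact szMean_congr_ae hne ((key ζ hζ).trans (key ζ' hζ').symm)
  -- The point lies on an edge inside `ΓD`. Both interpolants are affine there and agree at the end
  -- points, where the means use only edges in `ΓD`.
  obtain ⟨K, hK, a, ha, b, hb, hab, hxab, hsub⟩ := hs.1 x hx
  have hP := 𝒯.nodalInterp_mem (scottZhangValue s ζ)
  have hP' := 𝒯.nodalInterp_mem (scottZhangValue s ζ')
  have hnode : ∀ c ∈ K, c ∈ ΓD → scottZhang s ζ c = scottZhang s ζ' c := fun c hc hcD => by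
    have hcv : c ∈ 𝒯.vertices := ⟨K, hK, hc⟩
    rw [scottZhang, scottZhang, nodalInterp_apply _ hcv, nodalInterp_apply _ hcv, hval c hcv hcD]
  have e1 := eqOn_affinePart hP hK
  have e2 := eqOn_affinePart hP' hK
  have hsubK : segment ℝ a b ⊆ convexHull ℝ (K : Set Plane) := segment_subset_convexHull ha hb
  have hA := hnode a ha (hsub (left_mem_segment ℝ a b))
  have hB := hnode b hb (hsub (right_mem_segment ℝ a b))
  rw [scottZhang, scottZhang] at hA hB ⊢
  rw [e1 (hsubK (left_mem_segment ℝ a b)), e2 (hsubK (left_mem_segment ℝ a b))] at hA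
  rw [e1 (hsubK (right_mem_segment ℝ a b)), e2 (hsubK (right_mem_segment ℝ a b))] at hB
  rw [e1 (hsubK hxab), e2 (hsubK hxab)]
  obtain ⟨t, t', ht, ht', htt, rfl⟩ := hxab
  rw [Convex.combo_affine_apply htt, Convex.combo_affine_apply htt, hA, hB]

theorem VhD_eq (hΩ : IsPolygonalDomain Ω) {s : 𝒯.EdgeChoice}
    (hs : s.AdaptedTo ΓD) {ξD ζ ζ' : Plane → ℝ} (hζ : ζ ∈ lifts Ω ΓD ξD)
    (hζ' : ζ' ∈ lifts Ω ΓD ξD) : VhD s ΓD ζ = VhD s ΓD ζ' := by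
  ext z
  refine and_congr_right fun _ => forall₂_congr fun x hx => ?_
  have h := hs.scottZhang_eq hΩ hζ hζ' hx
  rw [h]

/-! ### Poincaré and trace inequalities -/

theorem lintegral_slope_sq_le (hΩ : IsPolygonalDomain Ω) {u : Plane → 𝕜} (hu : u ∈ 𝒯.P1 𝕜) :
    ∫⁻ x in Ω, ENNReal.ofReal (𝒯.slope u x) ^ 2 ≤ ENNReal.ofReal (2 * gradNorm Ω u ^ 2) := by
  have hH := memH1_P1 hΩ.isOpen hΩ.isBounded hu
  rw [← two_mul_ofReal, ← hH.sum_lintegral_weakPartial]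
  refine le_trans (le_of_eq ?_) (lintegral_gradSum_sq_le _ _ (hH.memLp_weakPartial 0).1)
  refine lintegral_congr_ae ?_
  have hcell := 𝒯.ae_exists_cell
  rw [hΩ.restrict_closure] at hcell
  filter_upwards [hcell, weakPartial_P1 hΩ.isOpen hΩ.isBounded hu 0,
    weakPartial_P1 hΩ.isOpen hΩ.isBounded hu 1] with x ⟨K, hK, hx, hx'⟩ h0 h1
  rw [gradSum, h0, h1, slope_eq hK (interior_subset hx) hx',
    piecewisePartial_eq hK (interior_subset hx) hx',
    piecewisePartial_eq hK (interior_subset hx) hx',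
    cellSlope, ENNReal.ofReal_add (norm_nonneg _) (norm_nonneg _), ofReal_norm, ofReal_norm]

end Triangulation

/-- For `V₀` the inequality with boundary term passes to the limit along smooth approximations,
whose traces on `ΓD` tend to zero. Discrete functions are treated directly through their own upper
gradient, so it is not needed that they belong to `V₀`. -/
theorem exists_poincare_V0 (hΩ : IsPolygonalDomain Ω) (hΓD : ΓD ⊆ frontier Ω)
    (hclosed : IsClosed ΓD) (hpos : 0 < (μH[1] : Measure Plane) ΓD) : ∃ C : ℝ, 0 < C ∧
      (∀ v ∈ V0 Ω ΓD, l2Norm (volume.restrict Ω) v ^ 2 ≤ C * gradNorm Ω v ^ 2) ∧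
      ∀ (𝒯 : Triangulation Ω), ∀ u ∈ 𝒯.Vh0 ΓD,
        l2Norm (volume.restrict Ω) u ^ 2 ≤ C * gradNorm Ω u ^ 2 := by
  obtain ⟨C, hC, hP⟩ := hΩ.exists_poincare_constant hΓD hpos ℂ
  refine ⟨4 * C, by positivity, fun v hv => ?_, fun 𝒯 u hu => ?_⟩
  · have hv1 : MemH1 Ω v := hv.1
    obtain ⟨φ, hφ, hw⟩ := HasTraceOn.exists_approx hv
    have hG := sq_nonneg (gradNorm Ω v)
    have hlim : Tendsto (fun n => 2 * eLpNorm (φ n - v) 2 (volume.restrict Ω) ^ 2 +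
        2 * (ENNReal.ofReal C * (2 * ∑ i, (eLpNorm (classicalPartial (φ n) i - weakPartial Ω i v) 2
          (volume.restrict Ω) + eLpNorm (weakPartial Ω i v) 2 (volume.restrict Ω)) ^ 2 +
          eLpNorm (φ n - 0) 2 ((μH[1] : Measure Plane).restrict ΓD) ^ 2))) atTop
        (𝓝 (2 * 0 ^ 2 + 2 * (ENNReal.ofReal C * (2 * ∑ i, (0 +
          eLpNorm (weakPartial Ω i v) 2 (volume.restrict Ω)) ^ 2 + 0 ^ 2)))) := by
      refine Tendsto.add (ENNReal.Tendsto.const_mul (ENNReal.Tendsto.pow hφ.tendsto)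
        (Or.inr (by norm_num))) (ENNReal.Tendsto.const_mul (ENNReal.Tendsto.const_mul
        (Tendsto.add (ENNReal.Tendsto.const_mul (tendsto_finsetSum _ fun i _ =>
          ENNReal.Tendsto.pow ((hφ.tendsto_partial i).add tendsto_const_nhds))
          (Or.inr (by norm_num))) (ENNReal.Tendsto.pow hw)) (Or.inr (by simp)))
        (Or.inr (by norm_num)))
    have hle := ge_of_tendsto' (b := eLpNorm v 2 (volume.restrict Ω) ^ 2) hlim fun n => by
      have hm := (hφ.smooth n).continuous.aestronglyMeasurable (μ := volume.restrict Ω)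
      have hmi := fun i => (continuous_classicalPartial (hφ.smooth n) i).aestronglyMeasurable
        (μ := volume.restrict Ω)
      have h1 : eLpNorm v 2 (volume.restrict Ω) ≤ eLpNorm (φ n - v) 2 (volume.restrict Ω) +
          eLpNorm (φ n) 2 (volume.restrict Ω) := by
        rw [add_comm]
        nth_rewrite 1 [← sub_sub_cancel (φ n) v]
        exact eLpNorm_sub_le hm (hm.sub hv1.1.1) (by norm_num)
      have h2 := hP _ _ (isUpperGradPair_of_contDiff hΩ.isBounded (hφ.smooth n))
      have h3 := lintegral_gradSum_sq_le (classicalPartial (φ n)) (volume.restrict Ω) (hmi 0)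
      have h4 : ∀ i, eLpNorm (classicalPartial (φ n) i) 2 (volume.restrict Ω) ≤
          eLpNorm (classicalPartial (φ n) i - weakPartial Ω i v) 2 (volume.restrict Ω) +
            eLpNorm (weakPartial Ω i v) 2 (volume.restrict Ω) := fun i => by
        nth_rewrite 1 [← sub_add_cancel (classicalPartial (φ n) i) (weakPartial Ω i v)]
        exact eLpNorm_add_le ((hmi i).sub (hv1.memLp_weakPartial i).1)
          (hv1.memLp_weakPartial i).1 (by norm_num)
      calc _ ≤ (eLpNorm (φ n - v) 2 (volume.restrict Ω) +
            eLpNorm (φ n) 2 (volume.restrict Ω)) ^ 2 := by gcongr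
        _ ≤ 2 * eLpNorm (φ n - v) 2 (volume.restrict Ω) ^ 2 +
            2 * eLpNorm (φ n) 2 (volume.restrict Ω) ^ 2 := add_sq_le_two_mul _ _
        _ ≤ _ := by
          rw [sub_zero, eLpNorm_two_sq (φ n), eLpNorm_two_sq (φ n)]
          gcongr
          refine h2.trans ?_
          gcongr
          refine h3.trans ?_
          gcongr with i
          rw [← eLpNorm_two_sq]
          gcongr
          exact h4 i
    simp only [zero_add, ne_eq, OfNat.ofNat_ne_zero, not_false_eq_true, zero_pow, mul_zero,
      add_zero, eLpNorm_two_sq] at hle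
    rw [hv1.sum_lintegral_weakPartial, lintegral_sq_eq_l2Norm hv1.1, two_mul_ofReal,
      ← ENNReal.ofReal_mul hC.le, two_mul_ofReal,
      ENNReal.ofReal_le_ofReal_iff (by positivity)] at hle
    linarith
  · have hH := Triangulation.memH1_P1 hΩ.isOpen hΩ.isBounded hu.1
    have h1 := hP _ _ (Triangulation.isUpperGradPair_slope hΩ.isBounded hu.1)
    have h0 : ∫⁻ x in ΓD, ‖u x‖ₑ ^ 2 ∂(μH[1] : Measure Plane) = 0 := by
      rw [setLIntegral_congr_fun hclosed.measurableSet (g := fun _ => 0) fun x hx => by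
        simp [hu.2 x hx], lintegral_zero]
    rw [h0, add_zero] at h1
    have h2 := h1.trans (mul_le_mul' le_rfl (Triangulation.lintegral_slope_sq_le hΩ hu.1))
    rw [lintegral_sq_eq_l2Norm hH.1, ← ENNReal.ofReal_mul hC.le,
      ENNReal.ofReal_le_ofReal_iff (by positivity)] at h2
    nlinarith [mul_nonneg hC.le (sq_nonneg (gradNorm Ω u))]

theorem memLp_trace_P1 (hΩ : IsPolygonalDomain Ω) {𝒯 : Triangulation Ω} {u : Plane → 𝕜}
    (hu : u ∈ 𝒯.P1 𝕜) : MemLp u 2 (neumannMeasure Ω ΓD) := by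
  have : IsFiniteMeasure ((μH[1] : Measure Plane).restrict (frontier Ω)) :=
    ⟨by simpa using hΩ.hausdorffMeasure_frontier_ne_top.lt_top⟩
  exact (Triangulation.memLp_P1 hΩ.isBounded hu (μ := (μH[1] : Measure Plane).restrict
    (frontier Ω))).mono_measure (Measure.restrict_mono sdiff_subset le_rfl)

/-- Uniform in the mesh: the constant comes from one fixed triangulation of `Ω`, and the mesh enters
only through the upper gradient `slope`. -/
theorem exists_trace_P1 (hΩ : IsPolygonalDomain Ω) (ΓD : Set Plane) (𝕜 : Type*) [RCLike 𝕜] :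
    ∃ T : ℝ, 0 < T ∧ ∀ (𝒯 : Triangulation Ω), ∀ u ∈ 𝒯.P1 𝕜,
      l2Norm (neumannMeasure Ω ΓD) u ≤ T * h1Norm Ω u := by
  obtain ⟨T, hT, hTb⟩ := hΩ.exists_trace_constant 𝕜
  refine ⟨√(2 * T), Real.sqrt_pos.2 (by positivity), fun 𝒯 u hu => ?_⟩
  have hH := Triangulation.memH1_P1 hΩ.isOpen hΩ.isBounded hu
  have h1 := hTb _ _ (Triangulation.isUpperGradPair_slope hΩ.isBounded hu)
  have h2 : ∫⁻ x, ‖u x‖ₑ ^ 2 ∂(neumannMeasure Ω ΓD) ≤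
      ∫⁻ x in frontier Ω, ‖u x‖ₑ ^ 2 ∂(μH[1] : Measure Plane) := lintegral_mono_set sdiff_subset
  have h3 := (h2.trans h1).trans (mul_le_mul' le_rfl
    (add_le_add le_rfl (Triangulation.lintegral_slope_sq_le hΩ hu)))
  rw [lintegral_sq_eq_l2Norm (memLp_trace_P1 hΩ hu), lintegral_sq_eq_l2Norm hH.1,
    ← ENNReal.ofReal_add (by positivity) (by positivity), ← ENNReal.ofReal_mul hT.le,
    ENNReal.ofReal_le_ofReal_iff (by positivity)] at h3
  have h4 := h1Norm_sq Ω u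
  have hn := h1Norm_nonneg Ω u
  have h5 : l2Norm (neumannMeasure Ω ΓD) u ≤ √(2 * T * h1Norm Ω u ^ 2) := by
    refine Real.le_sqrt_of_sq_le (h3.trans ?_)
    nlinarith [mul_nonneg hT.le (sq_nonneg (l2Norm (volume.restrict Ω) u))]
  rwa [Real.sqrt_mul (by positivity), Real.sqrt_sq hn] at h5

end Lifts

/-! ### Bilinear forms in the gradient -/

section Forms

variable {Ω : Set Plane} {μ : Measure Plane} {N : ℝ} {f g k : Plane → ℂ}

theorem lintegral_mul_mul_le (hN : 0 ≤ N) (hk : ∀ x, ‖k x‖ ≤ N) (hf : MemLp f 2 μ)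
    (hg : MemLp g 2 μ) :
    ∫⁻ x, ‖k x * f x * g x‖ₑ ∂μ ≤ ENNReal.ofReal (N * l2Norm μ f * l2Norm μ g) := by
  have h1 := eLpNorm_le_eLpNorm_mul_eLpNorm'_of_norm (p := 2) (q := 2) (r := 1) hf.1 hg.1
    (fun a b : ℂ => a * b) 1 (ae_of_all _ fun x => by simp)
  rw [eLpNorm_one_eq_lintegral_enorm, ENNReal.coe_one, one_mul] at h1
  calc ∫⁻ x, ‖k x * f x * g x‖ₑ ∂μ ≤ ∫⁻ x, ENNReal.ofReal N * ‖f x * g x‖ₑ ∂μ := by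
        refine lintegral_mono fun x => ?_
        rw [mul_assoc, enorm_mul]
        gcongr
        rw [← ofReal_norm]
        exact ENNReal.ofReal_le_ofReal (hk x)
    _ = ENNReal.ofReal N * ∫⁻ x, ‖f x * g x‖ₑ ∂μ := lintegral_const_mul' _ _ (by simp)
    _ ≤ ENNReal.ofReal N * (eLpNorm f 2 μ * eLpNorm g 2 μ) := by gcongr
    _ = _ := by
        rw [mul_assoc, ENNReal.ofReal_mul hN, ENNReal.ofReal_mul (l2Norm_nonneg _ _), l2Norm,
          l2Norm, ENNReal.ofReal_toReal hf.2.ne, ENNReal.ofReal_toReal hg.2.ne]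

theorem integrable_mul_mul (hN : 0 ≤ N) (hk : ∀ x, ‖k x‖ ≤ N) (hkm : AEStronglyMeasurable k μ)
    (hf : MemLp f 2 μ) (hg : MemLp g 2 μ) : Integrable (fun x => k x * f x * g x) μ :=
  ⟨(hkm.mul hf.1).mul hg.1, (lintegral_mul_mul_le hN hk hf hg).trans_lt ENNReal.ofReal_lt_top⟩

theorem norm_integral_mul_mul_le (hN : 0 ≤ N) (hk : ∀ x, ‖k x‖ ≤ N) (hf : MemLp f 2 μ)
    (hg : MemLp g 2 μ) : ‖∫ x, k x * f x * g x ∂μ‖ ≤ N * l2Norm μ f * l2Norm μ g := by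
  have h1 := (enorm_integral_le_lintegral_enorm _).trans (lintegral_mul_mul_le hN hk hf hg)
  rw [← ofReal_norm] at h1
  exact (ENNReal.ofReal_le_ofReal_iff
    (mul_nonneg (mul_nonneg hN (l2Norm_nonneg _ _)) (l2Norm_nonneg _ _))).1 h1

theorem integral_norm_sq_eq_l2Norm (hf : MemLp f 2 μ) :
    ∫ x, ‖f x‖ ^ 2 ∂μ = l2Norm μ f ^ 2 := by
  rw [integral_eq_lintegral_of_nonneg_ae (ae_of_all _ fun x => sq_nonneg _)
    (hf.1.norm.pow 2)]
  have : ∀ x, ENNReal.ofReal (‖f x‖ ^ 2) = ‖f x‖ₑ ^ 2 := fun x => by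
    rw [ENNReal.ofReal_pow (norm_nonneg _), ofReal_norm]
  simp_rw [this]
  rw [lintegral_sq_eq_l2Norm hf, ENNReal.toReal_ofReal (sq_nonneg _)]

/-- The bilinear form `∑ᵢ ∫_Ω cᵢ ∂ᵢζ ∂ᵢη`. -/
def gradForm (Ω : Set Plane) (c : Fin 2 → Plane → ℂ) (ζ η : Plane → ℂ) : ℂ :=
  ∑ i, ∫ x in Ω, c i x * weakPartial Ω i ζ x * weakPartial Ω i η x

/-- Bounded measurable coefficients. -/
structure IsBoundedCoeff (c : Fin 2 → Plane → ℂ) (N : ℝ) : Prop where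
  nonneg : 0 ≤ N
  meas : ∀ i, Measurable (c i)
  bound : ∀ i x, ‖c i x‖ ≤ N

variable {c : Fin 2 → Plane → ℂ} {ζ ζ' η : Plane → ℂ}

theorem gradForm_comm (Ω : Set Plane) (c : Fin 2 → Plane → ℂ) (ζ η : Plane → ℂ) :
    gradForm Ω c ζ η = gradForm Ω c η ζ := by
  simp only [gradForm, mul_right_comm]

theorem IsBoundedCoeff.integrable (hc : IsBoundedCoeff c N) (hζ : MemH1 Ω ζ) (hη : MemH1 Ω η)
    (i : Fin 2) :
    Integrable (fun x => c i x * weakPartial Ω i ζ x * weakPartial Ω i η x) (volume.restrict Ω) :=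
  integrable_mul_mul hc.nonneg (hc.bound i) (hc.meas i).aestronglyMeasurable
    (hζ.memLp_weakPartial i) (hη.memLp_weakPartial i)

theorem IsBoundedCoeff.gradForm_add (hc : IsBoundedCoeff c N) (hΩ : IsOpen Ω) (hζ : MemH1 Ω ζ)
    (hζ' : MemH1 Ω ζ') (hη : MemH1 Ω η) :
    gradForm Ω c (ζ + ζ') η = gradForm Ω c ζ η + gradForm Ω c ζ' η := by
  rw [gradForm, gradForm, gradForm, ← Finset.sum_add_distrib]
  refine Finset.sum_congr rfl fun i _ => ?_
  rw [← integral_add (hc.integrable hζ hη i) (hc.integrable hζ' hη i)]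
  refine integral_congr_ae ?_
  filter_upwards [hζ.weakPartial_add hΩ hζ' i] with x hx
  rw [hx, Pi.add_apply]
  ring

theorem gradForm_smul (hΩ : IsOpen Ω) (r : ℂ) (hζ : MemH1 Ω ζ) :
    gradForm Ω c (r • ζ) η = r * gradForm Ω c ζ η := by
  rw [gradForm, gradForm, Finset.mul_sum]
  refine Finset.sum_congr rfl fun i _ => ?_
  rw [← integral_const_mul]
  refine integral_congr_ae ?_
  have h := hζ.weakPartial_comp_clm hΩ ((ContinuousLinearMap.mul ℂ ℂ r).restrictScalars ℝ) i
  filter_upwards [h] with x hx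
  change weakPartial Ω i (r • ζ) x = r * weakPartial Ω i ζ x at hx
  rw [hx]
  ring

theorem MemH1.conj (hη : MemH1 Ω η) : MemH1 Ω (star η) :=
  hη.comp_clm (Complex.conjCLE : ℂ →L[ℝ] ℂ)

theorem MemH1.weakPartial_conj (hΩ : IsOpen Ω) (hη : MemH1 Ω η) (i : Fin 2) :
    weakPartial Ω i (star η) =ᵐ[volume.restrict Ω] fun x => star (weakPartial Ω i η x) :=
  hη.weakPartial_comp_clm hΩ (Complex.conjCLE : ℂ →L[ℝ] ℂ) i

theorem MemH1.gradNorm_conj (hΩ : IsOpen Ω) (hη : MemH1 Ω η) :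
    gradNorm Ω (star η) = gradNorm Ω η := by
  have : ∀ i, l2Norm (volume.restrict Ω) (weakPartial Ω i (star η)) =
      l2Norm (volume.restrict Ω) (weakPartial Ω i η) := fun i => by
    rw [l2Norm_congr_ae (hη.weakPartial_conj hΩ i), l2Norm, l2Norm]
    congr 1
    exact eLpNorm_congr_norm_ae (ae_of_all _ fun x => norm_star _)
  simp only [gradNorm, this]

theorem MemH1.h1Norm_ofReal {u : Plane → ℝ} (hΩ : IsOpen Ω) (hu : MemH1 Ω u) :
    h1Norm Ω (fun x => (u x : ℂ)) = h1Norm Ω u := by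
  have h0 : l2Norm (volume.restrict Ω) (fun x => (u x : ℂ)) = l2Norm (volume.restrict Ω) u := by
    rw [l2Norm, l2Norm]
    congr 1
    exact eLpNorm_congr_norm_ae (ae_of_all _ fun x => Complex.norm_real _)
  have h1 : ∀ i, l2Norm (volume.restrict Ω) (weakPartial Ω i (fun x => (u x : ℂ))) =
      l2Norm (volume.restrict Ω) (weakPartial Ω i u) := fun i => by
    refine (l2Norm_congr_ae (hu.weakPartial_comp_clm hΩ Complex.ofRealCLM i)).trans ?_
    rw [l2Norm, l2Norm]
    congr 1
    exact eLpNorm_congr_norm_ae (ae_of_all _ fun x => Complex.norm_real _)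
  simp only [h1Norm, gradNorm, h0, h1]

theorem IsBoundedCoeff.norm_gradForm_le (hc : IsBoundedCoeff c N) (hζ : MemH1 Ω ζ)
    (hη : MemH1 Ω η) : ‖gradForm Ω c ζ η‖ ≤ 2 * N * gradNorm Ω ζ * gradNorm Ω η := by
  have h : ∀ i, ‖∫ x in Ω, c i x * weakPartial Ω i ζ x * weakPartial Ω i η x‖ ≤
      N * gradNorm Ω ζ * gradNorm Ω η := fun i => by
    refine (norm_integral_mul_mul_le hc.nonneg (hc.bound i) (hζ.memLp_weakPartial i)
      (hη.memLp_weakPartial i)).trans ?_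
    have := hc.nonneg
    have := gradNorm_nonneg Ω ζ
    gcongr
    · exact l2Norm_nonneg _ _
    · exact l2Norm_weakPartial_le_gradNorm _ _ _
    · exact l2Norm_weakPartial_le_gradNorm _ _ _
  rw [gradForm, Fin.sum_univ_two]
  linarith [norm_add_le (∫ x in Ω, c 0 x * weakPartial Ω 0 ζ x * weakPartial Ω 0 η x)
    (∫ x in Ω, c 1 x * weakPartial Ω 1 ζ x * weakPartial Ω 1 η x), h 0, h 1]

/-- Coercivity: the integrand is `cᵢ |∂ᵢζ|²`, so the real part of `cᵢ`, whatever its sign, does not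
contribute to the imaginary part. -/
theorem IsBoundedCoeff.im_gradForm (hc : IsBoundedCoeff c N) (hΩ : IsOpen Ω) {ε : ℝ}
    (hε : ∀ i x, (c i x).im = ε) (hζ : MemH1 Ω ζ) :
    (gradForm Ω c ζ (star ζ)).im = ε * gradNorm Ω ζ ^ 2 := by
  rw [gradForm, Complex.im_sum, gradNorm_sq, Finset.mul_sum]
  refine Finset.sum_congr rfl fun i _ => ?_
  have h1 := integral_im (hc.integrable hζ hζ.conj i)
  simp only [RCLike.im_eq_complex_im] at h1
  rw [← h1, ← integral_norm_sq_eq_l2Norm (hζ.memLp_weakPartial i), ← integral_const_mul]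
  refine integral_congr_ae ?_
  filter_upwards [hζ.weakPartial_conj hΩ i] with x hx
  rw [hx, mul_assoc, ← hε i x]
  have : weakPartial Ω i ζ x * star (weakPartial Ω i ζ x) =
      ((‖weakPartial Ω i ζ x‖ ^ 2 : ℝ) : ℂ) := by
    rw [Complex.star_def, Complex.mul_conj, Complex.normSq_eq_norm_sq]
  rw [this, Complex.im_mul_ofReal]

/-- The form for the Neumann data without conjugation. -/
theorem neumannForm_conj {ΓD : Set Plane} (b : Plane → ℝ) (η : Plane → ℂ) :
    neumannForm Ω ΓD b (star η) = ∫ x, (b x : ℂ) * η x ∂(neumannMeasure Ω ΓD) := by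
  simp [neumannForm]

theorem norm_neumannForm_le {ΓD : Set Plane} {b : Plane → ℝ}
    (hb : MemLp b 2 (neumannMeasure Ω ΓD)) (hη : MemLp η 2 (neumannMeasure Ω ΓD)) :
    ‖neumannForm Ω ΓD b η‖ ≤ l2Norm (neumannMeasure Ω ΓD) b * l2Norm (neumannMeasure Ω ΓD) η := by
  have h := norm_integral_mul_mul_le (k := fun _ => 1) zero_le_one (fun _ => by simp)
    (MemLp.ofReal (K := ℂ) hb) hη.star
  have e1 : l2Norm (neumannMeasure Ω ΓD) (star η) = l2Norm (neumannMeasure Ω ΓD) η := by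
    rw [l2Norm, l2Norm]
    congr 1
    exact eLpNorm_congr_norm_ae (ae_of_all _ fun x => norm_star _)
  have e2 : l2Norm (neumannMeasure Ω ΓD) (fun x => ((b x : ℝ) : ℂ)) =
      l2Norm (neumannMeasure Ω ΓD) b := by
    rw [l2Norm, l2Norm]
    congr 1
    exact eLpNorm_congr_norm_ae (ae_of_all _ fun x => Complex.norm_real _)
  simp only [one_mul] at h
  rw [e1] at h
  exact h.trans (le_of_eq (by rw [← e2]; rfl))

/-! ### The coefficients -/

theorem measurable_cutoff {ξm ξp : ℝ} {G : ℝ → ℝ} (hG : Measurable G) :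
    Measurable (cutoff ξm ξp G) :=
  Measurable.ite measurableSet_Ici measurable_const
    (Measurable.ite measurableSet_Iic measurable_const hG)

theorem measurable_mu1 (α : ℝ) : Measurable (mu1 α) := by
  unfold mu1; fun_prop

theorem measurable_mu2 (β : ℝ) : Measurable (mu2 β) := by
  unfold mu2; fun_prop

theorem measurable_Bhat_diag (α β ξm ξp : ℝ) (i : Fin 2) :
    Measurable fun t => Bhat α β ξm ξp t i i := by
  have h1 : Measurable (Gamma12 α β) := (measurable_deriv _).neg.div (measurable_mu2 β)
  have h2 : Measurable (Gamma21 α β) := (measurable_deriv _).div (measurable_mu1 α)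
  fin_cases i
  · simpa [Bhat] using measurable_cutoff h2
  · simpa [Bhat] using measurable_cutoff h1

/-- The diagonal coefficients of the regularized form. -/
def regCoeff (B : ℝ → Matrix (Fin 2) (Fin 2) ℝ) (ε : ℝ) (ξ : Plane → ℝ) (i : Fin 2) (x : Plane) :
    ℂ :=
  (B (ξ x) i i : ℂ) + Complex.I * ε

theorem regCoeff_im (B : ℝ → Matrix (Fin 2) (Fin 2) ℝ) (ε : ℝ) (ξ : Plane → ℝ) (i : Fin 2)
    (x : Plane) : (regCoeff B ε ξ i x).im = ε := by
  simp [regCoeff]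

theorem isBoundedCoeff_regCoeff {α β ξm ξp M ε : ℝ} (hM : 0 < M) (hε : 0 < ε)
    (hB : ∀ t j k, |Bhat α β ξm ξp t j k| ≤ M) {ξ : Plane → ℝ} (hξ : Measurable ξ) :
    IsBoundedCoeff (regCoeff (Bhat α β ξm ξp) ε ξ) (M + ε) where
  nonneg := by positivity
  meas i := (Complex.measurable_ofReal.comp ((measurable_Bhat_diag α β ξm ξp i).comp hξ)).add_const
    _
  bound i x := by
    refine (norm_add_le _ _).trans (add_le_add ?_ ?_)
    · rw [Complex.norm_real]
      exact hB _ _ _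
    · simp [abs_of_pos hε]

/-- Testing with conjugates turns the sesquilinear form into a symmetric bilinear one, which allows
linear algebra with the ordinary dual space; `V_{h0}` is closed under conjugation. -/
theorem regForm_conj (hΩ : IsOpen Ω) {B : ℝ → Matrix (Fin 2) (Fin 2) ℝ} {ε : ℝ} {ξ : Plane → ℝ}
    (hB0 : ∀ t, B t 0 1 = 0) (hB1 : ∀ t, B t 1 0 = 0)
    (hc : IsBoundedCoeff (regCoeff B ε ξ) N) (hζ : MemH1 Ω ζ) (hη : MemH1 Ω η) :
    regForm Ω B ε ξ ζ (star η) = gradForm Ω (regCoeff B ε ξ) ζ η := by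
  rw [gradForm, Fin.sum_univ_two, ← integral_add (hc.integrable hζ hη 0) (hc.integrable hζ hη 1),
    regForm]
  refine integral_congr_ae ?_
  filter_upwards [hη.weakPartial_conj hΩ 0, hη.weakPartial_conj hΩ 1] with x h0 h1
  simp [Matrix.mulVec, dotProduct, Fin.sum_univ_two, weakGrad, regCoeff, hB0, hB1, h0, h1,
    Matrix.one_apply]

end Forms

/-! ### The discrete spaces -/

namespace Triangulation

variable {Ω ΓD : Set Plane} {𝒯 : Triangulation Ω} {𝕜 𝕜' : Type*} [RCLike 𝕜] [RCLike 𝕜']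
  {u v : Plane → 𝕜}

theorem P1_add (hu : u ∈ 𝒯.P1 𝕜) (hv : v ∈ 𝒯.P1 𝕜) : u + v ∈ 𝒯.P1 𝕜 := by
  refine ⟨hu.1.add hv.1, fun K hK => ?_, fun x hx => by simp [hu.2.2 x hx, hv.2.2 x hx]⟩
  obtain ⟨A, hA⟩ := hu.2.1 K hK
  obtain ⟨B, hB⟩ := hv.2.1 K hK
  exact ⟨A + B, fun x hx => by simp [hA hx, hB hx]⟩

theorem P1_comp_clm (A : 𝕜 →L[ℝ] 𝕜') (hu : u ∈ 𝒯.P1 𝕜) : (fun x => A (u x)) ∈ 𝒯.P1 𝕜' := by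
  refine ⟨A.continuous.comp_continuousOn hu.1, fun K hK => ?_, fun x hx => by simp [hu.2.2 x hx]⟩
  obtain ⟨B, hB⟩ := hu.2.1 K hK
  exact ⟨A.toLinearMap.toAffineMap.comp B, fun x hx => by simp [hB hx]⟩

theorem P1_zero : (0 : Plane → 𝕜) ∈ 𝒯.P1 𝕜 :=
  ⟨continuousOn_const, fun _ _ => ⟨0, fun _ _ => by simp⟩, fun _ _ => rfl⟩

theorem P1_eq_zero_of_closure (hu : u ∈ 𝒯.P1 𝕜) (h : ∀ x ∈ closure Ω, u x = 0) : u = 0 := by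
  funext x
  by_cases hx : x ∈ closure Ω
  · exact h x hx
  · exact hu.2.2 x hx

theorem P1_eq_zero_of_vertices (hu : u ∈ 𝒯.P1 𝕜) (h : ∀ a ∈ 𝒯.vertices, u a = 0) : u = 0 := by
  refine P1_eq_zero_of_closure hu fun x hx => ?_
  rw [← 𝒯.cover] at hx
  obtain ⟨K, hK, hxK⟩ := mem_iUnion₂.1 hx
  have := norm_sub_le_of_nodal hu hK (c := 0) (r := 0)
    (fun a ha => by simp [h a ⟨K, hK, ha⟩]) hxK
  simpa using this

theorem P1_eq_zero_of_ae (hΩ : IsOpen Ω) (hu : u ∈ 𝒯.P1 𝕜) (h : u =ᵐ[volume.restrict Ω] 0) :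
    u = 0 := by
  have h1 : EqOn u 0 Ω := Measure.eqOn_open_of_ae_eq h hΩ (hu.1.mono subset_closure)
    continuousOn_const
  exact P1_eq_zero_of_closure hu
    (h1.of_subset_closure hu.1 continuousOn_const subset_closure le_rfl)

variable (𝒯 ΓD) in
/-- `V_{h0}` as a subspace. -/
def Vh0Sub : Submodule ℂ (Plane → ℂ) where
  carrier := 𝒯.Vh0 ΓD
  add_mem' hu hv := ⟨P1_add hu.1 hv.1, fun x hx => by simp [hu.2 x hx, hv.2 x hx]⟩
  zero_mem' := ⟨P1_zero, fun _ _ => rfl⟩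
  smul_mem' r u hu :=
    ⟨P1_comp_clm ((ContinuousLinearMap.mul ℂ ℂ r).restrictScalars ℝ) hu.1,
      fun x hx => by simp [hu.2 x hx]⟩

theorem Vh0_conj {η : Plane → ℂ} (hη : η ∈ 𝒯.Vh0 ΓD) : star η ∈ 𝒯.Vh0 ΓD :=
  ⟨P1_comp_clm (Complex.conjCLE : ℂ →L[ℝ] ℂ) hη.1, fun x hx => by simp [hη.2 x hx]⟩

theorem finite_vertices (𝒯 : Triangulation Ω) : 𝒯.vertices.Finite := by
  have : 𝒯.vertices = ⋃ K ∈ 𝒯.cells, (K : Set Plane) := by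
    ext a
    simp [vertices]
  rw [this]
  exact 𝒯.cells.finite_toSet.biUnion fun K _ => K.finite_toSet

instance finiteDimensional_Vh0Sub : FiniteDimensional ℂ (𝒯.Vh0Sub ΓD) := by
  have : Finite 𝒯.vertices := 𝒯.finite_vertices
  have : Fintype 𝒯.vertices := Fintype.ofFinite _
  let f : 𝒯.Vh0Sub ΓD →ₗ[ℂ] (𝒯.vertices → ℂ) :=
    { toFun := fun u a => u.1 a
      map_add' := fun _ _ => rfl
      map_smul' := fun _ _ => rfl }
  refine FiniteDimensional.of_injective f (LinearMap.ker_eq_bot.1 (LinearMap.ker_eq_bot'.2 ?_))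
  intro u hu
  exact Subtype.ext (P1_eq_zero_of_vertices u.2.1 fun a ha => congrFun hu ⟨a, ha⟩)

theorem ofReal_scottZhang_mem_VhD (s : 𝒯.EdgeChoice) (ζD : Plane → ℝ) :
    (fun x => ((scottZhang s ζD x : ℝ) : ℂ)) ∈ VhD s ΓD ζD :=
  ⟨P1_comp_clm Complex.ofRealCLM (𝒯.nodalInterp_mem _), fun x _ => by simp⟩

theorem VhD_add {s : 𝒯.EdgeChoice} {ζD : Plane → ℝ} {w z : Plane → ℂ} (hw : w ∈ VhD s ΓD ζD)
    (hz : z ∈ 𝒯.Vh0 ΓD) : w + z ∈ VhD s ΓD ζD :=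
  ⟨P1_add hw.1 hz.1, fun x hx => by simp [hz.2 x hx, hw.2 x hx]⟩

theorem VhD_sub {s : 𝒯.EdgeChoice} {ζD : Plane → ℝ} {w ζ : Plane → ℂ} (hζ : ζ ∈ VhD s ΓD ζD)
    (hw : w ∈ VhD s ΓD ζD) : ζ - w ∈ 𝒯.Vh0 ΓD := by
  refine ⟨?_, fun x hx => ?_⟩
  · rw [sub_eq_add_neg]
    exact P1_add hζ.1 (P1_comp_clm (-ContinuousLinearMap.id ℝ ℂ) hw.1)
  · have h1 := hζ.2 x hx
    have h2 := hw.2 x hx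
    apply Complex.ext
    · simp [h1, h2]
    · simp [h1, h2]

end Triangulation

/-! ### The discrete problem -/

section Discrete

variable {Ω ΓD : Set Plane} {𝒯 : Triangulation Ω} {c : Fin 2 → Plane → ℂ} {N ε C : ℝ}

theorem l2Norm_eq_zero {μ : Measure Plane} {u : Plane → ℂ} (hu : MemLp u 2 μ)
    (h : l2Norm μ u = 0) : u =ᵐ[μ] 0 := by
  rw [l2Norm, ENNReal.toReal_eq_zero_iff] at h
  exact (eLpNorm_eq_zero_iff hu.1 (by norm_num)).1 (h.resolve_right hu.2.ne)

/-- Testing with the conjugate of `z` gives a vanishing gradient by coercivity, then `z = 0` almost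
everywhere by Poincaré, and everywhere by continuity. -/
theorem Vh0_eq_zero (hΩ : IsPolygonalDomain Ω) (hc : IsBoundedCoeff c N) (hε : 0 < ε)
    (hcε : ∀ i x, (c i x).im = ε)
    (hP : ∀ u ∈ 𝒯.Vh0 ΓD, l2Norm (volume.restrict Ω) u ^ 2 ≤ C * gradNorm Ω u ^ 2)
    {z : Plane → ℂ} (hz : z ∈ 𝒯.Vh0 ΓD) (h : ∀ η ∈ 𝒯.Vh0 ΓD, gradForm Ω c z η = 0) : z = 0 := by
  have hH := Triangulation.memH1_P1 hΩ.isOpen hΩ.isBounded hz.1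
  have h1 := hc.im_gradForm hΩ.isOpen hcε hH
  rw [h _ (Triangulation.Vh0_conj hz), Complex.zero_im] at h1
  have h2 : gradNorm Ω z ^ 2 = 0 := by
    rcases mul_eq_zero.1 h1.symm with h3 | h3
    · exact absurd h3 hε.ne'
    · exact h3
  have h3 := hP z hz
  rw [h2, mul_zero] at h3
  have h4 : l2Norm (volume.restrict Ω) z = 0 := by
    nlinarith [l2Norm_nonneg (volume.restrict Ω) z, sq_nonneg (l2Norm (volume.restrict Ω) z)]
  exact Triangulation.P1_eq_zero_of_ae hΩ.isOpen hz.1 (l2Norm_eq_zero hH.1 h4)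

/-- Unique solvability in `V_{h0}`. -/
theorem exists_gradForm_eq (hΩ : IsPolygonalDomain Ω) (hc : IsBoundedCoeff c N) (hε : 0 < ε)
    (hcε : ∀ i x, (c i x).im = ε)
    (hP : ∀ u ∈ 𝒯.Vh0 ΓD, l2Norm (volume.restrict Ω) u ^ 2 ≤ C * gradNorm Ω u ^ 2)
    (F : Module.Dual ℂ (𝒯.Vh0Sub ΓD)) :
    ∃ z ∈ 𝒯.Vh0 ΓD, ∀ η (hη : η ∈ 𝒯.Vh0 ΓD), gradForm Ω c z η = F ⟨η, hη⟩ := by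
  have hH : ∀ u : 𝒯.Vh0Sub ΓD, MemH1 Ω u.1 := fun u =>
    Triangulation.memH1_P1 hΩ.isOpen hΩ.isBounded u.2.1
  let L : 𝒯.Vh0Sub ΓD →ₗ[ℂ] Module.Dual ℂ (𝒯.Vh0Sub ΓD) :=
    LinearMap.mk₂ ℂ (fun z η => gradForm Ω c z.1 η.1)
      (fun z z' η => hc.gradForm_add hΩ.isOpen (hH z) (hH z') (hH η))
      (fun r z η => gradForm_smul hΩ.isOpen r (hH z))
      (fun z η η' => by
        rw [gradForm_comm, gradForm_comm Ω c z.1 η.1, gradForm_comm Ω c z.1 η'.1]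
        exact hc.gradForm_add hΩ.isOpen (hH η) (hH η') (hH z))
      (fun r z η => by
        rw [gradForm_comm, gradForm_comm Ω c z.1 η.1]
        exact gradForm_smul hΩ.isOpen r (hH η))
  have hinj : Function.Injective L := by
    refine LinearMap.ker_eq_bot.1 (LinearMap.ker_eq_bot'.2 fun z hz => Subtype.ext ?_)
    exact Vh0_eq_zero hΩ hc hε hcε hP z.2 fun η hη => DFunLike.congr_fun hz ⟨η, hη⟩
  -- Injectivity suffices because the space and its dual have the same finite dimension.
  obtain ⟨z, hz⟩ := (LinearMap.injective_iff_surjective_of_finrank_eq_finrank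
    Subspace.dual_finrank_eq.symm).1 hinj F
  exact ⟨z.1, z.2, fun η hη => by rw [← hz]; rfl⟩

variable {B : ℝ → Matrix (Fin 2) (Fin 2) ℝ} {s : 𝒯.EdgeChoice} {ζD g : Plane → ℝ}
  {ξh ζ : Plane → ℂ}

theorem isDiscreteSolution_iff (hΩ : IsPolygonalDomain Ω)
    (hB0 : ∀ t, B t 0 1 = 0) (hB1 : ∀ t, B t 1 0 = 0)
    (hc : IsBoundedCoeff (regCoeff B ε fun x => (ξh x).re) N) :
    IsDiscreteSolution s ΓD B ε ζD g ξh ζ ↔ ζ ∈ Triangulation.VhD s ΓD ζD ∧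
      ∀ η ∈ 𝒯.Vh0 ΓD, gradForm Ω (regCoeff B ε fun x => (ξh x).re) ζ η =
        neumannForm Ω ΓD g (star η) := by
  refine and_congr_right fun hζ => ?_
  have hζH := Triangulation.memH1_P1 hΩ.isOpen hΩ.isBounded hζ.1
  have key : ∀ η ∈ 𝒯.Vh0 ΓD, regForm Ω B ε (fun x => (ξh x).re) ζ (star η) =
      gradForm Ω (regCoeff B ε fun x => (ξh x).re) ζ η := fun η hη =>
    regForm_conj hΩ.isOpen hB0 hB1 hc hζH
      (Triangulation.memH1_P1 hΩ.isOpen hΩ.isBounded hη.1)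
  constructor
  · intro h η hη
    rw [← key η hη, h _ (Triangulation.Vh0_conj hη)]
  · intro h η hη
    have h1 := h _ (Triangulation.Vh0_conj hη)
    rwa [← key _ (Triangulation.Vh0_conj hη), star_star] at h1

/-- The real interpolant `w` satisfies the boundary conditions. Subtracting it leaves a problem in
`V_{h0}` with right-hand side `F`, the Neumann functional minus the form applied to `w`. -/
theorem existsUnique_isDiscreteSolution (hΩ : IsPolygonalDomain Ω)
    (hB0 : ∀ t, B t 0 1 = 0) (hB1 : ∀ t, B t 1 0 = 0) (hε : 0 < ε)
    (hc : IsBoundedCoeff (regCoeff B ε fun x => (ξh x).re) N)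
    (hP : ∀ u ∈ 𝒯.Vh0 ΓD, l2Norm (volume.restrict Ω) u ^ 2 ≤ C * gradNorm Ω u ^ 2)
    (hg : MemLp g 2 (neumannMeasure Ω ΓD)) :
    ∃! ζ, IsDiscreteSolution s ΓD B ε ζD g ξh ζ := by
  set c := regCoeff B ε fun x => (ξh x).re with hcdef
  have hcε : ∀ i x, (c i x).im = ε := fun i x => regCoeff_im _ _ _ _ _
  have hH : ∀ {u : Plane → ℂ}, u ∈ 𝒯.P1 ℂ → MemH1 Ω u := fun hu =>
    Triangulation.memH1_P1 hΩ.isOpen hΩ.isBounded hu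
  set w : Plane → ℂ := fun x => ((Triangulation.scottZhang s ζD x : ℝ) : ℂ) with hwdef
  have hw : w ∈ Triangulation.VhD s ΓD ζD := Triangulation.ofReal_scottZhang_mem_VhD s ζD
  have hint : ∀ u : 𝒯.Vh0Sub ΓD, Integrable (fun x => (g x : ℂ) * u.1 x)
      (neumannMeasure Ω ΓD) := fun u => by
    have := integrable_mul_mul (k := fun _ => 1) zero_le_one (fun _ => by simp)
      aestronglyMeasurable_const (MemLp.ofReal (K := ℂ) hg) (memLp_trace_P1 (ΓD := ΓD) hΩ u.2.1)
    simpa using this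
  let F : Module.Dual ℂ (𝒯.Vh0Sub ΓD) :=
    { toFun := fun η => neumannForm Ω ΓD g (star η.1) - gradForm Ω c w η.1
      map_add' := fun u v => by
        rw [neumannForm_conj, neumannForm_conj, neumannForm_conj, gradForm_comm Ω c w,
          gradForm_comm Ω c w, gradForm_comm Ω c w]
        have e1 : gradForm Ω c (u + v : 𝒯.Vh0Sub ΓD).1 w = _ :=
          hc.gradForm_add hΩ.isOpen (hH u.2.1) (hH v.2.1) (hH hw.1)
        have e2 : ∫ x, (g x : ℂ) * (u + v : 𝒯.Vh0Sub ΓD).1 x ∂(neumannMeasure Ω ΓD) =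
            (∫ x, (g x : ℂ) * u.1 x ∂(neumannMeasure Ω ΓD)) +
              ∫ x, (g x : ℂ) * v.1 x ∂(neumannMeasure Ω ΓD) := by
          rw [← integral_add (hint u) (hint v)]
          refine integral_congr_ae (ae_of_all _ fun x => ?_)
          exact mul_add _ _ _
        rw [e1, e2]
        ring
      map_smul' := fun r u => by
        rw [neumannForm_conj, neumannForm_conj, gradForm_comm Ω c w, gradForm_comm Ω c w]
        have e1 : gradForm Ω c (r • u : 𝒯.Vh0Sub ΓD).1 w = _ :=
          gradForm_smul hΩ.isOpen r (hH u.2.1)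
        have e2 : ∫ x, (g x : ℂ) * (r • u : 𝒯.Vh0Sub ΓD).1 x ∂(neumannMeasure Ω ΓD) =
            r * ∫ x, (g x : ℂ) * u.1 x ∂(neumannMeasure Ω ΓD) := by
          rw [← integral_const_mul]
          refine integral_congr_ae (ae_of_all _ fun x => ?_)
          exact mul_left_comm _ _ _
        rw [e1, e2]
        simp [mul_sub] }
  obtain ⟨z, hz, hzF⟩ := exists_gradForm_eq hΩ hc hε hcε hP F
  refine ⟨w + z, (isDiscreteSolution_iff hΩ hB0 hB1 hc).2
    ⟨Triangulation.VhD_add hw hz, fun η hη => ?_⟩, fun ζ hζ => ?_⟩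
  · rw [hc.gradForm_add hΩ.isOpen (hH hw.1) (hH hz.1) (hH hη.1), hzF η hη]
    exact add_sub_cancel _ _
  · obtain ⟨hζV, hζ⟩ := (isDiscreteSolution_iff hΩ hB0 hB1 hc).1 hζ
    have hd := Triangulation.VhD_sub hζV (Triangulation.VhD_add hw hz)
    have h0 := Vh0_eq_zero hΩ hc hε hcε hP hd fun η hη => by
      have e1 := hc.gradForm_add hΩ.isOpen (hH hd.1) (hH (Triangulation.VhD_add hw hz).1)
        (hH hη.1)
      rw [sub_add_cancel, hζ η hη, hc.gradForm_add hΩ.isOpen (hH hw.1) (hH hz.1) (hH hη.1),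
        hzF η hη] at e1
      have e2 : gradForm Ω c w η + F ⟨η, hη⟩ = neumannForm Ω ΓD g (star η) :=
        add_sub_cancel _ _
      rw [e2] at e1
      exact left_eq_add.1 (by rw [add_comm]; exact e1)
    exact sub_eq_zero.1 h0

/-- The a priori estimate, with a Poincaré constant `C` and a trace constant `T`. -/
theorem h1Norm_discreteSolution_le (hΩ : IsPolygonalDomain Ω)
    (hB0 : ∀ t, B t 0 1 = 0) (hB1 : ∀ t, B t 1 0 = 0) (hε : 0 < ε) (hC : 0 ≤ C)
    (hc : IsBoundedCoeff (regCoeff B ε fun x => (ξh x).re) N)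
    (hP : ∀ u ∈ 𝒯.Vh0 ΓD, l2Norm (volume.restrict Ω) u ^ 2 ≤ C * gradNorm Ω u ^ 2)
    (hg : MemLp g 2 (neumannMeasure Ω ΓD)) {T : ℝ} (hT : 0 < T)
    (htr : ∀ u ∈ 𝒯.P1 ℂ, l2Norm (neumannMeasure Ω ΓD) u ≤ T * h1Norm Ω u)
    (hζ : IsDiscreteSolution s ΓD B ε ζD g ξh ζ) :
    h1Norm Ω ζ ≤ 2 * (h1Norm Ω (Triangulation.scottZhang s ζD) +
      √(1 + C) * ((T * √(1 + C) * l2Norm (neumannMeasure Ω ΓD) g +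
        2 * N * h1Norm Ω (Triangulation.scottZhang s ζD)) / ε)) := by
  set c := regCoeff B ε fun x => (ξh x).re with hcdef
  have hcε : ∀ i x, (c i x).im = ε := fun i x => regCoeff_im _ _ _ _ _
  have hH : ∀ {u : Plane → ℂ}, u ∈ 𝒯.P1 ℂ → MemH1 Ω u := fun hu =>
    Triangulation.memH1_P1 hΩ.isOpen hΩ.isBounded hu
  obtain ⟨hζV, hζ⟩ := (isDiscreteSolution_iff hΩ hB0 hB1 hc).1 hζ
  set w : Plane → ℂ := fun x => ((Triangulation.scottZhang s ζD x : ℝ) : ℂ) with hwdef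
  have hw : w ∈ Triangulation.VhD s ΓD ζD := Triangulation.ofReal_scottZhang_mem_VhD s ζD
  have hwn : h1Norm Ω w = h1Norm Ω (Triangulation.scottZhang s ζD) :=
    MemH1.h1Norm_ofReal hΩ.isOpen (Triangulation.memH1_P1 hΩ.isOpen hΩ.isBounded
      (𝒯.nodalInterp_mem _))
  rw [← hwn]
  have hz := Triangulation.VhD_sub hζV hw
  set z := ζ - w with hzdef
  have hζe : ζ = w + z := by rw [hzdef, add_sub_cancel]
  have hzc := Triangulation.Vh0_conj hz
  have hzH := hH hz.1
  set G := l2Norm (neumannMeasure Ω ΓD) g with hGdef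
  set D := gradNorm Ω z with hDdef
  have hD0 : 0 ≤ D := gradNorm_nonneg _ _
  have hG0 : 0 ≤ G := l2Norm_nonneg _ _
  have hW0 := h1Norm_nonneg Ω w
  have hN0 := hc.nonneg
  have hzn : h1Norm Ω z ≤ √(1 + C) * D := by
    have h1 := h1Norm_sq Ω z
    have h2 := hP z hz
    have h3 : h1Norm Ω z ≤ √((1 + C) * D ^ 2) := Real.le_sqrt_of_sq_le (by
      rw [h1]; linarith)
    rwa [Real.sqrt_mul (by positivity), Real.sqrt_sq hD0] at h3
  have hform : gradForm Ω c z (star z) =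
      neumannForm Ω ΓD g z - gradForm Ω c w (star z) := by
    have e1 := hζ _ hzc
    rw [hζe, hc.gradForm_add hΩ.isOpen (hH hw.1) hzH hzH.conj, star_star] at e1
    rw [← e1]
    ring
  have him := hc.im_gradForm hΩ.isOpen hcε hzH
  -- The equation is tested with `z` itself; the left side is the imaginary part of the form at `z`.
  -- Trace and Poincaré inequalities reduce the Neumann term to the gradient norm `D`.
  have hle : ε * D ^ 2 ≤ (T * √(1 + C) * G + 2 * N * h1Norm Ω w) * D := by
    have h1 := norm_neumannForm_le hg (memLp_trace_P1 (ΓD := ΓD) hΩ hz.1)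
    have h2 := hc.norm_gradForm_le (hH hw.1) hzH.conj
    rw [hzH.gradNorm_conj hΩ.isOpen] at h2
    have h3 := (htr z hz.1).trans (mul_le_mul_of_nonneg_left hzn hT.le)
    have h4 := gradNorm_le_h1Norm Ω w
    calc ε * D ^ 2 = (gradForm Ω c z (star z)).im := him.symm
      _ ≤ ‖gradForm Ω c z (star z)‖ := (le_abs_self _).trans (Complex.abs_im_le_norm _)
      _ ≤ ‖neumannForm Ω ΓD g z‖ + ‖gradForm Ω c w (star z)‖ := by
          rw [hform]
          exact norm_sub_le _ _
      _ ≤ G * (T * (√(1 + C) * D)) + 2 * N * h1Norm Ω w * D := by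
          refine add_le_add (h1.trans (by gcongr)) (h2.trans (by gcongr))
      _ = _ := by ring
  have hDle : D ≤ (T * √(1 + C) * G + 2 * N * h1Norm Ω w) / ε := by
    rw [le_div_iff₀ hε]
    -- Dividing by `D` requires `D ≠ 0`; for `D = 0` the bound is trivial.
    rcases hD0.eq_or_lt with h0 | hpos
    · rw [← h0, zero_mul]
      positivity
    · refine le_of_mul_le_mul_right ?_ hpos
      linarith
  calc h1Norm Ω ζ ≤ 2 * (h1Norm Ω w + h1Norm Ω z) := by
        rw [hζe]
        exact MemH1.h1Norm_add_le hΩ.isOpen (hH hw.1) hzH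
    _ ≤ 2 * (h1Norm Ω w + √(1 + C) * D) := by gcongr
    _ ≤ _ := by gcongr

end Discrete

end Kirigami

end

/-! ### Choice of the constants and conclusion -/

theorem mainTheorem6 {Ω ΓD : Set Plane} (hΩ : IsPolygonalDomain Ω) (hΓD : ΓD ⊆ frontier Ω)
    (hΓD_closed : IsClosed ΓD) (hΓD_pos : 0 < (μH[1] : Measure Plane) ΓD) :
    ∃ C : ℝ, 0 < C ∧ ∃ Ctr : ℝ, 0 < Ctr ∧
      -- `C` is a Poincaré constant
      (∀ v ∈ V0 Ω ΓD, l2Norm (volume.restrict Ω) v ^ 2 ≤ C * gradNorm Ω v ^ 2) ∧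
      -- `Ctr` is a constant for the trace theorem
      (∀ ξD : Plane → ℝ, MemHHalf Ω ΓD ξD →
        ∃ ζD ∈ lifts Ω ΓD ξD, h1Norm Ω ζD ≤ Ctr * hHalfNorm Ω ΓD ξD) ∧
      ∀ (ι : Type*) (𝒯 : ι → Triangulation Ω),
        Triangulation.ShapeRegular 𝒯 → Triangulation.QuasiUniform 𝒯 →
        ∃ C' : ℝ, 0 < C' ∧
          -- `C'` is a stability constant for the interpolation
          (∀ (i : ι) (s : (𝒯 i).EdgeChoice) (v : Plane → ℝ), MemH1 Ω v →
            h1Norm Ω (Triangulation.scottZhang s v) ≤ C' * h1Norm Ω v) ∧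
          ∀ (α β ξm ξp M ε : ℝ), α ≤ 0 → 0 ≤ β →
            ξm ∈ Set.Icc (-(Real.pi / 2)) 0 → ξp ∈ Set.Icc 0 (Real.pi / 2) → 0 < M →
            (∀ t j k, |Bhat α β ξm ξp t j k| ≤ M) → 0 < ε →
            ∀ (i : ι) (s : (𝒯 i).EdgeChoice) (ξD ζD g : Plane → ℝ) (ξh : Plane → ℂ),
              MemHHalf Ω ΓD ξD → ζD ∈ lifts Ω ΓD ξD → MemLp g 2 (neumannMeasure Ω ΓD) →
              ξh ∈ Triangulation.VhD s ΓD ζD →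
              (∃! ζh : Plane → ℂ,
                IsDiscreteSolution s ΓD (Bhat α β ξm ξp) ε ζD g ξh ζh) ∧
              (h1Norm Ω ζD ≤ Ctr * hHalfNorm Ω ΓD ξD ∨ s.AdaptedTo ΓD →
                ∀ ζh : Plane → ℂ, IsDiscreteSolution s ΓD (Bhat α β ξm ξp) ε ζD g ξh ζh →
                  h1Norm Ω ζh ≤
                    C' * Ctr * (1 + M * √(1 + C) / ε) * hHalfNorm Ω ΓD ξD +
                      √(1 + C) / ε * l2Norm (neumannMeasure Ω ΓD) g) := by
  obtain ⟨C₀, hC₀, hPV, hPh⟩ := exists_poincare_V0 hΩ hΓD hΓD_closed hΓD_pos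
  obtain ⟨T, hT, htr⟩ := exists_trace_P1 hΩ ΓD ℂ
  -- The Poincaré constant is enlarged so that `√(1 + C) ≥ 2 T (1 + C₀)`, which is the factor in
  -- front of `‖g‖ / ε` in the energy estimate. It still depends only on `Ω` and `ΓD`.
  have hC₁ : C₀ ≤ C₀ + (2 * T * (1 + C₀)) ^ 2 := le_add_of_nonneg_right (sq_nonneg _)
  refine ⟨C₀ + (2 * T * (1 + C₀)) ^ 2, by positivity, 2, two_pos, fun v hv => ?_,
    fun ξD hξ => exists_lift hΩ hΓD hξ, ?_⟩
  · exact (hPV v hv).trans (mul_le_mul_of_nonneg_right hC₁ (sq_nonneg _))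
  intro ι 𝒯 ⟨σ, hσ, hshape⟩ ⟨τ, hτ, hquasi⟩
  obtain ⟨Q, hQ, hSZ⟩ := Triangulation.exists_scottZhang_constant (𝕜 := ℝ) hΩ hσ hτ
  have hstab : ∀ (i : ι) (s : (𝒯 i).EdgeChoice) (v : Plane → ℝ), MemH1 Ω v →
      h1Norm Ω (Triangulation.scottZhang s v) ≤ Q * h1Norm Ω v := fun i s v hv =>
    hSZ (𝒯 i) ⟨hσ, hτ, hshape i, hquasi i⟩ s v hv
  set r := √(1 + C₀) with hr
  have hr1 : 1 ≤ r := Real.one_le_sqrt.2 (by linarith)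
  -- The energy estimate gives the interpolant the factor `2 + 4 r (1 + M/ε)`, which is at most `6 r
  -- (1 + M/ε)` since `r ≥ 1`.
  refine ⟨6 * r * Q, by positivity, fun i s v hv => (hstab i s v hv).trans ?_, ?_⟩
  · refine mul_le_mul_of_nonneg_right ?_ (h1Norm_nonneg _ _)
    exact le_mul_of_one_le_left hQ.le (by linarith)
  intro α β ξm ξp M ε _ _ _ _ hM hB hε i s ξD ζD g ξh hξ hζD hg hξh
  have hc := isBoundedCoeff_regCoeff hM hε hB
    (Complex.measurable_re.comp (Triangulation.measurable_P1 hξh.1))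
  have hB0 : ∀ t, Bhat α β ξm ξp t 0 1 = 0 := fun t => by simp [Bhat]
  have hB1 : ∀ t, Bhat α β ξm ξp t 1 0 = 0 := fun t => by simp [Bhat]
  refine ⟨existsUnique_isDiscreteSolution hΩ hB0 hB1 hε hc (hPh (𝒯 i)) hg, fun hcase ζh hζh => ?_⟩
  have hH := hHalfNorm_nonneg Ω ΓD ξD
  -- Either the given lift is already good, or the edge choice is adapted and `ζh` also solves the
  -- problem posed with a good lift, since `V_{hD}` is the same.
  obtain ⟨z, hz, hzn, hzs⟩ : ∃ z ∈ lifts Ω ΓD ξD, h1Norm Ω z ≤ 2 * hHalfNorm Ω ΓD ξD ∧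
      IsDiscreteSolution s ΓD (Bhat α β ξm ξp) ε z g ξh ζh := by
    rcases hcase with h | h
    · exact ⟨ζD, hζD, h, hζh⟩
    · obtain ⟨z, hz, hzn⟩ := exists_lift hΩ hΓD hξ
      refine ⟨z, hz, hzn, ?_, hζh.2⟩
      rw [← Triangulation.VhD_eq hΩ h hζD hz]
      exact hζh.1
  have hest := h1Norm_discreteSolution_le hΩ hB0 hB1 hε hC₀.le hc (hPh (𝒯 i)) hg hT
    (htr (𝒯 i)) hzs
  have hS := (hstab i s z hz.1).trans (mul_le_mul_of_nonneg_left hzn hQ.le)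
  set S := h1Norm Ω (Triangulation.scottZhang s z) with hSdef
  have hS0 : 0 ≤ S := h1Norm_nonneg _ _
  set G := l2Norm (neumannMeasure Ω ΓD) g with hGdef
  have hG0 : 0 ≤ G := l2Norm_nonneg _ _
  set q := √(1 + (C₀ + (2 * T * (1 + C₀)) ^ 2)) with hq
  have hq1 : 1 ≤ q := Real.one_le_sqrt.2 (by nlinarith)
  have hq2 : 2 * (T * r * r) ≤ q := by
    have : r * r = 1 + C₀ := Real.mul_self_sqrt (by positivity)
    refine Real.le_sqrt_of_sq_le ?_
    rw [mul_assoc, this, ← mul_assoc]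
    linarith
  have hMε : M / ε ≤ M * q / ε := by
    gcongr
    exact le_mul_of_one_le_right hM.le hq1
  have hMε0 : 0 ≤ M / ε := by positivity
  calc h1Norm Ω ζh ≤ 2 * (S + r * ((T * r * G + 2 * (M + ε) * S) / ε)) := hest
    -- The coefficients are bounded by `M + ε`, not `M`; divided by `ε`, the extra `ε` becomes the
    -- `1` in `1 + M/ε`.
    _ = (2 + 4 * r * (1 + M / ε)) * S + 2 * (T * r * r) / ε * G := by
        field_simp
        ring
    _ ≤ 6 * r * (1 + M * q / ε) * S + q / ε * G := by
        gcongr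
        nlinarith [mul_nonneg (zero_le_one.trans hr1) hMε0]
    _ ≤ 6 * r * (1 + M * q / ε) * (Q * (2 * hHalfNorm Ω ΓD ξD)) + q / ε * G := by gcongr
    _ = _ := by ring
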